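/- Let $(a_j,b_j)$, $j\in\mathbb N$, be pairwise disjoint nonempty bounded open intervals in $[0,\infty)$ with $\sum_{j}(b_j-a_j)<\infty$, and let $\mathfrak E=[0,\infty)\setminus\bigcup_{j}(a_j,b_j)$. Let $c_j\in[a_j,b_j]$, $j\in\mathbb N$, and put $$m(z)=\frac{i}{2z^{1/2}}\prod_{j\in\mathbb N}\frac{z-c_j}{[(z-a_j)(z-b_j)]^{1/2}},\qquad z\in\mathbb C_+=\{z\in\mathbb C:\operatorname{Im} z>0\},$$ where $[(z-a_j)(z-b_j)]^{1/2}=(z-a_j)^{1/2}(z-b_j)^{1/2}$ and all square roots are principal; $m(x)$ for real $x\in(-\infty,0)\cup\bigcup_j(a_j,b_j)$ denotes the (real) boundary value $m(x+i0)$, which is given by the same formula. Suppose that $m$ is integrable on each interval $(a_j,b_j)$ and on $(-1,0)$, that $$-\int_{a_j}^{c_j}m(x)\,dx=\int_{c_j}^{b_j}m(x)\,dx,\qquad j\in\mathbb N,$$ and that $$\sum_{j\in\mathbb N}\int_{c_j}^{b_j}m(x)\,dx<\infty .$$ Then there is a nonnegative Borel measure $\rho$ on $\mathbb R$ with $\rho(\mathbb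 R\setminus\mathfrak E)=0$, $\int_{\mathfrak E}\frac{d\rho(\lambda)}{1+|\lambda|}<\infty$ and $$m(z)=\int_{\mathfrak E}\frac{d\rho(\lambda)}{\lambda-z},\qquad z\in\mathbb C_+,$$ and every such measure $\rho$ is absolutely continuous with respect to Lebesgue measure on $\mathbb R$. -/

import Mathlib

open MeasureTheory Set

noncomputable section

/-- The set `[0, ∞) \ ⋃ j, (a j, b j)`. -/
def gapSet (a b : ℕ → ℝ) : Set ℝ :=
  Ici 0 \ ⋃ j, Ioo (a j) (b j)

/-- The function `m(z) = (i / (2 z^{1/2})) ∏_j (z - c_j) / [(z - a_j)(z - b_j)]^{1/2}`.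

The branch on the open upper half-plane is the one that is positive on `(-∞, 0)`, with
`[(z - a)(z - b)]^{1/2}` asymptotic to `z` at infinity: it is obtained from the principal square
root (argument in `[0, π/2]` on the closed upper half-plane), as
`[(z - a)(z - b)]^{1/2} = (z - a)^{1/2} (z - b)^{1/2}`. Since the principal square root is
continuous on the closed upper half-plane, the same formula evaluated at a real point of
`(-∞, 0)` or of an interval `(a_j, b_j)` is the (real) value `m(x) = m(x + i0)`. -/
def herglotzProd (a b c : ℕ → ℝ) (z : ℂ) : ℂ :=
  Complex.I / (2 * z ^ (1 / 2 : ℂ)) *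
    ∏' j, (z - (c j : ℂ)) / ((z - (a j : ℂ)) ^ (1 / 2 : ℂ) * (z - (b j : ℂ)) ^ (1 / 2 : ℂ))

/-- `ρ` is a (nonnegative Borel) measure carried by `E`, with `∫ dρ(t) / (1 + |t|) < ∞`, that
represents `m` on the upper half-plane: `m(z) = ∫_E dρ(t) / (t - z)`. -/
structure IsHerglotzMeasure (m : ℂ → ℂ) (E : Set ℝ) (ρ : Measure ℝ) : Prop where
  compl_eq_zero : ρ Eᶜ = 0
  integrable : Integrable (fun t : ℝ => 1 / (1 + |t|)) ρ
  eq_integral : ∀ z : ℂ, 0 < z.im → m z = ∫ t : ℝ, 1 / ((t : ℂ) - z) ∂ρ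

end

/-!
Write `m = herglotzProd a b c`. On the upper half-plane `m = i exp Λ` with `Λ = prodLog a b c`, a sum
of logarithms, so that all powers of `m / i` are at hand. Each gap changes the argument of `m / i` by
at most half the angle under which the gap is seen (`abs_im_prodLog_le`). Hence the argument lies in
`[-π / 2, π / 2]`, that is `Im m ≥ 0`, and it tends to zero in the mean on `gapSet`
(`tendsto_lintegral_im_prodLog`). On the gaps and on the negative axis `m` has real boundary values,
negative to the left of `c j` and positive to the right of it, so the balance condition turns the
summability condition into integrability of `|m|` over the union of the gaps
(`integrableOn_norm_herglotzProd`).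

Existence of a representing measure needs only `Im m ≥ 0` and the decay of `m` at infinity: the
measures `Im m(x + i ε) dx / (π (1 + |x|))` are tight by Poisson's formula, and Prokhorov's theorem
gives a limit (`exists_measure_of_im_nonneg`). It does not charge the gaps and the negative axis,
where `Im m` tends to zero (`IsHerglotzMeasure.measure_compl_gapSet`).

For absolute continuity, consider the square root `p = (m / i) ^ (1 / 2) = exp (Λ / 2)`. Kolmogorov's
estimate bounds `|p| ^ (3 / 2)` in the mean with the weight `1 / (1 + x²)`, uniformly along
horizontal lines (`exists_integral_rpow_le`), so the functions `Im p(x + i ε)` are uniformly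
integrable and converge in mean to a function `v`, which vanishes on `gapSet` and satisfies
`v² ≤ |m|` elsewhere. So `v` is square integrable for the weight `1 / (1 + x²)`, and `p` is given by
Nevanlinna's formula with the density `v` and no singular part (`exp_half_prodLog_eq_integral`). If
`ρ` represents `m`, its Poisson integral is `Im m ≤ |p|²`. Near a compact null set, `p` is the sum of
a bounded function and of the Cauchy integral of a piece of `v` of small `L²` norm, which is small in
`L²` along horizontal lines (`lintegral_enorm_lineCauchy_sq_le`). Therefore `ρ` has no mass on the
null set (`absolutelyContinuous_of_nevanlinna`).
-/

open Filter Topology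

/-! ### Integrals of holomorphic functions along the boundary of the upper half-plane -/

/-- Cauchy's theorem for the upper half-plane: only the decay of `F` far out is needed, as the
contours are the rectangles `[-T, T] × [0, T]`. -/
theorem integral_eq_zero_of_decay {F : ℂ → ℂ} {C s R : ℝ} (hs : 1 < s) (hR : 0 < R) (hC : 0 ≤ C)
    (hd : ∀ z : ℂ, 0 ≤ z.im → DifferentiableAt ℂ F z) (hi : Integrable fun x : ℝ => F x)
    (hb : ∀ z : ℂ, 0 ≤ z.im → R ≤ ‖z‖ → ‖F z‖ ≤ C * ‖z‖ ^ (-s)) :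
    ∫ x : ℝ, F x = 0 := by
  have h1 : Tendsto (fun T : ℝ => ∫ x in (-T)..T, F x) atTop (𝓝 (∫ x : ℝ, F x)) :=
    intervalIntegral_tendsto_integral hi tendsto_neg_atTop_atBot tendsto_id
  have h2 : ∀ᶠ T : ℝ in atTop, ‖∫ x in (-T)..T, F x‖ ≤ 4 * C * T ^ (-(s - 1)) := by
    filter_upwards [eventually_ge_atTop R] with T hT
    have hT0 : 0 < T := hR.trans_le hT
    have key := Complex.integral_boundary_rect_eq_zero_of_differentiableOn F (-T : ℂ)
      (T + T * Complex.I) (fun z hz => by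
        refine (hd z ?_).differentiableWithinAt
        have := hz.2
        simp [uIcc_of_le hT0.le] at this
        exact this.1)
    simp only [Complex.neg_re, Complex.ofReal_re, Complex.add_re, Complex.mul_re, Complex.I_re,
      mul_zero, Complex.ofReal_im, Complex.I_im, mul_one, sub_self, add_zero, Complex.neg_im,
      neg_zero, Complex.ofReal_zero, zero_mul, Complex.add_im, Complex.mul_im, zero_add,
      Complex.ofReal_neg] at key
    have bd : ∀ z : ℂ, 0 ≤ z.im → T ≤ ‖z‖ → ‖F z‖ ≤ C * T ^ (-s) := fun z hz hzT =>
      (hb z hz (hT.trans hzT)).trans (mul_le_mul_of_nonneg_left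
        (Real.rpow_le_rpow_of_nonpos hT0 hzT (by linarith)) hC)
    have e1 : ‖∫ x in (-T)..T, F (x + T * Complex.I)‖ ≤ C * T ^ (-s) * |T - -T| := by
      refine intervalIntegral.norm_integral_le_of_norm_le_const fun x _ => bd _ (by simp [hT0.le]) ?_
      refine le_trans ?_ (Complex.abs_im_le_norm _)
      simp [le_abs_self]
    have e2 : ‖∫ y in (0 : ℝ)..T, F (T + y * Complex.I)‖ ≤ C * T ^ (-s) * |T - 0| := by
      refine intervalIntegral.norm_integral_le_of_norm_le_const fun y hy => bd _ ?_ ?_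
      · rw [uIoc_of_le hT0.le] at hy
        simp [hy.1.le]
      · refine le_trans ?_ (Complex.abs_re_le_norm _)
        simp [le_abs_self]
    have e3 : ‖∫ y in (0 : ℝ)..T, F (-T + y * Complex.I)‖ ≤ C * T ^ (-s) * |T - 0| := by
      refine intervalIntegral.norm_integral_le_of_norm_le_const fun y hy => bd _ ?_ ?_
      · rw [uIoc_of_le hT0.le] at hy
        simp [hy.1.le]
      · refine le_trans ?_ (Complex.abs_re_le_norm _)
        simp [le_abs_self]
    have e4 : ∫ x in (-T)..T, F x = (∫ x in (-T)..T, F (x + T * Complex.I))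
        - Complex.I * (∫ y in (0 : ℝ)..T, F (T + y * Complex.I))
        + Complex.I * ∫ y in (0 : ℝ)..T, F (-T + y * Complex.I) := by
      simp only [smul_eq_mul] at key
      linear_combination key
    have e5 : T ^ (-(s - 1)) = T ^ (-s) * T := by
      rw [show -(s - 1) = -s + 1 by ring, Real.rpow_add hT0, Real.rpow_one]
    rw [e4, e5]
    rw [sub_neg_eq_add, abs_of_pos (by linarith)] at e1
    rw [sub_zero, abs_of_pos hT0] at e2 e3
    calc _ ≤ ‖(∫ x in (-T)..T, F (x + T * Complex.I))‖
          + ‖Complex.I * (∫ y in (0 : ℝ)..T, F (T + y * Complex.I))‖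
          + ‖Complex.I * ∫ y in (0 : ℝ)..T, F (-T + y * Complex.I)‖ :=
          (norm_add_le _ _).trans (add_le_add_left (norm_sub_le _ _) _)
      _ ≤ _ := by
          rw [norm_mul, norm_mul, Complex.norm_I, one_mul, one_mul]
          linarith
  have h3 : Tendsto (fun T : ℝ => 4 * C * T ^ (-(s - 1))) atTop (𝓝 0) := by
    simpa using (tendsto_rpow_neg_atTop (show 0 < s - 1 by linarith)).const_mul (4 * C)
  exact tendsto_nhds_unique h1 (squeeze_zero_norm' h2 h3)

theorem continuous_comp_horizontal {β : Type*} [TopologicalSpace β] {F : ℂ → β}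
    (hF : ∀ z : ℂ, 0 < z.im → ContinuousAt F z) {ε : ℝ} (hε : 0 < ε) :
    Continuous fun x : ℝ => F (x + ε * Complex.I) := by
  rw [continuous_iff_continuousAt]
  intro x
  refine Tendsto.comp (hF (x + ε * Complex.I) (by simp [hε])) ?_
  have : Continuous fun x : ℝ => (x : ℂ) + ε * Complex.I := by fun_prop
  exact this.tendsto x

/-- On the closed upper half-plane the distance to `conj z` is comparable to `1 + ‖ζ‖`. -/
theorem norm_sub_conj_lower {z ζ : ℂ} (hz : 0 < z.im) (hζ : 0 ≤ ζ.im) :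
    1 + ‖ζ‖ ≤ ((1 + ‖z‖) / z.im + 1) * ‖ζ - (starRingEnd ℂ) z‖ := by
  have h1 : z.im ≤ ‖ζ - (starRingEnd ℂ) z‖ := by
    refine le_trans ?_ (Complex.abs_im_le_norm _)
    rw [Complex.sub_im, Complex.conj_im, sub_neg_eq_add]
    exact (by linarith : z.im ≤ ζ.im + z.im).trans (le_abs_self _)
  have h2 : ‖ζ‖ ≤ ‖ζ - (starRingEnd ℂ) z‖ + ‖z‖ := by
    have := norm_add_le (ζ - (starRingEnd ℂ) z) ((starRingEnd ℂ) z)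
    simpa using this
  have h3 : 1 + ‖z‖ ≤ (1 + ‖z‖) / z.im * ‖ζ - (starRingEnd ℂ) z‖ := by
    rw [div_mul_eq_mul_div, le_div_iff₀ hz]
    gcongr
  linarith

theorem ofReal_sub_ne_zero {z : ℂ} (hz : 0 < z.im) (x : ℝ) : (x : ℂ) - z ≠ 0 := by
  intro h
  have := congrArg Complex.im h
  simp at this
  linarith

theorem ofReal_sub_conj_ne_zero {z : ℂ} (hz : 0 < z.im) (x : ℝ) :
    (x : ℂ) - (starRingEnd ℂ) z ≠ 0 := by
  intro h
  have := congrArg Complex.im h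
  simp at this
  linarith

theorem norm_ofReal_sub_conj (z : ℂ) (x : ℝ) : ‖(x : ℂ) - (starRingEnd ℂ) z‖ = ‖(x : ℂ) - z‖ := by
  rw [← Complex.norm_conj ((x : ℂ) - z)]
  simp

theorem one_add_abs_le_norm_sub {z : ℂ} (hz : 0 < z.im) (x : ℝ) :
    1 + |x| ≤ ((1 + ‖z‖) / z.im + 1) * ‖(x : ℂ) - z‖ := by
  have := norm_sub_conj_lower (ζ := x) hz (by simp)
  rwa [norm_ofReal_sub_conj, Complex.norm_real, Real.norm_eq_abs] at this

/-- The Poisson kernel of the upper half-plane, up to the factor `1 / π`: its value for the point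
`x + i y` at the boundary point `x - u` or `x + u`. -/
noncomputable def poissonLine (y u : ℝ) : ℝ := y / (u ^ 2 + y ^ 2)

theorem poissonLine_nonneg {y : ℝ} (hy : 0 ≤ y) (u : ℝ) : 0 ≤ poissonLine y u := by
  unfold poissonLine; positivity

theorem poissonLine_eq {y : ℝ} (hy : 0 < y) (u : ℝ) :
    poissonLine y u = y⁻¹ * (1 + (y⁻¹ * u) ^ 2)⁻¹ := by
  unfold poissonLine
  field_simp
  ring

theorem integrable_poissonLine {y : ℝ} (hy : 0 < y) : Integrable (poissonLine y) := by
  have := (integrable_inv_one_add_sq.comp_mul_left' (R := y⁻¹) (by positivity)).const_mul y⁻¹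
  refine this.congr (Eventually.of_forall fun u => ?_)
  simp [poissonLine_eq hy]

theorem integral_poissonLine {y : ℝ} (hy : 0 < y) : ∫ u, poissonLine y u = Real.pi := by
  simp_rw [poissonLine_eq hy]
  rw [integral_const_mul, Measure.integral_comp_mul_left (fun u => (1 + u ^ 2)⁻¹),
    integral_univ_inv_one_add_sq]
  simp [abs_of_pos hy]
  field_simp

theorem integrable_poissonLine_sub {y : ℝ} (hy : 0 < y) (x : ℝ) :
    Integrable fun t => poissonLine y (t - x) := (integrable_poissonLine hy).comp_sub_right x

theorem integral_poissonLine_sub {y : ℝ} (hy : 0 < y) (x : ℝ) :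
    ∫ t, poissonLine y (t - x) = Real.pi := by
  rw [integral_sub_right_eq_self (poissonLine y), integral_poissonLine hy]

theorem poissonLine_neg (y u : ℝ) : poissonLine y (-u) = poissonLine y u := by
  simp [poissonLine]

@[fun_prop]
theorem measurable_poissonLine : Measurable fun q : ℝ × ℝ => poissonLine q.1 q.2 := by
  unfold poissonLine; fun_prop

theorem continuous_poissonLine {y : ℝ} (hy : 0 < y) : Continuous (poissonLine y) := by
  unfold poissonLine
  exact continuous_const.div (by fun_prop) fun u => by positivity

theorem normSq_ofReal_sub (z : ℂ) (x : ℝ) :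
    Complex.normSq ((x : ℂ) - z) = (x - z.re) ^ 2 + z.im ^ 2 := by
  simp [Complex.normSq_apply]
  ring

theorem im_inv_ofReal_sub (z : ℂ) (x : ℝ) :
    (((x : ℂ) - z)⁻¹).im = poissonLine z.im (x - z.re) := by
  rw [Complex.inv_im, normSq_ofReal_sub]
  simp [poissonLine]

theorem sub_mul_sub_conj (z : ℂ) (x : ℝ) :
    ((x : ℂ) - z) * ((x : ℂ) - (starRingEnd ℂ) z) = (((x - z.re) ^ 2 + z.im ^ 2 : ℝ) : ℂ) := by
  rw [← normSq_ofReal_sub, ← Complex.mul_conj]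
  simp

/-- Schwarz's formula for the upper half-plane: a holomorphic function that decays at infinity is
recovered from the boundary values of its imaginary part. -/
theorem schwarz_formula {F : ℂ → ℂ} {C s : ℝ} (hs : 0 < s)
    (hd : ∀ z : ℂ, 0 ≤ z.im → DifferentiableAt ℂ F z)
    (hb : ∀ z : ℂ, 0 ≤ z.im → ‖F z‖ ≤ C * (1 + ‖z‖) ^ (-s)) {z : ℂ} (hz : 0 < z.im) :
    Integrable (fun x : ℝ => ((F x).im : ℂ) * ((x : ℂ) - z)⁻¹) ∧
    Real.pi * F z = ∫ x : ℝ, ((F x).im : ℂ) * ((x : ℂ) - z)⁻¹ := by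
  have hC : 0 ≤ C := by
    have := (norm_nonneg _).trans (hb 0 (by simp))
    simpa using this
  set zc := (starRingEnd ℂ) z with hzc
  set κ := (1 + ‖z‖) / z.im + 1 with hκ
  have hκ0 : 0 < κ := by positivity
  have hcont : Continuous fun x : ℝ => F x := by
    rw [continuous_iff_continuousAt]
    intro x
    exact (hd x (by simp)).continuousAt.comp (Complex.continuous_ofReal.continuousAt)
  have hbx : ∀ x : ℝ, ‖F x‖ ≤ C * (1 + |x|) ^ (-s) := fun x => by
    simpa using hb x (by simp)
  have hdom : Integrable fun x : ℝ => C * κ * (1 + ‖x‖) ^ (-(1 + s)) :=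
    (integrable_one_add_norm (by simp [hs])).const_mul _
  have hinvz : ∀ x : ℝ, ‖((x : ℂ) - z)⁻¹‖ ≤ κ * (1 + |x|)⁻¹ := fun x => by
    rw [norm_inv, inv_le_iff_one_le_mul₀ (norm_pos_iff.2 (ofReal_sub_ne_zero hz x))]
    rw [mul_right_comm, ← div_eq_mul_inv, one_le_div (by positivity)]
    exact one_add_abs_le_norm_sub hz x
  have hinvzc : ∀ x : ℝ, ‖((x : ℂ) - zc)⁻¹‖ ≤ κ * (1 + |x|)⁻¹ := fun x => by
    rw [norm_inv, norm_ofReal_sub_conj, ← norm_inv]; exact hinvz x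
  have hpow : ∀ x : ℝ, C * (1 + |x|) ^ (-s) * (κ * (1 + |x|)⁻¹) =
      C * κ * (1 + ‖x‖) ^ (-(1 + s)) := fun x => by
    rw [Real.norm_eq_abs, show -(1 + s) = -s + -1 by ring, Real.rpow_add (by positivity),
      Real.rpow_neg_one]
    ring
  have hczinv : Continuous fun x : ℝ => ((x : ℂ) - z)⁻¹ :=
    (by fun_prop : Continuous fun x : ℝ => (x : ℂ) - z).inv₀ fun x => ofReal_sub_ne_zero hz x
  have hczcinv : Continuous fun x : ℝ => ((x : ℂ) - zc)⁻¹ :=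
    (by fun_prop : Continuous fun x : ℝ => (x : ℂ) - zc).inv₀ fun x => ofReal_sub_conj_ne_zero hz x
  have hI1 : Integrable fun x : ℝ => F x * ((x : ℂ) - z)⁻¹ := by
    refine hdom.mono' (hcont.mul hczinv).aestronglyMeasurable (Eventually.of_forall fun x => ?_)
    rw [norm_mul, ← hpow]
    exact mul_le_mul (hbx x) (hinvz x) (norm_nonneg _) (by positivity)
  have hI2 : Integrable fun x : ℝ => F x * ((x : ℂ) - zc)⁻¹ := by
    refine hdom.mono' (hcont.mul hczcinv).aestronglyMeasurable (Eventually.of_forall fun x => ?_)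
    rw [norm_mul, ← hpow]
    exact mul_le_mul (hbx x) (hinvzc x) (norm_nonneg _) (by positivity)
  -- the pole at `conj z` lies outside the half-plane
  have h0 : ∫ x : ℝ, F x * ((x : ℂ) - zc)⁻¹ = 0 := by
    refine integral_eq_zero_of_decay (F := fun ζ => F ζ * (ζ - zc)⁻¹) (C := C * κ) (s := 1 + s)
      (R := 1) (by linarith) one_pos (by positivity) ?_ hI2 ?_
    · intro ζ hζ
      refine (hd ζ hζ).mul ((differentiableAt_id.sub_const zc).inv ?_)
      intro h
      have := norm_sub_conj_lower hz hζ
      rw [← hzc] at this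
      simp only [id] at h
      rw [h] at this
      simp at this
      linarith [norm_nonneg ζ]
    · intro ζ hζ h1
      have h2 := norm_sub_conj_lower hz hζ
      rw [← hzc, ← hκ] at h2
      have h3 : 0 < ‖ζ - zc‖ := by
        by_contra h
        have : κ * ‖ζ - zc‖ ≤ 0 := mul_nonpos_of_nonneg_of_nonpos hκ0.le (not_lt.1 h)
        linarith [norm_nonneg ζ]
      have h4 : ‖(ζ - zc)⁻¹‖ ≤ κ * ‖ζ‖⁻¹ := by
        rw [norm_inv, inv_le_iff_one_le_mul₀ h3, mul_right_comm, ← div_eq_mul_inv,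
          one_le_div (by linarith)]
        linarith
      have h5 : ‖F ζ‖ ≤ C * ‖ζ‖ ^ (-s) := (hb ζ hζ).trans (mul_le_mul_of_nonneg_left
        (Real.rpow_le_rpow_of_nonpos (by linarith) (by linarith) (by linarith)) hC)
      rw [norm_mul]
      calc _ ≤ C * ‖ζ‖ ^ (-s) * (κ * ‖ζ‖⁻¹) :=
            mul_le_mul h5 h4 (norm_nonneg _) (by positivity)
        _ = _ := by
            rw [show -(1 + s) = -s + -1 by ring, Real.rpow_add (by linarith), Real.rpow_neg_one]
            ring
  -- the mean value property with respect to the Poisson kernel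
  have hPI : Integrable fun x : ℝ => ((poissonLine z.im (x - z.re) : ℝ) : ℂ) :=
    (integrable_poissonLine_sub hz z.re).ofReal
  have hFP : Integrable fun x : ℝ => F x * ((poissonLine z.im (x - z.re) : ℝ) : ℂ) := by
    refine hPI.bdd_mul (c := C) hcont.aestronglyMeasurable (Eventually.of_forall fun x => ?_)
    refine (hbx x).trans (mul_le_of_le_one_right hC ?_)
    exact Real.rpow_le_one_of_one_le_of_nonpos (by linarith [abs_nonneg x]) (by linarith)
  have hker : ∀ x : ℝ, ((x : ℂ) - z)⁻¹ * ((x : ℂ) - zc)⁻¹ * (z.im : ℂ) =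
      ((poissonLine z.im (x - z.re) : ℝ) : ℂ) := fun x => by
    rw [← mul_inv, sub_mul_sub_conj, poissonLine, ← Complex.ofReal_inv, ← Complex.ofReal_mul]
    congr 1
    field_simp
  have hG : ∫ x : ℝ, (dslope F z x) * ((x : ℂ) - zc)⁻¹ * (z.im : ℂ) = 0 := by
    have hds : ∀ x : ℝ, (dslope F z x) * ((x : ℂ) - zc)⁻¹ * (z.im : ℂ) =
        (F x - F z) * ((poissonLine z.im (x - z.re) : ℝ) : ℂ) := fun x => by
      rw [← hker, dslope_of_ne _ (sub_ne_zero.1 (ofReal_sub_ne_zero hz x)), slope_def_field]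
      ring
    have hds_int : Integrable fun x : ℝ => (dslope F z x) * ((x : ℂ) - zc)⁻¹ * (z.im : ℂ) := by
      simp_rw [hds, sub_mul]
      exact hFP.sub (hPI.const_mul _)
    refine integral_eq_zero_of_decay (F := fun ζ => dslope F z ζ * (ζ - zc)⁻¹ * (z.im : ℂ))
      (C := (2 * C) * 2 * κ * z.im) (s := 2) (R := 2 * ‖z‖ + 1) (by norm_num) (by positivity)
      (by positivity) ?_ hds_int ?_
    · intro ζ hζ
      refine (DifferentiableAt.mul ?_ ((differentiableAt_id.sub_const zc).inv ?_)).mul_const _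
      · by_cases hζz : ζ = z
        · have ho : {w : ℂ | 0 < w.im} ∈ 𝓝 z :=
            (isOpen_lt continuous_const Complex.continuous_im).mem_nhds hz
          have h1 : DifferentiableOn ℂ F {w : ℂ | 0 < w.im} := fun w hw =>
            (hd w (le_of_lt hw)).differentiableWithinAt
          rw [hζz]
          exact ((Complex.differentiableOn_dslope ho).2 h1).differentiableAt ho
        · exact (differentiableAt_dslope_of_ne hζz).2 (hd ζ hζ)
      · intro h
        have := norm_sub_conj_lower hz hζ
        simp only [id] at h
        rw [← hzc, h] at this
        simp at this
        linarith [norm_nonneg ζ]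
    · intro ζ hζ h1
      have hζ0 : 0 < ‖ζ‖ := by linarith [norm_nonneg z]
      have hne : ζ ≠ z := by
        rintro rfl
        linarith [norm_nonneg ζ]
      have h2 : ‖ζ‖ ≤ 2 * ‖ζ - z‖ := by
        have := norm_sub_norm_le ζ z
        linarith
      have h2' : ‖(ζ - z)⁻¹‖ ≤ 2 * ‖ζ‖⁻¹ := by
        rw [norm_inv, inv_le_iff_one_le_mul₀ (by linarith), mul_right_comm, ← div_eq_mul_inv,
          one_le_div hζ0]
        exact h2
      have h3 := norm_sub_conj_lower hz hζ
      rw [← hzc, ← hκ] at h3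
      have h3' : 0 < ‖ζ - zc‖ := by
        by_contra h
        have : κ * ‖ζ - zc‖ ≤ 0 := mul_nonpos_of_nonneg_of_nonpos hκ0.le (not_lt.1 h)
        linarith
      have h4 : ‖(ζ - zc)⁻¹‖ ≤ κ * ‖ζ‖⁻¹ := by
        rw [norm_inv, inv_le_iff_one_le_mul₀ h3', mul_right_comm, ← div_eq_mul_inv,
          one_le_div (by linarith)]
        linarith
      have h5 : ∀ w : ℂ, 0 ≤ w.im → ‖F w‖ ≤ C := fun w hw =>
        (hb w hw).trans (mul_le_of_le_one_right hC
          (Real.rpow_le_one_of_one_le_of_nonpos (by linarith [norm_nonneg w]) (by linarith)))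
      have h6 : ‖F ζ - F z‖ ≤ 2 * C := by
        have := norm_sub_le (F ζ) (F z)
        linarith [h5 ζ hζ, h5 z hz.le]
      rw [dslope_of_ne _ hne, slope_def_field, div_eq_mul_inv, norm_mul, norm_mul, norm_mul,
        Complex.norm_real, Real.norm_of_nonneg hz.le]
      calc _ ≤ (2 * C) * (2 * ‖ζ‖⁻¹) * (κ * ‖ζ‖⁻¹) * z.im := by gcongr
        _ = _ := by
          rw [Real.rpow_neg hζ0.le, Real.rpow_two]
          field_simp
  have hmean : ∫ x : ℝ, F x * ((poissonLine z.im (x - z.re) : ℝ) : ℂ) = Real.pi * F z := by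
    have hds : ∀ x : ℝ, (dslope F z x) * ((x : ℂ) - zc)⁻¹ * (z.im : ℂ) =
        F x * ((poissonLine z.im (x - z.re) : ℝ) : ℂ)
          - F z * ((poissonLine z.im (x - z.re) : ℝ) : ℂ) := fun x => by
      rw [← hker, dslope_of_ne _ (sub_ne_zero.1 (ofReal_sub_ne_zero hz x)), slope_def_field]
      ring
    simp_rw [hds] at hG
    rw [integral_sub hFP (hPI.const_mul _), integral_const_mul, integral_complex_ofReal,
      integral_poissonLine_sub hz] at hG
    linear_combination hG
  have h1 : ∫ x : ℝ, F x * ((x : ℂ) - z)⁻¹ = 2 * Complex.I * (Real.pi * F z) := by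
    have e : ∀ x : ℝ, F x * ((x : ℂ) - z)⁻¹ = F x * ((x : ℂ) - zc)⁻¹ +
        2 * Complex.I * (F x * ((poissonLine z.im (x - z.re) : ℝ) : ℂ)) := fun x => by
      have hy : (2 * Complex.I * (z.im : ℂ)) = ((x : ℂ) - zc) - ((x : ℂ) - z) := by
        rw [hzc]
        apply Complex.ext <;> simp
        ring
      have ha := ofReal_sub_ne_zero hz x
      have hb := ofReal_sub_conj_ne_zero hz x
      rw [← hzc] at hb
      rw [← hker]
      calc _ = F x * ((x : ℂ) - zc)⁻¹ + F x * ((x : ℂ) - z)⁻¹ * ((x : ℂ) - zc)⁻¹ *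
            (((x : ℂ) - zc) - ((x : ℂ) - z)) := by field_simp; ring
        _ = _ := by rw [← hy]; ring
    simp_rw [e]
    rw [integral_add hI2 (hFP.const_mul _), integral_const_mul, hmean, h0, zero_add]
  -- conjugation turns the vanishing of the integral with pole `conj z` into that of the integral of
  -- `conj F` with pole `z`, so that only `F / (2 i)` contributes
  have hI2c : Integrable fun x : ℝ => (starRingEnd ℂ) (F x) * ((x : ℂ) - z)⁻¹ := by
    have h := (Complex.conjCLE.toContinuousLinearMap.integrable_comp hI2)
    refine h.congr (Eventually.of_forall fun x => ?_)
    simp [hzc]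
  have h2 : ∫ x : ℝ, (starRingEnd ℂ) (F x) * ((x : ℂ) - z)⁻¹ = 0 := by
    have h := congrArg (starRingEnd ℂ) h0
    rw [← integral_conj] at h
    simpa [hzc] using h
  have e : ∀ x : ℝ, ((F x).im : ℂ) * ((x : ℂ) - z)⁻¹ = (2 * Complex.I)⁻¹ *
      (F x * ((x : ℂ) - z)⁻¹ - (starRingEnd ℂ) (F x) * ((x : ℂ) - z)⁻¹) := fun x => by
    rw [← sub_mul, Complex.sub_conj, ← mul_assoc]
    have : (2 * Complex.I : ℂ) ≠ 0 := by simp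
    field_simp
    push_cast
    ring
  simp_rw [e]
  refine ⟨(hI1.sub hI2c).const_mul _, ?_⟩
  rw [integral_const_mul, integral_sub hI1 hI2c, h1, h2, sub_zero, ← mul_assoc,
    inv_mul_cancel₀ (by simp), one_mul]

theorem im_integral_eq {α : Type*} [MeasurableSpace α] {μ : Measure α} {g : α → ℂ}
    (hg : Integrable g μ) : (∫ x, g x ∂μ).im = ∫ x, (g x).im ∂μ := (integral_im hg).symm

theorem re_integral_eq {α : Type*} [MeasurableSpace α] {μ : Measure α} {g : α → ℂ}
    (hg : Integrable g μ) : (∫ x, g x ∂μ).re = ∫ x, (g x).re ∂μ := (integral_re hg).symm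

/-- Poisson's formula for the imaginary part of a holomorphic function that decays at infinity. -/
theorem poisson_formula_im {F : ℂ → ℂ} {C s : ℝ} (hs : 0 < s)
    (hd : ∀ z : ℂ, 0 ≤ z.im → DifferentiableAt ℂ F z)
    (hb : ∀ z : ℂ, 0 ≤ z.im → ‖F z‖ ≤ C * (1 + ‖z‖) ^ (-s)) {z : ℂ} (hz : 0 < z.im) :
    Integrable (fun x : ℝ => (F x).im * poissonLine z.im (x - z.re)) ∧
    Real.pi * (F z).im = ∫ x : ℝ, (F x).im * poissonLine z.im (x - z.re) := by
  obtain ⟨hi, h⟩ := schwarz_formula hs hd hb hz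
  have e : ∀ x : ℝ, (((F x).im : ℂ) * ((x : ℂ) - z)⁻¹).im =
      (F x).im * poissonLine z.im (x - z.re) := fun x => by
    rw [Complex.im_ofReal_mul, im_inv_ofReal_sub]
  have h1 := hi.im
  have h2 := congrArg Complex.im h
  rw [Complex.im_ofReal_mul, im_integral_eq hi] at h2
  simp only [RCLike.im_eq_complex_im, e] at h1 h2
  exact ⟨h1, h2⟩

/-- The kernel `1 / (x - z) - x / (1 + x ^ 2)` of the Nevanlinna representation, in the form that
shows its decay in `x`. -/
noncomputable def nevanlinnaKernel (z : ℂ) (x : ℝ) : ℂ :=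
  (1 + x * z) * ((x : ℂ) - z)⁻¹ * ((1 + x ^ 2)⁻¹ : ℝ)

theorem nevanlinnaKernel_eq {z : ℂ} (hz : 0 < z.im) (x : ℝ) :
    nevanlinnaKernel z x = ((x : ℂ) - z)⁻¹ - ((x * (1 + x ^ 2)⁻¹ : ℝ) : ℂ) := by
  have h := ofReal_sub_ne_zero hz x
  have h2 : ((1 + x ^ 2 : ℝ) : ℂ) ≠ 0 := by
    exact_mod_cast (by positivity : (1 + x ^ 2 : ℝ) ≠ 0)
  rw [nevanlinnaKernel, Complex.ofReal_mul, Complex.ofReal_inv]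
  field_simp
  push_cast
  ring

theorem norm_nevanlinnaKernel_le {z : ℂ} (hz : 0 < z.im) (x : ℝ) :
    ‖nevanlinnaKernel z x‖ ≤ (1 + ‖z‖) * ((1 + ‖z‖) / z.im + 1) * (1 + x ^ 2)⁻¹ := by
  rw [nevanlinnaKernel, norm_mul, norm_mul, Complex.norm_real,
    Real.norm_of_nonneg (by positivity : (0 : ℝ) ≤ (1 + x ^ 2)⁻¹)]
  refine mul_le_mul_of_nonneg_right ?_ (by positivity)
  have h3 := norm_pos_iff.2 (ofReal_sub_ne_zero hz x)
  rw [norm_inv, ← div_eq_mul_inv, div_le_iff₀ h3, mul_assoc]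
  have h1 : ‖(1 : ℂ) + x * z‖ ≤ 1 + |x| * ‖z‖ := by
    refine (norm_add_le _ _).trans ?_
    simp
  have h2 := one_add_abs_le_norm_sub hz x
  calc _ ≤ (1 + ‖z‖) * (1 + |x|) := by nlinarith [abs_nonneg x, norm_nonneg z]
    _ ≤ _ := by gcongr

theorem continuous_nevanlinnaKernel {z : ℂ} (hz : 0 < z.im) : Continuous (nevanlinnaKernel z) := by
  unfold nevanlinnaKernel
  refine ((by fun_prop : Continuous fun x : ℝ => (1 : ℂ) + x * z).mul
    ((by fun_prop : Continuous fun x : ℝ => (x : ℂ) - z).inv₀ fun x => ofReal_sub_ne_zero hz x)).mul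
    (Complex.continuous_ofReal.comp ((by fun_prop : Continuous fun x : ℝ => 1 + x ^ 2).inv₀
      fun x => by positivity))

/-- Schwarz's formula with the Nevanlinna kernel, which is integrable also against boundary values
that are only integrable for the weight `1 / (1 + x ^ 2)`. -/
theorem schwarz_formula_sub {F : ℂ → ℂ} {C s : ℝ} (hs : 0 < s)
    (hd : ∀ z : ℂ, 0 ≤ z.im → DifferentiableAt ℂ F z)
    (hb : ∀ z : ℂ, 0 ≤ z.im → ‖F z‖ ≤ C * (1 + ‖z‖) ^ (-s)) {z : ℂ} (hz : 0 < z.im) :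
    Real.pi * F z = Real.pi * (F Complex.I).re + ∫ x : ℝ, ((F x).im : ℂ) * nevanlinnaKernel z x := by
  obtain ⟨hi, h⟩ := schwarz_formula hs hd hb hz
  obtain ⟨hi', h'⟩ := schwarz_formula hs hd hb (z := Complex.I) (by simp)
  have e : ∀ x : ℝ, (((F x).im : ℂ) * ((x : ℂ) - Complex.I)⁻¹).re =
      (F x).im * (x * (1 + x ^ 2)⁻¹) := fun x => by
    rw [Complex.re_ofReal_mul, Complex.inv_re, normSq_ofReal_sub]
    simp [div_eq_mul_inv, add_comm]
  have h1 := hi'.re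
  have h2 := congrArg Complex.re h'
  rw [Complex.re_ofReal_mul, re_integral_eq hi'] at h2
  simp only [RCLike.re_eq_complex_re, e] at h1 h2
  have h3 : ∀ x : ℝ, ((F x).im : ℂ) * nevanlinnaKernel z x = ((F x).im : ℂ) * ((x : ℂ) - z)⁻¹ -
      (((F x).im * (x * (1 + x ^ 2)⁻¹) : ℝ) : ℂ) := fun x => by
    rw [nevanlinnaKernel_eq hz]
    push_cast
    ring
  have h1c : Integrable fun x : ℝ => (((F x).im * (x * (1 + x ^ 2)⁻¹) : ℝ) : ℂ) := h1.ofReal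
  simp_rw [h3]
  rw [integral_sub hi h1c, ← h, integral_complex_ofReal, ← h2]
  push_cast
  ring

/-! ### Cauchy integrals of compactly supported square-integrable functions -/

/-- The Cauchy integral `∫ f(t) / (t - z) dt` of a real function on the line. -/
noncomputable def lineCauchy (f : ℝ → ℝ) (z : ℂ) : ℂ := ∫ t : ℝ, (f t : ℂ) * ((t : ℂ) - z)⁻¹

theorem norm_inv_ofReal_sub_le {z : ℂ} {ε : ℝ} (hε : 0 < ε) (hz : ε ≤ z.im) (t : ℝ) :
    ‖((t : ℂ) - z)⁻¹‖ ≤ ε⁻¹ := by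
  rw [norm_inv]
  refine inv_anti₀ hε (hz.trans ?_)
  refine le_trans ?_ (Complex.abs_im_le_norm _)
  simp [le_abs_self]

theorem continuous_inv_ofReal_sub {z : ℂ} (hz : 0 < z.im) :
    Continuous fun t : ℝ => ((t : ℂ) - z)⁻¹ :=
  (by fun_prop : Continuous fun x : ℝ => (x : ℂ) - z).inv₀ fun x => ofReal_sub_ne_zero hz x

theorem integrable_mul_inv_ofReal_sub {f : ℝ → ℝ} (hf : Integrable f) {z : ℂ} (hz : 0 < z.im) :
    Integrable fun t : ℝ => (f t : ℂ) * ((t : ℂ) - z)⁻¹ :=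
  hf.ofReal.mul_bdd (c := z.im⁻¹) (continuous_inv_ofReal_sub hz).aestronglyMeasurable
    (Eventually.of_forall fun t => norm_inv_ofReal_sub_le hz le_rfl t)

theorem differentiableAt_lineCauchy {f : ℝ → ℝ} (hf : Integrable f) {z : ℂ} (hz : 0 < z.im) :
    DifferentiableAt ℂ (lineCauchy f) z := by
  have hpos : ∀ ζ ∈ Metric.ball z (z.im / 2), z.im / 2 ≤ ζ.im := fun ζ hζ => by
    have h1 := (Complex.abs_im_le_norm (ζ - z)).trans (mem_ball_iff_norm.1 hζ).le
    rw [Complex.sub_im, abs_le] at h1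
    linarith
  have key := hasDerivAt_integral_of_dominated_loc_of_deriv_le (μ := volume)
    (F := fun (ζ : ℂ) (t : ℝ) => (f t : ℂ) * ((t : ℂ) - ζ)⁻¹) (x₀ := z)
    (s := Metric.ball z (z.im / 2)) (bound := fun t => |f t| * ((z.im / 2)⁻¹ ^ 2))
    (F' := fun (ζ : ℂ) (t : ℝ) => (f t : ℂ) * ((t : ℂ) - ζ)⁻¹ ^ 2)
    (Metric.ball_mem_nhds _ (by linarith)) ?_ (integrable_mul_inv_ofReal_sub hf hz) ?_ ?_
    (hf.abs.mul_const _) ?_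
  · exact key.2.differentiableAt
  · filter_upwards [Metric.ball_mem_nhds z (show 0 < z.im / 2 by linarith)] with ζ hζ
    exact (integrable_mul_inv_ofReal_sub hf
      (lt_of_lt_of_le (by linarith) (hpos ζ hζ))).aestronglyMeasurable
  · exact hf.ofReal.aestronglyMeasurable.mul
      ((continuous_inv_ofReal_sub hz).pow 2).aestronglyMeasurable
  · refine Eventually.of_forall fun t ζ hζ => ?_
    rw [norm_mul, norm_pow, Complex.norm_real, Real.norm_eq_abs]
    gcongr
    exact norm_inv_ofReal_sub_le (by linarith) (hpos ζ hζ) t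
  · refine Eventually.of_forall fun t ζ hζ => ?_
    have hne := ofReal_sub_ne_zero (lt_of_lt_of_le (by linarith) (hpos ζ hζ)) t
    have h1 : HasDerivAt (fun ζ : ℂ => (t : ℂ) - ζ) (-1) ζ := by
      simpa using (hasDerivAt_id ζ).const_sub (t : ℂ)
    refine ((h1.inv hne).const_mul (f t : ℂ)).congr_deriv ?_
    field_simp

theorem norm_lineCauchy_le {f : ℝ → ℝ} (hf : Integrable f) {R : ℝ} (hR : 0 ≤ R)
    (hsupp : ∀ t, R < |t| → f t = 0) {ε : ℝ} (hε : 0 < ε) {z : ℂ} (hz : ε ≤ z.im) :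
    ‖lineCauchy f z‖ ≤ (∫ t, |f t|) * ((1 + R) / ε + 1) * (1 + ‖z‖)⁻¹ := by
  rw [lineCauchy, mul_assoc, ← integral_mul_const]
  refine (norm_integral_le_of_norm_le (hf.abs.mul_const _) (Eventually.of_forall fun t => ?_))
  rw [norm_mul, Complex.norm_real, Real.norm_eq_abs]
  by_cases ht : R < |t|
  · simp [hsupp t ht]
  · refine mul_le_mul_of_nonneg_left ?_ (abs_nonneg _)
    have h0 := norm_pos_iff.2 (ofReal_sub_ne_zero (hε.trans_le hz) t)
    rw [norm_inv, inv_le_iff_one_le_mul₀ h0, mul_right_comm, ← div_eq_mul_inv,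
      one_le_div (by positivity)]
    have h1 : ε ≤ ‖(t : ℂ) - z‖ := by
      refine hz.trans (le_trans ?_ (Complex.abs_im_le_norm _))
      simp [le_abs_self]
    have h2 : ‖z‖ ≤ R + ‖(t : ℂ) - z‖ := by
      have := norm_sub_le (t : ℂ) ((t : ℂ) - z)
      rw [sub_sub_cancel, Complex.norm_real, Real.norm_eq_abs] at this
      linarith
    have h3 : 1 + R ≤ (1 + R) / ε * ‖(t : ℂ) - z‖ := by
      rw [div_mul_eq_mul_div, le_div_iff₀ hε]
      gcongr
    linarith

theorem lineCauchy_im {f : ℝ → ℝ} (hf : Integrable f) {z : ℂ} (hz : 0 < z.im) :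
    (lineCauchy f z).im = ∫ t, f t * poissonLine z.im (t - z.re) := by
  rw [lineCauchy, im_integral_eq (integrable_mul_inv_ofReal_sub hf hz)]
  refine integral_congr_ae (Eventually.of_forall fun t => ?_)
  beta_reduce
  rw [Complex.im_ofReal_mul, im_inv_ofReal_sub]

theorem poissonLine_le {y : ℝ} (hy : 0 < y) (u : ℝ) : poissonLine y u ≤ y⁻¹ := by
  rw [poissonLine, div_le_iff₀ (by positivity)]
  field_simp
  nlinarith [sq_nonneg u]

/-- Jensen's inequality for the Poisson kernel, obtained from `0 ≤ ∫ (f - c)² P` for the mean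
value `c` of `f`. -/
theorem sq_integral_mul_poissonLine_le {f : ℝ → ℝ} (hf : Integrable f)
    (hf2 : Integrable fun t => f t ^ 2) {y : ℝ} (hy : 0 < y) (x : ℝ) :
    (∫ t, f t * poissonLine y (t - x)) ^ 2 ≤
      Real.pi * ∫ t, f t ^ 2 * poissonLine y (t - x) := by
  have hm : AEStronglyMeasurable (fun t => poissonLine y (t - x)) :=
    (integrable_poissonLine_sub hy x).aestronglyMeasurable
  have hb : ∀ᵐ t : ℝ, ‖poissonLine y (t - x)‖ ≤ y⁻¹ := Eventually.of_forall fun t => by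
    rw [Real.norm_of_nonneg (poissonLine_nonneg hy.le _)]
    exact poissonLine_le hy _
  have h1 := hf.mul_bdd hm hb
  have h2 := hf2.mul_bdd hm hb
  have h3 := integrable_poissonLine_sub hy x
  set A := ∫ t, f t * poissonLine y (t - x)
  set c := A / Real.pi with hc
  have h0 : 0 ≤ ∫ t, (f t - c) ^ 2 * poissonLine y (t - x) :=
    integral_nonneg fun t => mul_nonneg (sq_nonneg _) (poissonLine_nonneg hy.le _)
  have e : ∀ t, (f t - c) ^ 2 * poissonLine y (t - x) = f t ^ 2 * poissonLine y (t - x) -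
      2 * c * (f t * poissonLine y (t - x)) + c ^ 2 * poissonLine y (t - x) := fun t => by ring
  simp_rw [e] at h0
  have h12 : Integrable fun t => f t ^ 2 * poissonLine y (t - x) -
      2 * c * (f t * poissonLine y (t - x)) := h2.sub (h1.const_mul _)
  rw [integral_add h12 (h3.const_mul _), integral_sub h2 (h1.const_mul _), integral_const_mul, integral_const_mul, integral_poissonLine_sub hy] at h0
  have hA : A = c * Real.pi := by rw [hc]; field_simp
  change 0 ≤ _ - 2 * c * A + _ at h0
  rw [hA] at h0 ⊢
  nlinarith [Real.pi_pos]

/-- The boundedness of the Hilbert transform on `L²`, as a bound on horizontal lines. The square of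
the Cauchy integral is holomorphic and decays quadratically, so that its integral along a horizontal
line vanishes: the real and the imaginary part have equal `L²` norms. -/
theorem lintegral_enorm_lineCauchy_sq_le {f : ℝ → ℝ} (hf : Integrable f)
    (hf2 : Integrable fun t => f t ^ 2) {R : ℝ} (hR : 0 ≤ R) (hsupp : ∀ t, R < |t| → f t = 0)
    {ε : ℝ} (hε : 0 < ε) :
    ∫⁻ x : ℝ, ENNReal.ofReal (‖lineCauchy f (x + ε * Complex.I)‖ ^ 2) ≤
      ENNReal.ofReal (2 * Real.pi ^ 2 * ∫ t, f t ^ 2) := by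
  set C := (∫ t, |f t|) * ((1 + R) / ε + 1)
  have hC : 0 ≤ C := mul_nonneg (integral_nonneg fun _ => abs_nonneg _) (by positivity)
  set G : ℂ → ℂ := fun z => lineCauchy f (z + ε * Complex.I) ^ 2 with hG
  have him : ∀ z : ℂ, (z + ε * Complex.I).im = z.im + ε := fun z => by simp
  have hGd : ∀ z : ℂ, 0 ≤ z.im → DifferentiableAt ℂ G z := fun z hz => by
    refine DifferentiableAt.pow ?_ 2
    exact (differentiableAt_lineCauchy hf (by rw [him]; linarith)).comp z
      (differentiableAt_id.add_const _)
  have hnorm : ∀ z : ℂ, 0 ≤ z.im → ‖z‖ ≤ ‖z + ε * Complex.I‖ := fun z hz => by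
    rw [← sq_le_sq₀ (norm_nonneg _) (norm_nonneg _), Complex.sq_norm, Complex.sq_norm,
      Complex.normSq_apply, Complex.normSq_apply, him]
    simp
    nlinarith
  have hhb : ∀ z : ℂ, 0 ≤ z.im → ‖lineCauchy f (z + ε * Complex.I)‖ ≤ C * (1 + ‖z‖)⁻¹ :=
    fun z hz => (norm_lineCauchy_le hf hR hsupp hε (by rw [him]; linarith)).trans <| by
      have := hnorm z hz
      gcongr
  have hGb : ∀ z : ℂ, 0 ≤ z.im → ‖G z‖ ≤ C ^ 2 * (1 + ‖z‖) ^ (-2 : ℝ) := fun z hz => by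
    rw [hG, norm_pow, Real.rpow_neg (by positivity), Real.rpow_two, ← inv_pow, ← mul_pow]
    exact pow_le_pow_left₀ (norm_nonneg _) (hhb z hz) 2
  have hcont : Continuous fun x : ℝ => lineCauchy f (x + ε * Complex.I) := by
    refine continuous_comp_horizontal (fun z hz => ?_) hε
    exact (differentiableAt_lineCauchy hf hz).continuousAt
  have hGi : Integrable fun x : ℝ => G x := by
    refine ((integrable_one_add_norm (r := 2) (E := ℝ) (by simp)).const_mul (C ^ 2)).mono'
      (hcont.pow 2).aestronglyMeasurable (Eventually.of_forall fun x => ?_)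
    simpa using hGb x (by simp)
  have h0 : ∫ x : ℝ, G x = 0 := by
    refine integral_eq_zero_of_decay (C := C ^ 2) (s := 2) (R := 1) (by norm_num) one_pos
      (by positivity) hGd hGi fun z hz h1 => (hGb z hz).trans ?_
    refine mul_le_mul_of_nonneg_left ?_ (by positivity)
    exact Real.rpow_le_rpow_of_nonpos (by linarith) (by linarith) (by norm_num)
  have h0re : ∫ x : ℝ, (G x).re = 0 := by
    have := congrArg Complex.re h0
    rwa [re_integral_eq hGi] at this
  have hn : Integrable fun x : ℝ => ‖lineCauchy f (x + ε * Complex.I)‖ ^ 2 := by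
    refine hGi.norm.congr (Eventually.of_forall fun x => ?_)
    simp [hG]
  have hI : Integrable fun x : ℝ => (lineCauchy f (x + ε * Complex.I)).im ^ 2 := by
    refine hn.mono' ((Complex.continuous_im.comp hcont).pow 2).aestronglyMeasurable
      (Eventually.of_forall fun x => ?_)
    rw [Real.norm_of_nonneg (sq_nonneg _), ← sq_abs]
    gcongr
    exact Complex.abs_im_le_norm _
  have e1 : ∀ x : ℝ, ‖lineCauchy f (x + ε * Complex.I)‖ ^ 2 =
      (G x).re + 2 * (lineCauchy f (x + ε * Complex.I)).im ^ 2 := fun x => by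
    rw [Complex.sq_norm, Complex.normSq_apply, hG]
    simp only [pow_two, Complex.mul_re]
    ring
  have e2 : ∫ x : ℝ, ‖lineCauchy f (x + ε * Complex.I)‖ ^ 2 =
      2 * ∫ x : ℝ, (lineCauchy f (x + ε * Complex.I)).im ^ 2 := by
    simp_rw [e1]
    have hGre : Integrable fun x : ℝ => (G x).re := hGi.re
    rw [integral_add hGre (hI.const_mul 2), h0re, integral_const_mul, zero_add]
  have e3 : ENNReal.ofReal (∫ x : ℝ, (lineCauchy f (x + ε * Complex.I)).im ^ 2) ≤
      ENNReal.ofReal (Real.pi ^ 2 * ∫ t, f t ^ 2) := by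
    rw [ofReal_integral_eq_lintegral_ofReal hI (Eventually.of_forall fun _ => sq_nonneg _)]
    have hmf : AEMeasurable fun t => ENNReal.ofReal (f t ^ 2) :=
      hf2.aestronglyMeasurable.aemeasurable.ennreal_ofReal
    have hb : ∀ x : ℝ, ENNReal.ofReal ((lineCauchy f (x + ε * Complex.I)).im ^ 2) ≤
        ENNReal.ofReal Real.pi * ∫⁻ t, ENNReal.ofReal (f t ^ 2) *
          ENNReal.ofReal (poissonLine ε (t - x)) := fun x => by
      rw [lineCauchy_im hf (by simp [hε])]
      simp only [Complex.add_im, Complex.ofReal_im, Complex.mul_im, Complex.ofReal_re,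
        Complex.I_im, mul_one, Complex.I_re, mul_zero, add_zero, zero_add, Complex.add_re,
        Complex.mul_re, sub_self]
      refine (ENNReal.ofReal_le_ofReal (sq_integral_mul_poissonLine_le hf hf2 hε x)).trans ?_
      rw [ENNReal.ofReal_mul Real.pi_pos.le]
      gcongr
      have h2 := hf2.mul_bdd (integrable_poissonLine_sub hε x).aestronglyMeasurable
        (c := ε⁻¹) (Eventually.of_forall fun t => by
          rw [Real.norm_of_nonneg (poissonLine_nonneg hε.le _)]
          exact poissonLine_le hε _)
      rw [ofReal_integral_eq_lintegral_ofReal h2 (Eventually.of_forall fun t =>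
        mul_nonneg (sq_nonneg _) (poissonLine_nonneg hε.le _))]
      refine (lintegral_congr fun t => ?_).le
      rw [ENNReal.ofReal_mul (sq_nonneg _)]
    refine (lintegral_mono hb).trans ?_
    rw [lintegral_const_mul' _ _ ENNReal.ofReal_ne_top, lintegral_lintegral_swap]
    · have e4 : ∀ t : ℝ, ∫⁻ x, ENNReal.ofReal (f t ^ 2) * ENNReal.ofReal (poissonLine ε (t - x)) =
          ENNReal.ofReal (f t ^ 2) * ENNReal.ofReal Real.pi := fun t => by
        rw [lintegral_const_mul' _ _ ENNReal.ofReal_ne_top]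
        congr 1
        rw [← integral_poissonLine_sub hε t, ofReal_integral_eq_lintegral_ofReal
          (integrable_poissonLine_sub hε t)
          (Eventually.of_forall fun _ => poissonLine_nonneg hε.le _)]
        refine lintegral_congr fun x => ?_
        rw [← poissonLine_neg, neg_sub]
      simp_rw [e4]
      rw [lintegral_mul_const' _ _ ENNReal.ofReal_ne_top,
        ← ofReal_integral_eq_lintegral_ofReal hf2 (Eventually.of_forall fun _ => sq_nonneg _),
        ← ENNReal.ofReal_mul (integral_nonneg fun _ => sq_nonneg _),
        ← ENNReal.ofReal_mul Real.pi_pos.le]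
      refine ENNReal.ofReal_le_ofReal (le_of_eq ?_)
      ring
    · have m1 : AEMeasurable (fun q : ℝ × ℝ => ENNReal.ofReal (f q.2 ^ 2))
          (volume.prod volume) := hmf.comp_snd
      have m2 : Measurable fun q : ℝ × ℝ => ENNReal.ofReal (poissonLine ε (q.2 - q.1)) :=
        (measurable_poissonLine.comp (measurable_const.prodMk
          (measurable_snd.sub measurable_fst))).ennreal_ofReal
      exact m1.mul m2.aemeasurable
  rw [← ofReal_integral_eq_lintegral_ofReal hn (Eventually.of_forall fun _ => sq_nonneg _), e2,
    ENNReal.ofReal_mul (by norm_num), mul_assoc, ENNReal.ofReal_mul (by norm_num)]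
  gcongr

/-! ### Measures with a given Poisson integral -/

theorem lintegral_poissonLine_sub {y : ℝ} (hy : 0 < y) (t : ℝ) :
    ∫⁻ x, ENNReal.ofReal (poissonLine y (t - x)) = ENNReal.ofReal Real.pi := by
  rw [← integral_poissonLine_sub hy t, ofReal_integral_eq_lintegral_ofReal
    (integrable_poissonLine_sub hy t) (Eventually.of_forall fun _ => poissonLine_nonneg hy.le _)]
  refine lintegral_congr fun x => ?_
  rw [← poissonLine_neg, neg_sub]

theorem lintegral_poissonLine_Ioc {y : ℝ} (hy : 0 < y) (t : ℝ) {δ : ℝ} (hδ : 0 ≤ δ) :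
    ∫⁻ x in Ioc (t - δ) (t + δ), ENNReal.ofReal (poissonLine y (t - x)) =
      ENNReal.ofReal (2 * Real.arctan (δ / y)) := by
  have hcont : Continuous fun x => poissonLine y (t - x) :=
    (continuous_poissonLine hy).comp (by fun_prop)
  have h1 : ∫ x in (t - δ)..(t + δ), poissonLine y (t - x) = 2 * Real.arctan (δ / y) := by
    rw [intervalIntegral.integral_eq_sub_of_hasDerivAt (f := fun x => Real.arctan ((x - t) / y))]
    · rw [add_sub_cancel_left, sub_right_comm, sub_self, zero_sub, neg_div, Real.arctan_neg]
      ring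
    · intro x _
      have h := (((hasDerivAt_id x).sub_const t).div_const y).arctan
      refine h.congr_deriv ?_
      unfold poissonLine
      simp only [id]
      field_simp
      ring
    · exact hcont.intervalIntegrable _ _
  rw [← h1, intervalIntegral.integral_of_le (by linarith),
    ofReal_integral_eq_lintegral_ofReal hcont.integrableOn_Ioc
      (Eventually.of_forall fun _ => poissonLine_nonneg hy.le _)]

theorem tendsto_arctan_div {ε : ℕ → ℝ} (hε : ∀ n, 0 < ε n) (hε0 : Tendsto ε atTop (𝓝 0))
    {δ : ℝ} (hδ : 0 < δ) : Tendsto (fun n => 2 * Real.arctan (δ / ε n)) atTop (𝓝 Real.pi) := by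
  have h1 : Tendsto (fun n => δ / ε n) atTop atTop := by
    have h2 : Tendsto ε atTop (𝓝[>] 0) :=
      tendsto_nhdsWithin_iff.2 ⟨hε0, Eventually.of_forall fun n => hε n⟩
    simp_rw [div_eq_mul_inv]
    exact (tendsto_inv_nhdsGT_zero.comp h2).const_mul_atTop hδ
  have h3 := ((Real.tendsto_arctan_atTop.mono_right nhdsWithin_le_nhds).comp h1).const_mul 2
  rw [mul_div_cancel₀ _ (two_ne_zero)] at h3
  exact h3

/-- Lower semicontinuity in the Stieltjes inversion formula: the Poisson integrals of `ρ`, as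
densities, do not lose mass on an open set in the limit. -/
theorem pi_mul_measure_le_liminf {ρ : Measure ℝ} [SFinite ρ] {u : ℝ → ℝ → ℝ}
    (hint : ∀ x y, 0 < y → Integrable (fun t => poissonLine y (t - x)) ρ)
    (hu : ∀ x y, 0 < y → u x y = ∫ t, poissonLine y (t - x) ∂ρ)
    {ε : ℕ → ℝ} (hε : ∀ n, 0 < ε n) (hε0 : Tendsto ε atTop (𝓝 0)) {V : Set ℝ} (hV : IsOpen V) :
    ENNReal.ofReal Real.pi * ρ V ≤
      liminf (fun n => ∫⁻ x in V, ENNReal.ofReal (u x (ε n))) atTop := by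
  have hmeas : ∀ n, Measurable fun q : ℝ × ℝ => ENNReal.ofReal (poissonLine (ε n) (q.1 - q.2)) :=
    fun n => (measurable_poissonLine.comp (measurable_const.prodMk
      (measurable_fst.sub measurable_snd))).ennreal_ofReal
  have h1 : ∀ n, ∫⁻ x in V, ENNReal.ofReal (u x (ε n)) =
      ∫⁻ t, (∫⁻ x in V, ENNReal.ofReal (poissonLine (ε n) (t - x))) ∂ρ := fun n => by
    rw [lintegral_lintegral_swap (hmeas n).aemeasurable]
    refine lintegral_congr fun x => ?_
    rw [hu x _ (hε n), ofReal_integral_eq_lintegral_ofReal (hint x _ (hε n))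
      (Eventually.of_forall fun _ => poissonLine_nonneg (hε n).le _)]
  simp_rw [h1]
  refine le_trans ?_ (lintegral_liminf_le fun n => (hmeas n).lintegral_prod_right')
  rw [← setLIntegral_const, ← lintegral_indicator hV.measurableSet]
  refine lintegral_mono fun t => ?_
  by_cases ht : t ∈ V
  · rw [indicator_of_mem ht]
    obtain ⟨δ, hδ, hball⟩ := Metric.isOpen_iff.1 hV t ht
    have hsub : Ioc (t - δ / 2) (t + δ / 2) ⊆ V := fun x hx => hball <| by
      rw [Metric.mem_ball, Real.dist_eq, abs_lt]
      constructor <;> linarith [hx.1, hx.2]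
    have h2 : ∀ n, ENNReal.ofReal (2 * Real.arctan (δ / 2 / ε n)) ≤
        ∫⁻ x in V, ENNReal.ofReal (poissonLine (ε n) (t - x)) := fun n => by
      rw [← lintegral_poissonLine_Ioc (hε n) t (by linarith : 0 ≤ δ / 2)]
      exact lintegral_mono_set hsub
    have h3 := (ENNReal.tendsto_ofReal (tendsto_arctan_div hε hε0 (half_pos hδ))).liminf_eq
    rw [← h3]
    exact liminf_le_liminf (Eventually.of_forall h2)
  · rw [indicator_of_notMem ht]
    exact zero_le

/-! ### Absolute continuity from a square-integrable boundary function -/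

theorem norm_nevanlinnaKernel_sub_le {z : ℂ} (hz : 0 < z.im) {S : ℝ} {t : ℝ}
    (ht : |t| ≤ S) :
    ‖nevanlinnaKernel z t - ((t : ℂ) - z)⁻¹‖ ≤ S * (1 + t ^ 2)⁻¹ := by
  rw [nevanlinnaKernel_eq hz, sub_sub_cancel_left, norm_neg, Complex.norm_real, norm_mul,
    Real.norm_eq_abs, Real.norm_of_nonneg (by positivity : (0 : ℝ) ≤ (1 + t ^ 2)⁻¹)]
  gcongr

theorem norm_nevanlinnaKernel_le_of_le {z : ℂ} (hz : 0 < z.im) {S d : ℝ} (hzS : ‖z‖ ≤ S)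
    (hd : 0 < d) {t : ℝ} (ht : d ≤ ‖(t : ℂ) - z‖) :
    ‖nevanlinnaKernel z t‖ ≤ (S + (1 + S ^ 2) / d) * (1 + t ^ 2)⁻¹ := by
  rw [nevanlinnaKernel, norm_mul, norm_mul, Complex.norm_real,
    Real.norm_of_nonneg (by positivity : (0 : ℝ) ≤ (1 + t ^ 2)⁻¹)]
  refine mul_le_mul_of_nonneg_right ?_ (by positivity)
  have h3 := norm_pos_iff.2 (ofReal_sub_ne_zero hz t)
  rw [norm_inv, ← div_eq_mul_inv, div_le_iff₀ h3, add_mul]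
  have h1 : (1 : ℂ) + t * z = ((t : ℂ) - z) * z + (1 + z ^ 2) := by ring
  have h2 : ‖(1 : ℂ) + z ^ 2‖ ≤ 1 + S ^ 2 := by
    refine (norm_add_le _ _).trans ?_
    rw [norm_one, norm_pow]
    gcongr
  have h4 : 1 + S ^ 2 ≤ (1 + S ^ 2) / d * ‖(t : ℂ) - z‖ := by
    rw [div_mul_eq_mul_div, le_div_iff₀ hd]
    gcongr
  rw [h1]
  refine (norm_add_le _ _).trans ?_
  rw [norm_mul, mul_comm ‖(t : ℂ) - z‖]
  gcongr
  exact h2.trans h4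

/-- If the Poisson integral of `ρ` is at most `|p|²` for a holomorphic function `p` whose imaginary
part has boundary values that are square integrable (against `dx / (1 + x²)`), then `ρ` is
absolutely continuous. Near a compact null set `K`, the part of the boundary values carried by a
small neighbourhood of `K` contributes little by the `L²` boundedness of the Hilbert transform, and
the rest contributes a bounded function. -/
theorem absolutelyContinuous_of_nevanlinna {ρ : Measure ℝ} [SFinite ρ] [IsLocallyFiniteMeasure ρ]
    {p : ℂ → ℂ} {v : ℝ → ℝ} {c₀ : ℝ}
    (hint : ∀ x y, 0 < y → Integrable (fun t => poissonLine y (t - x)) ρ)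
    (hle : ∀ x y : ℝ, 0 < y → ∫ t, poissonLine y (t - x) ∂ρ ≤ ‖p (x + y * Complex.I)‖ ^ 2)
    (hv1 : Integrable fun x => v x * (1 + x ^ 2)⁻¹)
    (hv2 : Integrable fun x => v x ^ 2 * (1 + x ^ 2)⁻¹)
    (hp : ∀ z : ℂ, 0 < z.im →
      Real.pi * p z = Real.pi * c₀ + ∫ x : ℝ, (v x : ℂ) * nevanlinnaKernel z x) :
    ρ ≪ volume := by
  refine Measure.AbsolutelyContinuous.mk fun N hN hN0 => ?_
  by_contra hne
  obtain ⟨K, hKN, hK, hρK⟩ := hN.exists_lt_isCompact (pos_iff_ne_zero.2 hne)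
  have hK0 : volume K = 0 := measure_mono_null hKN hN0
  obtain ⟨R, hR0, hKR⟩ : ∃ R : ℝ, 0 ≤ R ∧ ∀ x ∈ K, |x| ≤ R := by
    obtain ⟨R, hR⟩ := hK.isBounded.subset_closedBall 0
    refine ⟨max R 0, le_max_right _ _, fun x hx => ?_⟩
    have := hR hx
    rw [mem_closedBall_zero_iff, Real.norm_eq_abs] at this
    exact this.trans (le_max_left _ _)
  set S := R + 2 with hS
  set ν := volume.withDensity fun x => ENNReal.ofReal (v x ^ 2 * (1 + x ^ 2)⁻¹) with hν
  have : IsFiniteMeasure ν := isFiniteMeasure_withDensity_ofReal hv2.2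
  have hν0 : ν K = 0 := withDensity_absolutelyContinuous _ _ hK0
  set M := 4 * Real.pi ^ 2 * (1 + S ^ 2)
  have hthick : ∀ d : ℝ, d ≤ 1 → ∀ x ∈ Metric.thickening d K, |x| ≤ R + 1 := fun d hd x hx => by
    obtain ⟨k, hk, hxk⟩ := Metric.mem_thickening_iff.1 hx
    rw [Real.dist_eq] at hxk
    have := abs_sub_abs_le_abs_sub x k
    linarith [hKR k hk]
  -- the estimate for a fixed neighbourhood of `K`
  have main : ∀ d : ℝ, 0 < d → d ≤ 1 → ENNReal.ofReal (Real.pi ^ 2) *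
      (ENNReal.ofReal Real.pi * ρ K) ≤ ENNReal.ofReal M * ν (Metric.thickening d K) := by
    intro d hd hd1
    set U := Metric.thickening d K with hU
    have hUm : MeasurableSet U := Metric.isOpen_thickening.measurableSet
    set f := U.indicator v with hf
    have hUS : ∀ x ∈ U, 1 ≤ (1 + S ^ 2) * (1 + x ^ 2)⁻¹ := fun x hx => by
      rw [← div_eq_mul_inv, one_le_div (by positivity), ← sq_abs x]
      have := hthick d hd1 x hx
      gcongr
      linarith
    have hf_int : Integrable f := by
      rw [hf, integrable_indicator_iff hUm]
      have h1 : IntegrableOn (fun x => (v x * (1 + x ^ 2)⁻¹) * (1 + x ^ 2)) U := by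
        refine hv1.integrableOn.mul_bdd (c := 1 + S ^ 2)
          (by fun_prop : Continuous fun x : ℝ => 1 + x ^ 2).aestronglyMeasurable ?_
        refine (ae_restrict_iff' hUm).2 (Eventually.of_forall fun x hx => ?_)
        have := hUS x hx
        rw [← div_eq_mul_inv, one_le_div (by positivity)] at this
        rwa [Real.norm_of_nonneg (by positivity)]
      refine h1.congr (Eventually.of_forall fun x => ?_)
      have : (1 + x ^ 2) ≠ 0 := by positivity
      field_simp
    have hf2_le : ∀ x, f x ^ 2 ≤ U.indicator (fun x => (1 + S ^ 2) * (v x ^ 2 * (1 + x ^ 2)⁻¹)) x :=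
      fun x => by
        by_cases hx : x ∈ U
        · rw [hf, indicator_of_mem hx, indicator_of_mem hx]
          nlinarith [hUS x hx, sq_nonneg (v x)]
        · rw [hf, indicator_of_notMem hx, indicator_of_notMem hx]
          simp
    have hf2 : Integrable fun x => f x ^ 2 := by
      refine ((hv2.const_mul (1 + S ^ 2)).indicator hUm).mono'
        (hf_int.aestronglyMeasurable.pow 2) (Eventually.of_forall fun x => ?_)
      rw [Real.norm_of_nonneg (sq_nonneg _)]
      exact hf2_le x
    have hf2ν : ENNReal.ofReal (∫ x, f x ^ 2) ≤ ENNReal.ofReal (1 + S ^ 2) * ν U := by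
      rw [ofReal_integral_eq_lintegral_ofReal hf2 (Eventually.of_forall fun _ => sq_nonneg _), hν,
        withDensity_apply _ hUm, ← lintegral_const_mul' _ _ ENNReal.ofReal_ne_top,
        ← lintegral_indicator hUm]
      refine lintegral_mono fun x => ?_
      refine (ENNReal.ofReal_le_ofReal (hf2_le x)).trans (le_of_eq ?_)
      by_cases hx : x ∈ U
      · rw [indicator_of_mem hx, indicator_of_mem hx, ENNReal.ofReal_mul (by positivity)]
      · rw [indicator_of_notMem hx, indicator_of_notMem hx, ENNReal.ofReal_zero]
    have hsupp : ∀ t, R + 1 < |t| → f t = 0 := fun t ht =>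
      indicator_of_notMem (fun h => absurd (hthick d hd1 t h) (not_le.2 ht)) _
    set W := ∫ x, |v x * (1 + x ^ 2)⁻¹|
    set κ := S + (1 + S ^ 2) / (d / 2) with hκ
    have hκS : S ≤ κ := by
      have : 0 ≤ (1 + S ^ 2) / (d / 2) := by positivity
      linarith
    set B := Real.pi * |c₀| + κ * W with hB
    -- `π p` differs from the Cauchy integral of `f` by a bounded function near `K`: on `U` by the
    -- regular part of the kernel, and off `U` the kernel has no singularity
    have hbound : ∀ x ∈ Metric.thickening (d / 2) K, ∀ y : ℝ, 0 < y → y ≤ 1 →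
        ‖Real.pi * p (x + y * Complex.I) - lineCauchy f (x + y * Complex.I)‖ ≤ B := by
      intro x hx y hy hy1
      set z : ℂ := x + y * Complex.I with hz
      have hzim : 0 < z.im := by simp [hz, hy]
      have hzre : z.re = x := by simp [hz]
      have hzS : ‖z‖ ≤ S := by
        refine (norm_add_le _ _).trans ?_
        have := hthick (d / 2) (by linarith) x hx
        simp only [norm_mul, Complex.norm_real, Complex.norm_I, mul_one, Real.norm_eq_abs,
          abs_of_pos hy]
        linarith
      have hI1 : Integrable fun t : ℝ => (v t : ℂ) * nevanlinnaKernel z t := by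
        have h1 : Integrable fun t : ℝ => ((v t * (1 + t ^ 2)⁻¹ : ℝ) : ℂ) *
            ((1 + t * z) * ((t : ℂ) - z)⁻¹) := by
          refine hv1.ofReal.mul_bdd (c := (1 + ‖z‖) * ((1 + ‖z‖) / z.im + 1))
            ((by fun_prop : Continuous fun t : ℝ => (1 : ℂ) + t * z).mul
              (continuous_inv_ofReal_sub hzim)).aestronglyMeasurable
            (Eventually.of_forall fun t => ?_)
          have := norm_nevanlinnaKernel_le hzim t
          rw [nevanlinnaKernel, norm_mul, Complex.norm_real,
            Real.norm_of_nonneg (by positivity : (0 : ℝ) ≤ (1 + t ^ 2)⁻¹)] at this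
          exact le_of_mul_le_mul_right this (by positivity)
        refine h1.congr (Eventually.of_forall fun t => ?_)
        simp only [nevanlinnaKernel, Complex.ofReal_mul]
        ring
      have hI2 := integrable_mul_inv_ofReal_sub hf_int hzim
      rw [hp z hzim, lineCauchy, add_sub_assoc, ← integral_sub hI1 hI2]
      refine (norm_add_le _ _).trans (add_le_add ?_ ?_)
      · simp [abs_of_pos Real.pi_pos]
      · rw [← integral_const_mul]
        refine norm_integral_le_of_norm_le (hv1.abs.const_mul _) (Eventually.of_forall fun t => ?_)
        rw [abs_mul, abs_of_nonneg (by positivity : (0 : ℝ) ≤ (1 + t ^ 2)⁻¹), mul_left_comm]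
        by_cases ht : t ∈ U
        · rw [hf, indicator_of_mem ht, ← mul_sub, norm_mul, Complex.norm_real, Real.norm_eq_abs]
          gcongr
          refine (norm_nevanlinnaKernel_sub_le hzim (S := S) ?_).trans ?_
          · linarith [hthick d hd1 t ht]
          · gcongr
        · rw [hf, indicator_of_notMem ht, Complex.ofReal_zero, zero_mul, sub_zero, norm_mul,
            Complex.norm_real, Real.norm_eq_abs]
          gcongr
          refine norm_nevanlinnaKernel_le_of_le hzim hzS (by linarith) ?_
          obtain ⟨k, hk, hxk⟩ := Metric.mem_thickening_iff.1 hx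
          have h1 : d ≤ |t - k| := by
            by_contra h
            exact ht (Metric.mem_thickening_iff.2 ⟨k, hk, by rw [Real.dist_eq]; linarith⟩)
          rw [Real.dist_eq] at hxk
          have h2 : |t - k| ≤ |t - x| + |x - k| := abs_sub_le t x k
          refine le_trans ?_ (Complex.abs_re_le_norm _)
          rw [Complex.sub_re, Complex.ofReal_re, hzre]
          linarith
    -- the bounded part contributes at most the volume of a much smaller neighbourhood of `K`
    have hV : ∀ r : ℝ, 0 < r → r ≤ d / 2 → ENNReal.ofReal (Real.pi ^ 2) *
        (ENNReal.ofReal Real.pi * ρ K) ≤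
        ENNReal.ofReal (2 * B ^ 2) * volume (Metric.thickening r K) +
          ENNReal.ofReal (4 * Real.pi ^ 2 * ∫ t, f t ^ 2) := by
      intro r hr hrd
      set V := Metric.thickening r K with hVdef
      have hVm : MeasurableSet V := Metric.isOpen_thickening.measurableSet
      have h1 := pi_mul_measure_le_liminf (ρ := ρ) (u := fun x y => ∫ t, poissonLine y (t - x) ∂ρ)
        hint (fun _ _ _ => rfl) (ε := fun n : ℕ => 1 / ((n : ℝ) + 1)) (fun n => by positivity)
        tendsto_one_div_add_atTop_nhds_zero_nat (V := V) Metric.isOpen_thickening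
      have h2 : ∀ n : ℕ, ENNReal.ofReal (Real.pi ^ 2) * ∫⁻ x in V, ENNReal.ofReal
          (∫ t, poissonLine (1 / ((n : ℝ) + 1)) (t - x) ∂ρ) ≤
          ENNReal.ofReal (2 * B ^ 2) * volume V +
            ENNReal.ofReal (4 * Real.pi ^ 2 * ∫ t, f t ^ 2) := by
        intro n
        set y : ℝ := 1 / ((n : ℝ) + 1) with hy
        have hy0 : 0 < y := by positivity
        have hy1 : y ≤ 1 := by
          rw [hy, div_le_one (by positivity)]
          linarith [n.cast_nonneg (α := ℝ)]
        rw [← lintegral_const_mul' _ _ ENNReal.ofReal_ne_top]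
        have h3 : ∀ x ∈ V, ENNReal.ofReal (Real.pi ^ 2) *
            ENNReal.ofReal (∫ t, poissonLine y (t - x) ∂ρ) ≤ ENNReal.ofReal (2 * B ^ 2) +
            2 * ENNReal.ofReal (‖lineCauchy f (x + y * Complex.I)‖ ^ 2) := by
          intro x hx
          have hb := hbound x (Metric.thickening_mono hrd K hx) y hy0 hy1
          have hB0 := (norm_nonneg _).trans hb
          set q := lineCauchy f (x + y * Complex.I)
          have h4 : ‖Real.pi * p (x + y * Complex.I)‖ ≤ B + ‖q‖ := by
            have := norm_add_le (Real.pi * p (x + y * Complex.I) - q) q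
            rw [sub_add_cancel] at this
            linarith
          rw [norm_mul, Complex.norm_real, Real.norm_of_nonneg Real.pi_pos.le] at h4
          rw [← ENNReal.ofReal_mul (by positivity), show (2 : ENNReal) = ENNReal.ofReal 2 by simp,
            ← ENNReal.ofReal_mul (by norm_num), ← ENNReal.ofReal_add (by positivity)
            (by positivity)]
          refine ENNReal.ofReal_le_ofReal ?_
          calc Real.pi ^ 2 * ∫ t, poissonLine y (t - x) ∂ρ
              ≤ Real.pi ^ 2 * ‖p (x + y * Complex.I)‖ ^ 2 := by
                gcongr
                exact hle x y hy0
            _ = (Real.pi * ‖p (x + y * Complex.I)‖) ^ 2 := by ring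
            _ ≤ (B + ‖q‖) ^ 2 := by
                gcongr
            _ ≤ _ := by nlinarith [sq_nonneg (B - ‖q‖)]
        refine (setLIntegral_mono' hVm h3).trans ?_
        rw [lintegral_add_left measurable_const, setLIntegral_const,
          lintegral_const_mul' _ _ (by simp)]
        gcongr
        refine (mul_le_mul_right (setLIntegral_le_lintegral _ _) _).trans ?_
        refine (mul_le_mul_right (lintegral_enorm_lineCauchy_sq_le hf_int hf2 (by linarith) hsupp
          hy0) _).trans (le_of_eq ?_)
        rw [show (2 : ENNReal) = ENNReal.ofReal 2 by simp, ← ENNReal.ofReal_mul (by norm_num)]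
        congr 1
        ring
      calc _ ≤ ENNReal.ofReal (Real.pi ^ 2) * liminf (fun n : ℕ => ∫⁻ x in V, ENNReal.ofReal
              (∫ t, poissonLine (1 / ((n : ℝ) + 1)) (t - x) ∂ρ)) atTop := by
            gcongr
            refine le_trans ?_ h1
            gcongr
            exact Metric.self_subset_thickening hr K
        _ = liminf (fun n : ℕ => ENNReal.ofReal (Real.pi ^ 2) * ∫⁻ x in V, ENNReal.ofReal
              (∫ t, poissonLine (1 / ((n : ℝ) + 1)) (t - x) ∂ρ)) atTop :=
            (ENNReal.liminf_const_mul_of_ne_top (by simp)).symm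
        _ ≤ _ := liminf_le_of_le (by isBoundedDefault) fun b hb => by
            obtain ⟨n, hn⟩ := hb.exists
            exact hn.trans (h2 n)
    have hlim : Tendsto (fun r => ENNReal.ofReal (2 * B ^ 2) * volume (Metric.thickening r K) +
          ENNReal.ofReal (4 * Real.pi ^ 2 * ∫ t, f t ^ 2)) (𝓝[>] 0)
        (𝓝 (ENNReal.ofReal (2 * B ^ 2) * volume (closure K) +
          ENNReal.ofReal (4 * Real.pi ^ 2 * ∫ t, f t ^ 2))) := by
      refine (ENNReal.Tendsto.const_mul (tendsto_measure_thickening ?_)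
        (Or.inr ENNReal.ofReal_ne_top)).add
        tendsto_const_nhds
      exact ⟨1, one_pos, (hK.isBounded.thickening.measure_lt_top).ne⟩
    rw [hK.isClosed.closure_eq, hK0, mul_zero, zero_add] at hlim
    refine (ge_of_tendsto hlim ?_).trans ?_
    · filter_upwards [Ioc_mem_nhdsGT (show (0 : ℝ) < d / 2 by linarith)] with r hr
      exact hV r hr.1 hr.2
    · rw [ENNReal.ofReal_mul (by positivity), ENNReal.ofReal_mul (p := 4 * Real.pi ^ 2)
        (by positivity), mul_assoc]
      gcongr
  have hlim : Tendsto (fun d => ENNReal.ofReal M * ν (Metric.thickening d K)) (𝓝[>] 0)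
      (𝓝 (ENNReal.ofReal M * ν (closure K))) :=
    ENNReal.Tendsto.const_mul (tendsto_measure_thickening ⟨1, one_pos, measure_ne_top _ _⟩)
      (Or.inr (by simp))
  rw [hK.isClosed.closure_eq, hν0, mul_zero] at hlim
  have h0 : ENNReal.ofReal (Real.pi ^ 2) * (ENNReal.ofReal Real.pi * ρ K) ≤ 0 := by
    refine ge_of_tendsto hlim ?_
    filter_upwards [Ioc_mem_nhdsGT one_pos] with d hd
    exact main d hd.1 hd.2
  have hpi := Real.pi_pos
  simp [hpi.not_ge, (pow_pos hpi 2).not_ge, hρK.ne'] at h0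

/-! ### The logarithm of the product -/

/-- The logarithm of the factor of `herglotzProd` that belongs to the gap `(a, b)` with zero `c`. -/
noncomputable def gapLog (a b c : ℝ) (z : ℂ) : ℂ :=
  Complex.log (z - c) - Complex.log (z - a) / 2 - Complex.log (z - b) / 2

/-- A logarithm of `herglotzProd a b c / i`. -/
noncomputable def prodLog (a b c : ℕ → ℝ) (z : ℂ) : ℂ :=
  -Complex.log 2 - Complex.log z / 2 + ∑' j, gapLog (a j) (b j) (c j) z

theorem sub_ofReal_mem_slitPlane {z : ℂ} (hz : 0 < z.im) (t : ℝ) : z - t ∈ Complex.slitPlane := by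
  rw [Complex.mem_slitPlane_iff]
  right
  simp [hz.ne']

theorem hasDerivAt_log_sub_ofReal {z : ℂ} (hz : 0 < z.im) (t : ℝ) :
    HasDerivAt (fun t : ℝ => Complex.log (z - t)) (((t : ℂ) - z)⁻¹) t := by
  have h1 : HasDerivAt (fun t : ℝ => z - (t : ℂ)) (-1) t := by
    simpa using (Complex.ofRealCLM.hasDerivAt (x := t)).const_sub z
  refine (h1.clog_real (sub_ofReal_mem_slitPlane hz t)).congr_deriv ?_
  rw [← neg_sub z, inv_neg, neg_div, one_div]

theorem log_sub_log_eq_integral {z : ℂ} (hz : 0 < z.im) (r s : ℝ) :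
    Complex.log (z - s) - Complex.log (z - r) = ∫ t in r..s, ((t : ℂ) - z)⁻¹ :=
  (intervalIntegral.integral_eq_sub_of_hasDerivAt (fun t _ => hasDerivAt_log_sub_ofReal hz t)
    ((continuous_inv_ofReal_sub hz).intervalIntegrable _ _)).symm

theorem arg_sub_arg_eq_integral {z : ℂ} (hz : 0 < z.im) (r s : ℝ) :
    (z - s).arg - (z - r).arg = ∫ t in r..s, poissonLine z.im (t - z.re) := by
  rw [intervalIntegral.integral_eq_sub_of_hasDerivAt (f := fun t : ℝ => (z - t).arg)]
  · intro t _
    have h := Complex.imCLM.hasFDerivAt.comp_hasDerivAt t (hasDerivAt_log_sub_ofReal hz t)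
    have h2 : HasDerivAt (fun t : ℝ => (Complex.log (z - t)).im) ((((t : ℂ) - z)⁻¹).im) t := h
    rw [im_inv_ofReal_sub] at h2
    simpa only [Complex.log_im] using h2
  · exact ((continuous_poissonLine hz).comp (by fun_prop)).intervalIntegrable _ _

theorem norm_gapLog_le {a b c : ℝ} (hc : c ∈ Icc a b) {z : ℂ} (hz : 0 < z.im) {d : ℝ} (hd : 0 < d)
    (h : ∀ t ∈ Icc a b, d ≤ ‖(t : ℂ) - z‖) : ‖gapLog a b c z‖ ≤ (b - a) / (2 * d) := by
  have e : gapLog a b c z = (1 / 2 : ℂ) * ((Complex.log (z - c) - Complex.log (z - a)) -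
      (Complex.log (z - b) - Complex.log (z - c))) := by
    unfold gapLog; ring
  have hI : ∀ r s : ℝ, r ≤ s → Icc r s ⊆ Icc a b →
      ‖Complex.log (z - s) - Complex.log (z - r)‖ ≤ d⁻¹ * (s - r) := fun r s hrs hsub => by
    rw [log_sub_log_eq_integral hz, ← abs_of_nonneg (sub_nonneg.2 hrs)]
    refine intervalIntegral.norm_integral_le_of_norm_le_const fun t ht => ?_
    rw [uIoc_of_le hrs] at ht
    rw [norm_inv]
    exact inv_anti₀ hd (h t (hsub (Ioc_subset_Icc_self ht)))
  have h1 := hI a c hc.1 (Icc_subset_Icc le_rfl hc.2)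
  have h2 := hI c b hc.2 (Icc_subset_Icc hc.1 le_rfl)
  rw [e, norm_mul]
  have h3 := norm_sub_le (Complex.log (z - c) - Complex.log (z - a))
    (Complex.log (z - b) - Complex.log (z - c))
  have h4 : ‖(1 / 2 : ℂ)‖ = 1 / 2 := by norm_num
  rw [h4]
  calc _ ≤ 1 / 2 * (d⁻¹ * (c - a) + d⁻¹ * (b - c)) := by gcongr; linarith
    _ = _ := by field_simp; ring

theorem abs_im_gapLog_le {a b c : ℝ} (hc : c ∈ Icc a b) {z : ℂ} (hz : 0 < z.im) :
    |(gapLog a b c z).im| ≤ 1 / 2 * ∫ t in Ioo a b, poissonLine z.im (t - z.re) := by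
  have e : (gapLog a b c z).im = 1 / 2 * (((z - c).arg - (z - a).arg) -
      ((z - b).arg - (z - c).arg)) := by
    have h2 : ∀ w : ℂ, (w / 2).im = w.im / 2 := fun w => by simp
    simp only [gapLog, Complex.sub_im, h2, Complex.log_im]
    ring
  have hint : ∀ r s, IntervalIntegrable (fun t => poissonLine z.im (t - z.re)) volume r s :=
    fun r s => ((continuous_poissonLine hz).comp (by fun_prop)).intervalIntegrable _ _
  have h1 : 0 ≤ (z - c).arg - (z - a).arg := by
    rw [arg_sub_arg_eq_integral hz]
    exact intervalIntegral.integral_nonneg hc.1 fun _ _ => poissonLine_nonneg hz.le _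
  have h2 : 0 ≤ (z - b).arg - (z - c).arg := by
    rw [arg_sub_arg_eq_integral hz]
    exact intervalIntegral.integral_nonneg hc.2 fun _ _ => poissonLine_nonneg hz.le _
  have h3 := arg_sub_arg_eq_integral hz a b
  rw [intervalIntegral.integral_of_le (hc.1.trans hc.2), integral_Ioc_eq_integral_Ioo] at h3
  rw [e, ← h3, abs_mul, abs_of_pos (by norm_num : (0 : ℝ) < 1 / 2)]
  gcongr
  rw [abs_le]
  constructor <;> linarith

theorem im_pos_le_norm_ofReal_sub (z : ℂ) (t : ℝ) : z.im ≤ ‖(t : ℂ) - z‖ := by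
  refine le_trans ?_ (Complex.abs_im_le_norm _)
  simp [le_abs_self]

theorem setIntegral_Ioi_poissonLine_le {z : ℂ} (hz : 0 < z.im) :
    ∫ t in Ioi 0, poissonLine z.im (t - z.re) ≤ Real.pi - z.arg := by
  have h := intervalIntegral_tendsto_integral_Ioi (a := 0)
    (integrable_poissonLine_sub hz z.re).integrableOn tendsto_id
  refine le_of_tendsto h (Eventually.of_forall fun T => ?_)
  have := arg_sub_arg_eq_integral hz 0 T
  simp only [id]
  rw [← this]
  simp only [Complex.ofReal_zero, sub_zero]
  linarith [(z - T).arg_le_pi]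

section Product

variable {a b c : ℕ → ℝ}

theorem summable_gapLog (hlen : Summable fun j => b j - a j)
    (hc : ∀ j, c j ∈ Icc (a j) (b j)) {z : ℂ} (hz : 0 < z.im) :
    Summable fun j => gapLog (a j) (b j) (c j) z :=
  Summable.of_norm_bounded (hlen.div_const (2 * z.im)) fun j =>
    norm_gapLog_le (hc j) hz hz fun t _ => im_pos_le_norm_ofReal_sub z t

theorem norm_tsum_gapLog_le (hlen : Summable fun j => b j - a j)
    (hc : ∀ j, c j ∈ Icc (a j) (b j)) {z : ℂ} (hz : 0 < z.im) :
    ‖∑' j, gapLog (a j) (b j) (c j) z‖ ≤ (∑' j, (b j - a j)) / (2 * z.im) := by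
  refine tsum_of_norm_bounded (hlen.hasSum.div_const (2 * z.im)) fun j => ?_
  exact norm_gapLog_le (hc j) hz hz fun t _ => im_pos_le_norm_ofReal_sub z t

theorem differentiableAt_prodLog (hlen : Summable fun j => b j - a j)
    (hc : ∀ j, c j ∈ Icc (a j) (b j)) {z : ℂ} (hz : 0 < z.im) :
    DifferentiableAt ℂ (prodLog a b c) z := by
  have hlog : ∀ w : ℂ, 0 < w.im → ∀ t : ℝ,
      DifferentiableAt ℂ (fun w : ℂ => Complex.log (w - t)) w := fun w hw t =>
    (differentiableAt_id.sub_const _).clog (sub_ofReal_mem_slitPlane hw t)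
  have ho : IsOpen {w : ℂ | z.im / 2 < w.im} := isOpen_lt continuous_const Complex.continuous_im
  have hmem : {w : ℂ | z.im / 2 < w.im} ∈ 𝓝 z := ho.mem_nhds (by simpa using half_lt_self hz)
  have h1 : DifferentiableOn ℂ (fun w => ∑' j, gapLog (a j) (b j) (c j) w)
      {w : ℂ | z.im / 2 < w.im} := by
    refine Complex.differentiableOn_tsum_of_summable_norm (hlen.div_const (2 * (z.im / 2)))
      (fun j w hw => ?_) ho fun j w hw => ?_
    · have hw' : 0 < w.im := lt_trans (half_pos hz) hw
      exact (((hlog w hw' _).sub ((hlog w hw' _).div_const 2)).sub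
        ((hlog w hw' _).div_const 2)).differentiableWithinAt
    · have hw' : 0 < w.im := lt_trans (half_pos hz) hw
      exact norm_gapLog_le (hc j) hw' (half_pos hz) fun t _ =>
        (le_of_lt hw).trans (im_pos_le_norm_ofReal_sub w t)
  have h2 := hlog z hz 0
  simp only [Complex.ofReal_zero, sub_zero] at h2
  exact ((differentiableAt_const _).sub (h2.div_const 2)).add (h1.differentiableAt hmem)

theorem herglotzProd_eq_of_summable {z : ℂ} (h0 : z ≠ 0) (hza : ∀ j, z ≠ a j) (hzb : ∀ j, z ≠ b j)
    (hzc : ∀ j, z ≠ c j) (hs : Summable fun j => gapLog (a j) (b j) (c j) z) :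
    herglotzProd a b c z = Complex.I * Complex.exp (prodLog a b c z) := by
  have h1 : ∀ w : ℂ, w ≠ 0 → w ^ (1 / 2 : ℂ) = Complex.exp (Complex.log w / 2) := fun w hw => by
    rw [Complex.cpow_def_of_ne_zero hw]
    ring_nf
  have h2 : ∀ j, (z - (c j : ℂ)) / ((z - (a j : ℂ)) ^ (1 / 2 : ℂ) * (z - (b j : ℂ)) ^ (1 / 2 : ℂ)) =
      Complex.exp (gapLog (a j) (b j) (c j) z) := fun j => by
    rw [h1 _ (sub_ne_zero.2 (hza j)), h1 _ (sub_ne_zero.2 (hzb j)), gapLog, Complex.exp_sub,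
      Complex.exp_sub, Complex.exp_log (sub_ne_zero.2 (hzc j)), div_div]
  have h3 : ∏' j, Complex.exp (gapLog (a j) (b j) (c j) z) =
      Complex.exp (∑' j, gapLog (a j) (b j) (c j) z) := hs.hasSum.cexp.tprod_eq
  rw [herglotzProd, tprod_congr h2, h3, prodLog, Complex.exp_add,
    Complex.exp_sub, Complex.exp_neg, Complex.exp_log two_ne_zero, h1 z h0]
  field_simp

theorem ne_ofReal_of_im_pos {z : ℂ} (hz : 0 < z.im) (t : ℝ) : z ≠ t := by
  rintro rfl
  simp at hz

theorem herglotzProd_eq (hlen : Summable fun j => b j - a j)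
    (hc : ∀ j, c j ∈ Icc (a j) (b j)) {z : ℂ} (hz : 0 < z.im) :
    herglotzProd a b c z = Complex.I * Complex.exp (prodLog a b c z) :=
  herglotzProd_eq_of_summable (by simpa using ne_ofReal_of_im_pos hz 0)
    (fun _ => ne_ofReal_of_im_pos hz _) (fun _ => ne_ofReal_of_im_pos hz _)
    (fun _ => ne_ofReal_of_im_pos hz _) (summable_gapLog hlen hc hz)

theorem norm_exp_prodLog {z : ℂ} (hz : z ≠ 0) :
    ‖Complex.exp (prodLog a b c z)‖ =
      1 / 2 * ‖z‖ ^ (-(1 / 2) : ℝ) * ‖Complex.exp (∑' j, gapLog (a j) (b j) (c j) z)‖ := by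
  have h0 : 0 < ‖z‖ := norm_pos_iff.2 hz
  rw [prodLog, Complex.exp_add, norm_mul, Complex.exp_sub, Complex.exp_neg,
    Complex.exp_log two_ne_zero, norm_div, norm_inv, Complex.norm_exp (Complex.log z / 2)]
  have h2 : (Complex.log z / 2).re = Real.log ‖z‖ * (1 / 2) := by
    rw [← Complex.log_re]
    simp [div_eq_mul_inv]
  rw [h2, ← Real.rpow_def_of_pos h0, Real.rpow_neg h0.le]
  simp [div_eq_mul_inv]

theorem norm_exp_prodLog_le (hlen : Summable fun j => b j - a j)
    (hc : ∀ j, c j ∈ Icc (a j) (b j)) {z : ℂ} (hz : 0 < z.im) :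
    ‖Complex.exp (prodLog a b c z)‖ ≤
      ‖z‖ ^ (-(1 / 2) : ℝ) * Real.exp ((∑' j, (b j - a j)) / (2 * z.im)) := by
  rw [norm_exp_prodLog (by simpa using ne_ofReal_of_im_pos hz 0)]
  have h1 : ‖Complex.exp (∑' j, gapLog (a j) (b j) (c j) z)‖ ≤
      Real.exp ((∑' j, (b j - a j)) / (2 * z.im)) := by
    rw [Complex.norm_exp]
    exact Real.exp_le_exp.2 ((Complex.re_le_norm _).trans (norm_tsum_gapLog_le hlen hc hz))
  have h2 : 0 ≤ ‖z‖ ^ (-(1 / 2) : ℝ) := by positivity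
  refine mul_le_mul ?_ h1 (norm_nonneg _) h2
  linarith

/-- The argument of `herglotzProd / i` is bounded by half the harmonic measure of the negative
axis and of the gaps. -/
theorem abs_im_prodLog_le (ha : ∀ j, 0 ≤ a j)
    (hdisj : Pairwise fun j k => Disjoint (Ioo (a j) (b j)) (Ioo (a k) (b k)))
    (hlen : Summable fun j => b j - a j) (hc : ∀ j, c j ∈ Icc (a j) (b j)) {z : ℂ}
    (hz : 0 < z.im) :
    |(prodLog a b c z).im| ≤ z.arg / 2 +
      1 / 2 * (∫ t in ⋃ j, Ioo (a j) (b j), poissonLine z.im (t - z.re)) ∧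
    |(prodLog a b c z).im| ≤ Real.pi / 2 := by
  have hP := integrable_poissonLine_sub hz z.re
  have hsum := hasSum_integral_iUnion (μ := volume) (s := fun j => Ioo (a j) (b j))
    (f := fun t => poissonLine z.im (t - z.re)) (fun j => measurableSet_Ioo) hdisj hP.integrableOn
  have hb : |∑' j, (gapLog (a j) (b j) (c j) z).im| ≤
      1 / 2 * ∫ t in ⋃ j, Ioo (a j) (b j), poissonLine z.im (t - z.re) := by
    rw [← Real.norm_eq_abs]
    exact tsum_of_norm_bounded (hsum.mul_left (1 / 2)) fun j => abs_im_gapLog_le (hc j) hz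
  have him : (prodLog a b c z).im = -(z.arg / 2) + ∑' j, (gapLog (a j) (b j) (c j) z).im := by
    have h2 : ∀ w : ℂ, (w / 2).im = w.im / 2 := fun w => by simp
    have h3 : (Complex.log 2).im = 0 := by
      rw [Complex.log_im, ← Complex.ofReal_ofNat, Complex.arg_ofReal_of_nonneg (by norm_num)]
    rw [prodLog, Complex.add_im, Complex.sub_im, Complex.neg_im, h3, h2, Complex.log_im,
      Complex.im_tsum (summable_gapLog hlen hc hz)]
    ring
  have harg : 0 ≤ z.arg := Complex.arg_nonneg_iff.2 hz.le
  have hle : ∫ t in ⋃ j, Ioo (a j) (b j), poissonLine z.im (t - z.re) ≤ Real.pi - z.arg := by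
    refine le_trans (setIntegral_mono_set hP.integrableOn (Eventually.of_forall fun _ =>
      poissonLine_nonneg hz.le _) (LE.le.eventuallyLE ?_))
      (setIntegral_Ioi_poissonLine_le hz)
    exact iUnion_subset fun j t ht => (ha j).trans_lt ht.1
  rw [abs_le] at hb
  rw [him]
  refine ⟨abs_le.2 ⟨by linarith [hb.1], by linarith [hb.2]⟩,
    abs_le.2 ⟨by linarith [hb.1], by linarith [hb.2]⟩⟩

end Product

/-! ### Boundary values on the gaps and on the negative axis -/

theorem tendsto_log_vertical {x t : ℝ} (h : x ≠ t) :
    Tendsto (fun ε : ℝ => Complex.log ((x : ℂ) + ε * Complex.I - t)) (𝓝[>] 0)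
      (𝓝 (Complex.log ((x : ℂ) - t))) := by
  have hcont : Tendsto (fun ε : ℝ => (x : ℂ) + ε * Complex.I - t) (𝓝[>] 0)
      (𝓝 ((x : ℂ) - t)) := by
    have : Continuous fun ε : ℝ => (x : ℂ) + ε * Complex.I - t := by fun_prop
    have h2 := this.tendsto 0
    simp only [Complex.ofReal_zero, zero_mul, add_zero] at h2
    exact h2.mono_left nhdsWithin_le_nhds
  rcases lt_or_gt_of_ne h with h1 | h1
  · have := Complex.continuousWithinAt_log_of_re_neg_of_im_zero (z := (x : ℂ) - t)
      (by simpa using h1) (by simp)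
    refine this.tendsto.comp (tendsto_nhdsWithin_iff.2 ⟨hcont, ?_⟩)
    filter_upwards [self_mem_nhdsWithin] with ε hε
    simpa using le_of_lt hε
  · refine (continuousAt_clog ?_).tendsto.comp hcont
    rw [Complex.mem_slitPlane_iff]
    left
    simpa using h1

theorem tendsto_gapLog_vertical {a b c x : ℝ} (ha : x ≠ a) (hb : x ≠ b) (hc : x ≠ c) :
    Tendsto (fun ε : ℝ => gapLog a b c ((x : ℂ) + ε * Complex.I)) (𝓝[>] 0)
      (𝓝 (gapLog a b c x)) :=
  ((tendsto_log_vertical hc).sub ((tendsto_log_vertical ha).div_const 2)).sub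
    ((tendsto_log_vertical hb).div_const 2)

theorem abs_sub_le_norm_vertical (x y t : ℝ) : |t - x| ≤ ‖(t : ℂ) - (x + y * Complex.I)‖ := by
  refine le_trans (le_of_eq ?_) (Complex.abs_re_le_norm _)
  simp

theorem norm_gapLog_vertical_le {a b c : ℝ} (hc : c ∈ Icc a b) {x d : ℝ} (hd : 0 < d)
    (h : ∀ t ∈ Icc a b, d ≤ |t - x|) {ε : ℝ} (hε : 0 < ε) :
    ‖gapLog a b c ((x : ℂ) + ε * Complex.I)‖ ≤ (b - a) / (2 * d) :=
  norm_gapLog_le hc (by simp [hε]) hd fun t ht => (h t ht).trans (abs_sub_le_norm_vertical x ε t)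

theorem norm_gapLog_ofReal_le {a b c : ℝ} (hc : c ∈ Icc a b) {x d : ℝ} (hd : 0 < d)
    (h : ∀ t ∈ Icc a b, d ≤ |t - x|) : ‖gapLog a b c x‖ ≤ (b - a) / (2 * d) := by
  have hne : ∀ t ∈ Icc a b, x ≠ t := by
    rintro t ht rfl
    have := h x ht
    rw [sub_self, abs_zero] at this
    linarith
  have hab := hc.1.trans hc.2
  refine le_of_tendsto (tendsto_gapLog_vertical (hne a (left_mem_Icc.2 hab))
    (hne b (right_mem_Icc.2 hab)) (hne c hc)).norm ?_
  filter_upwards [self_mem_nhdsWithin] with ε hε using norm_gapLog_vertical_le hc hd h hε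

theorem arg_ofReal_sub (x t : ℝ) : ((x : ℂ) - t).arg = if x < t then Real.pi else 0 := by
  rw [← Complex.ofReal_sub]
  split_ifs with h
  · exact Complex.arg_ofReal_of_neg (sub_neg.2 h)
  · exact Complex.arg_ofReal_of_nonneg (sub_nonneg.2 (not_lt.1 h))

theorem im_gapLog_ofReal (a b c x : ℝ) : (gapLog a b c x).im = (if x < c then Real.pi else 0) -
    (if x < a then Real.pi else 0) / 2 - (if x < b then Real.pi else 0) / 2 := by
  have h2 : ∀ w : ℂ, (w / 2).im = w.im / 2 := fun w => by simp
  simp only [gapLog, Complex.sub_im, h2, Complex.log_im, arg_ofReal_sub]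

theorem I_mul_exp_of_im_eq_neg {w : ℂ} (h : w.im = -(Real.pi / 2)) :
    Complex.I * Complex.exp w = ‖Complex.exp w‖ := by
  rw [Complex.norm_exp, Complex.exp_eq_exp_re_mul_sin_add_cos, h]
  simp only [Complex.ofReal_neg, Complex.ofReal_div, Complex.ofReal_ofNat, Complex.cos_neg,
    Complex.cos_pi_div_two, Complex.sin_neg, Complex.sin_pi_div_two, Complex.ofReal_exp]
  linear_combination (-Complex.exp w.re) * Complex.I_sq

theorem I_mul_exp_of_im_eq {w : ℂ} (h : w.im = Real.pi / 2) :
    Complex.I * Complex.exp w = -‖Complex.exp w‖ := by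
  rw [Complex.norm_exp, Complex.exp_eq_exp_re_mul_sin_add_cos, h]
  simp only [Complex.ofReal_div, Complex.ofReal_ofNat,
    Complex.cos_pi_div_two, Complex.sin_pi_div_two, Complex.ofReal_exp]
  linear_combination (Complex.exp w.re) * Complex.I_sq

section Gaps

variable {a b c : ℕ → ℝ}

theorem measurableSet_gapSet : MeasurableSet (gapSet a b) :=
  measurableSet_Ici.diff (MeasurableSet.iUnion fun _ => measurableSet_Ioo)

theorem mem_compl_gapSet {x : ℝ} : x ∈ (gapSet a b)ᶜ ↔ x < 0 ∨ ∃ k, x ∈ Ioo (a k) (b k) := by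
  simp only [gapSet, mem_compl_iff, Set.mem_sdiff, mem_Ici, mem_iUnion, not_and, not_not]
  constructor
  · intro h
    by_cases hx : x < 0
    · exact Or.inl hx
    · exact Or.inr (h (not_lt.1 hx))
  · rintro (h | h) h0
    · exact absurd h (not_lt.2 h0)
    · exact h

/-- `x` has distance at least `d` from the origin, from all gaps but the `k`-th, and from the
endpoints of the `k`-th gap. -/
structure GapSep (a b : ℕ → ℝ) (x : ℝ) (k : ℕ) (d : ℝ) : Prop where
  pos : 0 < d
  zero : d ≤ |x|
  gap : ∀ j, j ≠ k → ∀ t ∈ Icc (a j) (b j), d ≤ |t - x|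
  left : d ≤ |a k - x|
  right : d ≤ |b k - x|

theorem gapSep_of_neg (ha : ∀ j, 0 ≤ a j) (hab : ∀ j, a j < b j) {x : ℝ} (hx : x < 0) (k : ℕ) :
    GapSep a b x k (-x) where
  pos := by linarith
  zero := neg_le_abs x
  gap j _ t ht := le_trans (by linarith [ha j, ht.1]) (le_abs_self _)
  left := le_trans (by linarith [ha k]) (le_abs_self _)
  right := le_trans (by linarith [ha k, hab k]) (le_abs_self _)

theorem gapSep_of_mem (ha : ∀ j, 0 ≤ a j) (hab : ∀ j, a j < b j)
    (hdisj : Pairwise fun j k => Disjoint (Ioo (a j) (b j)) (Ioo (a k) (b k))) {x : ℝ} {k : ℕ}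
    (hx : x ∈ Ioo (a k) (b k)) : GapSep a b x k (min (x - a k) (b k - x)) where
  pos := lt_min (sub_pos.2 hx.1) (sub_pos.2 hx.2)
  zero := (min_le_left _ _).trans (le_trans (by linarith [ha k]) (le_abs_self _))
  gap j hj t ht := by
    have h1 := (hdisj hj).closure_left isOpen_Ioo
    rw [closure_Ioo (hab j).ne] at h1
    have h2 : t ∉ Ioo (a k) (b k) := fun h => disjoint_left.1 h1 ht h
    by_cases h3 : a k < t
    · have h4 : b k ≤ t := by
        by_contra h
        exact h2 ⟨h3, not_le.1 h⟩
      exact (min_le_right _ _).trans (le_trans (by linarith) (le_abs_self _))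
    · exact (min_le_left _ _).trans (le_trans (by linarith) (neg_le_abs _))
  left := (min_le_left _ _).trans (le_trans (by linarith) (neg_le_abs _))
  right := (min_le_right _ _).trans (le_abs_self _)

theorem exists_gapSep (ha : ∀ j, 0 ≤ a j) (hab : ∀ j, a j < b j)
    (hdisj : Pairwise fun j k => Disjoint (Ioo (a j) (b j)) (Ioo (a k) (b k))) {x : ℝ}
    (hx : x ∈ (gapSet a b)ᶜ) : ∃ k d, GapSep a b x k d := by
  rcases mem_compl_gapSet.1 hx with h | ⟨k, hk⟩
  · exact ⟨0, _, gapSep_of_neg ha hab h 0⟩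
  · exact ⟨k, _, gapSep_of_mem ha hab hdisj hk⟩

namespace GapSep

variable {x : ℝ} {k : ℕ} {d : ℝ}

theorem ne_zero (h : GapSep a b x k d) : x ≠ 0 := by
  rintro rfl
  have := h.zero
  rw [abs_zero] at this
  linarith [h.pos]

theorem ne_of_le (h : GapSep a b x k d) {t : ℝ} (ht : d ≤ |t - x|) : x ≠ t := by
  rintro rfl
  rw [sub_self, abs_zero] at ht
  linarith [h.pos]

theorem ne_left (h : GapSep a b x k d) (hab : ∀ j, a j < b j) (j : ℕ) : x ≠ a j := by
  by_cases hj : j = k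
  · exact hj ▸ h.ne_of_le h.left
  · exact h.ne_of_le (h.gap j hj _ (left_mem_Icc.2 (hab j).le))

theorem ne_right (h : GapSep a b x k d) (hab : ∀ j, a j < b j) (j : ℕ) : x ≠ b j := by
  by_cases hj : j = k
  · exact hj ▸ h.ne_of_le h.right
  · exact h.ne_of_le (h.gap j hj _ (right_mem_Icc.2 (hab j).le))

theorem ne_mid (h : GapSep a b x k d) (hc : ∀ j, c j ∈ Icc (a j) (b j)) (hxc : x ≠ c k) (j : ℕ) :
    x ≠ c j := by
  by_cases hj : j = k
  · exact hj ▸ hxc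
  · exact h.ne_of_le (h.gap j hj _ (hc j))

theorem summable (h : GapSep a b x k d) (hlen : Summable fun j => b j - a j)
    (hc : ∀ j, c j ∈ Icc (a j) (b j)) : Summable fun j => gapLog (a j) (b j) (c j) x := by
  refine Summable.of_norm_bounded_eventually (hlen.div_const (2 * d)) ?_
  rw [Filter.eventually_cofinite]
  refine (finite_singleton k).subset fun j hj => ?_
  by_contra hjk
  exact hj (norm_gapLog_ofReal_le (hc j) h.pos (h.gap j hjk))

theorem tendsto_prodLog (h : GapSep a b x k d) (hab : ∀ j, a j < b j)
    (hlen : Summable fun j => b j - a j) (hc : ∀ j, c j ∈ Icc (a j) (b j)) (hxc : x ≠ c k) :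
    Tendsto (fun ε : ℝ => prodLog a b c ((x : ℂ) + ε * Complex.I)) (𝓝[>] 0)
      (𝓝 (prodLog a b c x)) := by
  have h0 := tendsto_log_vertical h.ne_zero
  simp only [Complex.ofReal_zero, sub_zero] at h0
  have hterm : ∀ j, Tendsto (fun ε : ℝ => gapLog (a j) (b j) (c j) ((x : ℂ) + ε * Complex.I))
      (𝓝[>] 0) (𝓝 (gapLog (a j) (b j) (c j) x)) := fun j =>
    tendsto_gapLog_vertical (h.ne_left hab j) (h.ne_right hab j) (h.ne_mid hc hxc j)
  refine (tendsto_const_nhds.sub (h0.div_const 2)).add ?_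
  refine tendsto_tsum_of_dominated_convergence (bound := fun j => (b j - a j) / (2 * d) +
    if j = k then ‖gapLog (a k) (b k) (c k) x‖ + 1 else 0) ?_ hterm ?_
  · refine (hlen.div_const _).add (summable_of_hasFiniteSupport ((finite_singleton k).subset ?_))
    intro j hj
    by_contra hjk
    exact hj (if_neg hjk)
  · have hk := (hterm k).norm.eventually (gt_mem_nhds (lt_add_one _))
    filter_upwards [self_mem_nhdsWithin, hk] with ε hε hεk j
    by_cases hj : j = k
    · subst hj
      rw [if_pos rfl]
      have : 0 ≤ (b j - a j) / (2 * d) := div_nonneg (by linarith [hab j]) (by linarith [h.pos])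
      linarith
    · rw [if_neg hj, add_zero]
      exact norm_gapLog_vertical_le (hc j) h.pos (h.gap j hj) hε

theorem herglotzProd_eq (h : GapSep a b x k d) (hab : ∀ j, a j < b j)
    (hlen : Summable fun j => b j - a j) (hc : ∀ j, c j ∈ Icc (a j) (b j)) (hxc : x ≠ c k) :
    herglotzProd a b c x = Complex.I * Complex.exp (prodLog a b c x) :=
  herglotzProd_eq_of_summable (by exact_mod_cast h.ne_zero)
    (fun j => by exact_mod_cast h.ne_left hab j) (fun j => by exact_mod_cast h.ne_right hab j)
    (fun j => by exact_mod_cast h.ne_mid hc hxc j) (h.summable hlen hc)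

theorem im_prodLog (h : GapSep a b x k d)
    (hlen : Summable fun j => b j - a j) (hc : ∀ j, c j ∈ Icc (a j) (b j)) :
    (prodLog a b c x).im = -(if x < 0 then Real.pi else 0) / 2 +
      (gapLog (a k) (b k) (c k) x).im := by
  have h2 : ∀ w : ℂ, (w / 2).im = w.im / 2 := fun w => by simp
  have h3 : (Complex.log 2).im = 0 := by
    rw [Complex.log_im, ← Complex.ofReal_ofNat, Complex.arg_ofReal_of_nonneg (by norm_num)]
  have h4 : (x : ℂ).arg = if x < 0 then Real.pi else 0 := by simpa using arg_ofReal_sub x 0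
  rw [prodLog, Complex.add_im, Complex.sub_im, Complex.neg_im, h3, h2, Complex.log_im, h4,
    Complex.im_tsum (h.summable hlen hc), tsum_eq_single k]
  · ring
  · intro j hj
    -- the two ends of the other gaps lie on the same side of `x`
    rw [im_gapLog_ofReal]
    have hside : ∀ t ∈ Icc (a j) (b j), (x < t ↔ x < a j) := by
      intro t ht
      refine ⟨fun hxt => ?_, fun hxa => hxa.trans_le ht.1⟩
      by_contra hxa
      have := h.gap j hj x ⟨not_lt.1 hxa, hxt.le.trans ht.2⟩
      rw [sub_self, abs_zero] at this
      linarith [h.pos]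
    have hle := (hc j).1.trans (hc j).2
    simp only [hside (c j) (hc j), hside (b j) (right_mem_Icc.2 hle)]
    ring

end GapSep

theorem herglotzProd_of_neg (ha : ∀ j, 0 ≤ a j) (hab : ∀ j, a j < b j)
    (hlen : Summable fun j => b j - a j) (hc : ∀ j, c j ∈ Icc (a j) (b j)) {x : ℝ} (hx : x < 0) :
    herglotzProd a b c x = ‖herglotzProd a b c x‖ := by
  have h := gapSep_of_neg ha hab hx 0
  have hxc : x ≠ c 0 := by have := (hc 0).1; have := ha 0; intro h; linarith
  rw [h.herglotzProd_eq hab hlen hc hxc, norm_mul, Complex.norm_I, one_mul]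
  refine I_mul_exp_of_im_eq_neg ?_
  rw [h.im_prodLog hlen hc, im_gapLog_ofReal, if_pos hx, if_pos, if_pos, if_pos]
  · ring
  all_goals linarith [ha 0, hab 0, (hc 0).1]

theorem herglotzProd_of_mem_right (ha : ∀ j, 0 ≤ a j) (hab : ∀ j, a j < b j)
    (hdisj : Pairwise fun j k => Disjoint (Ioo (a j) (b j)) (Ioo (a k) (b k)))
    (hlen : Summable fun j => b j - a j) (hc : ∀ j, c j ∈ Icc (a j) (b j)) {x : ℝ} {k : ℕ}
    (hx : x ∈ Ioo (c k) (b k)) : herglotzProd a b c x = ‖herglotzProd a b c x‖ := by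
  have h := gapSep_of_mem ha hab hdisj (k := k) ⟨(hc k).1.trans_lt hx.1, hx.2⟩
  rw [h.herglotzProd_eq hab hlen hc hx.1.ne', norm_mul, Complex.norm_I, one_mul]
  refine I_mul_exp_of_im_eq_neg ?_
  rw [h.im_prodLog hlen hc, im_gapLog_ofReal, if_neg, if_neg, if_neg, if_pos hx.2]
  · ring
  all_goals linarith [ha k, (hc k).1, hx.1]

theorem herglotzProd_of_mem_left (ha : ∀ j, 0 ≤ a j) (hab : ∀ j, a j < b j)
    (hdisj : Pairwise fun j k => Disjoint (Ioo (a j) (b j)) (Ioo (a k) (b k)))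
    (hlen : Summable fun j => b j - a j) (hc : ∀ j, c j ∈ Icc (a j) (b j)) {x : ℝ} {k : ℕ}
    (hx : x ∈ Ioo (a k) (c k)) : herglotzProd a b c x = -‖herglotzProd a b c x‖ := by
  have h := gapSep_of_mem ha hab hdisj (k := k) ⟨hx.1, hx.2.trans_le (hc k).2⟩
  rw [h.herglotzProd_eq hab hlen hc hx.2.ne, norm_mul, Complex.norm_I, one_mul]
  refine I_mul_exp_of_im_eq ?_
  rw [h.im_prodLog hlen hc, im_gapLog_ofReal, if_neg, if_pos hx.2, if_neg, if_pos]
  · ring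
  all_goals linarith [ha k, (hc k).2, hx.1, hx.2]

/-- The boundary values of `herglotzProd` off `gapSet` are real, apart from the points `c j`. -/
theorem im_herglotzProd_eq_zero (ha : ∀ j, 0 ≤ a j) (hab : ∀ j, a j < b j)
    (hdisj : Pairwise fun j k => Disjoint (Ioo (a j) (b j)) (Ioo (a k) (b k)))
    (hlen : Summable fun j => b j - a j) (hc : ∀ j, c j ∈ Icc (a j) (b j)) {x : ℝ}
    (hx : x ∈ (gapSet a b)ᶜ) (hxc : x ∉ range c) : (herglotzProd a b c x).im = 0 := by
  rcases mem_compl_gapSet.1 hx with h | ⟨k, hk⟩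
  · rw [herglotzProd_of_neg ha hab hlen hc h, Complex.ofReal_im]
  · rcases lt_or_gt_of_ne (show x ≠ c k from fun h => hxc ⟨k, h.symm⟩) with h | h
    · rw [herglotzProd_of_mem_left ha hab hdisj hlen hc ⟨hk.1, h⟩, Complex.neg_im,
        Complex.ofReal_im, neg_zero]
    · rw [herglotzProd_of_mem_right ha hab hdisj hlen hc ⟨h, hk.2⟩, Complex.ofReal_im]

/-- Almost every point off `gapSet` is separated from the singularities, and the logarithm has a
boundary value there. -/
theorem ae_tendsto_prodLog (ha : ∀ j, 0 ≤ a j) (hab : ∀ j, a j < b j)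
    (hdisj : Pairwise fun j k => Disjoint (Ioo (a j) (b j)) (Ioo (a k) (b k)))
    (hlen : Summable fun j => b j - a j) (hc : ∀ j, c j ∈ Icc (a j) (b j)) :
    ∀ᵐ x : ℝ, x ∈ (gapSet a b)ᶜ →
      Tendsto (fun ε : ℝ => prodLog a b c ((x : ℂ) + ε * Complex.I)) (𝓝[>] 0)
        (𝓝 (prodLog a b c x)) ∧
      herglotzProd a b c x = Complex.I * Complex.exp (prodLog a b c x) ∧
      (herglotzProd a b c x).im = 0 := by
  have h0 : ∀ᵐ x : ℝ, x ∉ range c := (countable_range c).ae_notMem _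
  filter_upwards [h0] with x hxc hx
  obtain ⟨k, d, h⟩ := exists_gapSep ha hab hdisj hx
  have hxk : x ≠ c k := fun h => hxc ⟨k, h.symm⟩
  exact ⟨h.tendsto_prodLog hab hlen hc hxk, h.herglotzProd_eq hab hlen hc hxk,
    im_herglotzProd_eq_zero ha hab hdisj hlen hc hx hxc⟩

theorem continuous_prodLog_horizontal (hlen : Summable fun j => b j - a j)
    (hc : ∀ j, c j ∈ Icc (a j) (b j)) {ε : ℝ} (hε : 0 < ε) :
    Continuous fun x : ℝ => prodLog a b c (x + ε * Complex.I) :=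
  continuous_comp_horizontal (fun _ hz => (differentiableAt_prodLog hlen hc hz).continuousAt) hε

theorem aestronglyMeasurable_prodLog (ha : ∀ j, 0 ≤ a j) (hab : ∀ j, a j < b j)
    (hdisj : Pairwise fun j k => Disjoint (Ioo (a j) (b j)) (Ioo (a k) (b k)))
    (hlen : Summable fun j => b j - a j) (hc : ∀ j, c j ∈ Icc (a j) (b j)) :
    AEStronglyMeasurable (fun x : ℝ => prodLog a b c x) (volume.restrict (gapSet a b)ᶜ) := by
  have hseq : Tendsto (fun n : ℕ => 1 / ((n : ℝ) + 1)) atTop (𝓝[>] 0) :=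
    tendsto_nhdsWithin_iff.2 ⟨tendsto_one_div_add_atTop_nhds_zero_nat,
      Eventually.of_forall fun n => by simp only [mem_Ioi]; positivity⟩
  refine aestronglyMeasurable_of_tendsto_ae atTop (f := fun (n : ℕ) (x : ℝ) =>
    prodLog a b c (x + ((1 / ((n : ℝ) + 1) : ℝ) : ℂ) * Complex.I)) (fun n =>
    (continuous_prodLog_horizontal hlen hc (by positivity)).aestronglyMeasurable) ?_
  rw [ae_restrict_iff' measurableSet_gapSet.compl]
  filter_upwards [ae_tendsto_prodLog ha hab hdisj hlen hc] with x hx hxE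
  exact (hx hxE).1.comp hseq

end Gaps

/-! ### Integrability of the boundary values -/

section Boundary

variable {a b c : ℕ → ℝ}

/-- The balance condition and the summability condition together say that the boundary values of
`herglotzProd` are integrable over the union of all gaps. -/
theorem integrableOn_iUnion_gaps (ha : ∀ j, 0 ≤ a j) (hab : ∀ j, a j < b j)
    (hdisj : Pairwise fun j k => Disjoint (Ioo (a j) (b j)) (Ioo (a k) (b k)))
    (hlen : Summable fun j => b j - a j) (hc : ∀ j, c j ∈ Icc (a j) (b j))
    (hint : ∀ j, IntegrableOn (fun x : ℝ => herglotzProd a b c x) (Ioo (a j) (b j)))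
    (hbal : ∀ j, -∫ x in (a j)..(c j), herglotzProd a b c x
      = ∫ x in (c j)..(b j), herglotzProd a b c x)
    (hPW : Summable fun j => ∫ x in (c j)..(b j), herglotzProd a b c x) :
    IntegrableOn (fun x : ℝ => herglotzProd a b c x) (⋃ j, Ioo (a j) (b j)) := by
  refine integrableOn_iUnion_of_summable_integral_norm hint ?_
  have hR : ∀ j, ∫ x in (c j)..(b j), herglotzProd a b c x =
      ((∫ x in Ioo (c j) (b j), ‖herglotzProd a b c x‖ : ℝ) : ℂ) := fun j => by
    rw [intervalIntegral.integral_of_le (hc j).2, integral_Ioc_eq_integral_Ioo,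
      ← integral_complex_ofReal]
    exact setIntegral_congr_fun measurableSet_Ioo fun x hx =>
      herglotzProd_of_mem_right ha hab hdisj hlen hc hx
  have hL : ∀ j, -∫ x in (a j)..(c j), herglotzProd a b c x =
      ((∫ x in Ioo (a j) (c j), ‖herglotzProd a b c x‖ : ℝ) : ℂ) := fun j => by
    rw [intervalIntegral.integral_of_le (hc j).1, integral_Ioc_eq_integral_Ioo,
      ← integral_complex_ofReal, ← integral_neg]
    refine setIntegral_congr_fun measurableSet_Ioo fun x hx => ?_
    nth_rewrite 1 [herglotzProd_of_mem_left ha hab hdisj hlen hc hx]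
    rw [neg_neg]
  have hsplit : ∀ j, ∫ x in Ioo (a j) (b j), ‖herglotzProd a b c x‖ =
      2 * ∫ x in Ioo (c j) (b j), ‖herglotzProd a b c x‖ := fun j => by
    have h1 : ∫ x in Ioo (a j) (c j), ‖herglotzProd a b c x‖ =
        ∫ x in Ioo (c j) (b j), ‖herglotzProd a b c x‖ := by
      have := hbal j
      rw [hL, hR] at this
      exact_mod_cast this
    have hi : IntegrableOn (fun x : ℝ => ‖herglotzProd a b c x‖) (Ioo (a j) (b j)) := (hint j).norm
    have hi1 : IntervalIntegrable (fun x : ℝ => ‖herglotzProd a b c x‖) volume (a j) (c j) :=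
      (intervalIntegrable_iff_integrableOn_Ioo_of_le (hc j).1).2
        (hi.mono_set (Ioo_subset_Ioo_right (hc j).2))
    have hi2 : IntervalIntegrable (fun x : ℝ => ‖herglotzProd a b c x‖) volume (c j) (b j) :=
      (intervalIntegrable_iff_integrableOn_Ioo_of_le (hc j).2).2
        (hi.mono_set (Ioo_subset_Ioo_left (hc j).1))
    have h2 := intervalIntegral.integral_add_adjacent_intervals hi1 hi2
    rw [intervalIntegral.integral_of_le (hc j).1, intervalIntegral.integral_of_le (hc j).2,
      intervalIntegral.integral_of_le (hab j).le, integral_Ioc_eq_integral_Ioo,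
      integral_Ioc_eq_integral_Ioo, integral_Ioc_eq_integral_Ioo, h1] at h2
    rw [← h2]
    ring
  simp_rw [hsplit]
  simp_rw [hR] at hPW
  exact (Complex.summable_ofReal.1 hPW).mul_left 2

theorem norm_herglotzProd_le_of_le_neg_one (ha : ∀ j, 0 ≤ a j) (hab : ∀ j, a j < b j)
    (hlen : Summable fun j => b j - a j) (hc : ∀ j, c j ∈ Icc (a j) (b j)) {x : ℝ}
    (hx : x ≤ -1) : ‖herglotzProd a b c x‖ ≤ Real.exp ((∑' j, (b j - a j)) / (2 * 1)) := by
  have h := gapSep_of_neg ha hab (show x < 0 by linarith) 0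
  have hxc : x ≠ c 0 := by have := (hc 0).1; have := ha 0; intro h; linarith
  have hn : ‖(x : ℂ)‖ = -x := by rw [Complex.norm_real, Real.norm_eq_abs, abs_of_neg (by linarith)]
  have h1 : ‖∑' j, gapLog (a j) (b j) (c j) x‖ ≤ (∑' j, (b j - a j)) / (2 * 1) := by
    refine tsum_of_norm_bounded (hlen.hasSum.div_const (2 * 1)) fun j => ?_
    refine norm_gapLog_ofReal_le (hc j) one_pos fun t ht => ?_
    exact le_trans (by linarith [ha j, ht.1]) (le_abs_self _)
  rw [h.herglotzProd_eq hab hlen hc hxc, norm_mul, Complex.norm_I, one_mul,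
    norm_exp_prodLog (by exact_mod_cast h.ne_zero), hn]
  have h2 : ‖Complex.exp (∑' j, gapLog (a j) (b j) (c j) x)‖ ≤
      Real.exp ((∑' j, (b j - a j)) / (2 * 1)) := by
    rw [Complex.norm_exp]
    exact Real.exp_le_exp.2 ((Complex.re_le_norm _).trans h1)
  have h3 : (-x) ^ (-(1 / 2) : ℝ) ≤ 1 :=
    Real.rpow_le_one_of_one_le_of_nonpos (by linarith) (by norm_num)
  have h4 : 0 ≤ (-x) ^ (-(1 / 2) : ℝ) := Real.rpow_nonneg (by linarith) _
  calc _ ≤ 1 * Real.exp ((∑' j, (b j - a j)) / (2 * 1)) := by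
        refine mul_le_mul (by linarith) h2 (norm_nonneg _) one_pos.le
    _ = _ := one_mul _

theorem aestronglyMeasurable_herglotzProd (ha : ∀ j, 0 ≤ a j) (hab : ∀ j, a j < b j)
    (hdisj : Pairwise fun j k => Disjoint (Ioo (a j) (b j)) (Ioo (a k) (b k)))
    (hlen : Summable fun j => b j - a j) (hc : ∀ j, c j ∈ Icc (a j) (b j)) :
    AEStronglyMeasurable (fun x : ℝ => herglotzProd a b c x)
      (volume.restrict (gapSet a b)ᶜ) := by
  have h1 := (Complex.continuous_exp.comp_aestronglyMeasurable
    (aestronglyMeasurable_prodLog ha hab hdisj hlen hc)).const_mul Complex.I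
  refine h1.congr ?_
  rw [Filter.EventuallyEq, ae_restrict_iff' measurableSet_gapSet.compl]
  filter_upwards [ae_tendsto_prodLog ha hab hdisj hlen hc] with x hx hxE
  exact (hx hxE).2.1.symm

theorem integrableOn_norm_herglotzProd (ha : ∀ j, 0 ≤ a j) (hab : ∀ j, a j < b j)
    (hdisj : Pairwise fun j k => Disjoint (Ioo (a j) (b j)) (Ioo (a k) (b k)))
    (hlen : Summable fun j => b j - a j) (hc : ∀ j, c j ∈ Icc (a j) (b j))
    (hint : ∀ j, IntegrableOn (fun x : ℝ => herglotzProd a b c x) (Ioo (a j) (b j)))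
    (hbal : ∀ j, -∫ x in (a j)..(c j), herglotzProd a b c x
      = ∫ x in (c j)..(b j), herglotzProd a b c x)
    (hzero : IntegrableOn (fun x : ℝ => herglotzProd a b c x) (Ioo (-1) 0))
    (hPW : Summable fun j => ∫ x in (c j)..(b j), herglotzProd a b c x) :
    IntegrableOn (fun x : ℝ => ‖herglotzProd a b c x‖ * (1 + x ^ 2)⁻¹) (gapSet a b)ᶜ := by
  have hw : ∀ (s : Set ℝ), IntegrableOn (fun x : ℝ => herglotzProd a b c x) s →
      IntegrableOn (fun x : ℝ => ‖herglotzProd a b c x‖ * (1 + x ^ 2)⁻¹) s := fun s hs => by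
    refine hs.norm.mul_bdd (c := 1) (Continuous.aestronglyMeasurable
      ((by fun_prop : Continuous fun x : ℝ => 1 + x ^ 2).inv₀ fun x => by positivity))
      (Eventually.of_forall fun x => ?_)
    rw [norm_inv, Real.norm_of_nonneg (by positivity)]
    exact inv_le_one_of_one_le₀ (by nlinarith [sq_nonneg x])
  have h1 : IntegrableOn (fun x : ℝ => ‖herglotzProd a b c x‖ * (1 + x ^ 2)⁻¹) (Iic (-1)) := by
    have hsub : Iic (-1 : ℝ) ⊆ (gapSet a b)ᶜ := fun x hx =>
      mem_compl_gapSet.2 (Or.inl (by simp only [mem_Iic] at hx; linarith))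
    refine Integrable.bdd_mul (c := Real.exp ((∑' j, (b j - a j)) / (2 * 1)))
      integrable_inv_one_add_sq.integrableOn
      ((aestronglyMeasurable_herglotzProd ha hab hdisj hlen hc).mono_measure
        (Measure.restrict_mono hsub le_rfl)).norm ?_
    refine (ae_restrict_iff' measurableSet_Iic).2 (Eventually.of_forall fun x hx => ?_)
    rw [norm_norm]
    exact norm_herglotzProd_le_of_le_neg_one ha hab hlen hc hx
  have h2 := (h1.union (hw _ hzero)).union
    (hw _ (integrableOn_iUnion_gaps ha hab hdisj hlen hc hint hbal hPW))
  refine h2.mono_set fun x hx => ?_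
  rcases mem_compl_gapSet.1 hx with h | ⟨k, hk⟩
  · left
    by_cases h' : x ≤ -1
    · exact Or.inl h'
    · exact Or.inr ⟨not_le.1 h', h⟩
  · exact Or.inr (mem_iUnion.2 ⟨k, hk⟩)

/-! ### The boundary argument on `gapSet` -/

/-- The harmonic measure of the gaps and of the negative axis, seen from `x + i ε`, tends to zero in
the mean over `x ∈ gapSet`. -/
theorem tendsto_lintegral_im_prodLog (ha : ∀ j, 0 ≤ a j)
    (hdisj : Pairwise fun j k => Disjoint (Ioo (a j) (b j)) (Ioo (a k) (b k)))
    (hlen : Summable fun j => b j - a j) (hc : ∀ j, c j ∈ Icc (a j) (b j))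
    {ε : ℕ → ℝ} (hε : ∀ n, 0 < ε n) (hε0 : Tendsto ε atTop (𝓝 0)) :
    Tendsto (fun n => ∫⁻ x in gapSet a b,
      ENNReal.ofReal (|(prodLog a b c (x + ε n * Complex.I)).im| * (1 + x ^ 2)⁻¹)) atTop (𝓝 0) := by
  set G := ⋃ j, Ioo (a j) (b j) with hG
  have hGm : MeasurableSet G := MeasurableSet.iUnion fun _ => measurableSet_Ioo
  have hGo : IsOpen G := isOpen_iUnion fun _ => isOpen_Ioo
  have hGE : Disjoint G (gapSet a b) := disjoint_sdiff_right
  have hGvol : volume G ≠ ⊤ := by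
    rw [hG, measure_iUnion hdisj fun _ => measurableSet_Ioo]
    simp_rw [Real.volume_Ioo]
    exact hlen.tsum_ofReal_ne_top
  have hseq : Tendsto ε atTop (𝓝[>] 0) :=
    tendsto_nhdsWithin_iff.2 ⟨hε0, Eventually.of_forall hε⟩
  -- the angle under which the negative axis is seen tends to zero at every positive point
  have h1 : Tendsto (fun n => ∫⁻ x in gapSet a b,
      ENNReal.ofReal (((x : ℂ) + ε n * Complex.I).arg * (1 + x ^ 2)⁻¹)) atTop (𝓝 0) := by
    have := tendsto_lintegral_of_dominated_convergence (μ := volume.restrict (gapSet a b))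
      (F := fun n x => ENNReal.ofReal (((x : ℂ) + ε n * Complex.I).arg * (1 + x ^ 2)⁻¹))
      (f := fun _ => 0) (fun x => ENNReal.ofReal (Real.pi * (1 + x ^ 2)⁻¹)) ?_ ?_ ?_ ?_
    · simpa using this
    · intro n
      refine Measurable.ennreal_ofReal (Measurable.mul ?_ (by fun_prop))
      exact Complex.measurable_arg.comp (by fun_prop)
    · intro n
      refine Eventually.of_forall fun x => ENNReal.ofReal_le_ofReal ?_
      have := Complex.arg_le_pi ((x : ℂ) + ε n * Complex.I)
      gcongr
    · exact (((integrable_inv_one_add_sq.const_mul Real.pi).integrableOn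
        (s := gapSet a b)).lintegral_lt_top).ne
    · refine (ae_restrict_iff' measurableSet_gapSet).2 ?_
      have h0 : ∀ᵐ x : ℝ, x ∉ ({0} : Set ℝ) := (countable_singleton 0).ae_notMem _
      filter_upwards [h0] with x hx0 hxE
      have hx : 0 < x := lt_of_le_of_ne hxE.1 (fun h => hx0 h.symm)
      have h2 := (tendsto_log_vertical (x := x) (t := 0) hx.ne').comp hseq
      have h3 := (Complex.continuous_im.tendsto _).comp h2
      simp only [Complex.ofReal_zero, sub_zero, Complex.log_im, Complex.arg_ofReal_of_nonneg hx.le]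
        at h3
      have h4 : Tendsto (fun n => ((x : ℂ) + ε n * Complex.I).arg) atTop (𝓝 0) := by
        simpa [Function.comp_def, Complex.log_im] using h3
      have h5 := ENNReal.tendsto_ofReal (h4.mul_const ((1 + x ^ 2)⁻¹))
      simpa using h5
  -- for the gaps the order of integration is exchanged: seen from a point of a gap, the harmonic
  -- measure of `gapSet` tends to zero, and the gaps have finite total length
  have hmeas : ∀ n, Measurable fun q : ℝ × ℝ => ENNReal.ofReal (poissonLine (ε n) (q.1 - q.2)) :=
    fun n => (measurable_poissonLine.comp (measurable_const.prodMk
      (measurable_fst.sub measurable_snd))).ennreal_ofReal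
  have h2 : Tendsto (fun n => ∫⁻ t in G, ∫⁻ x in gapSet a b,
      ENNReal.ofReal (poissonLine (ε n) (t - x))) atTop (𝓝 0) := by
    have := tendsto_lintegral_of_dominated_convergence (μ := volume.restrict G)
      (F := fun n t => ∫⁻ x in gapSet a b, ENNReal.ofReal (poissonLine (ε n) (t - x)))
      (f := fun _ => 0) (fun _ => ENNReal.ofReal Real.pi) ?_ ?_ ?_ ?_
    · simpa using this
    · exact fun n => (hmeas n).lintegral_prod_right'
    · refine fun n => Eventually.of_forall fun t => ?_
      rw [← lintegral_poissonLine_sub (hε n) t]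
      exact setLIntegral_le_lintegral _ _
    · rw [setLIntegral_const]
      exact ENNReal.mul_ne_top ENNReal.ofReal_ne_top hGvol
    · refine (ae_restrict_iff' hGm).2 (Eventually.of_forall fun t ht => ?_)
      obtain ⟨δ, hδ, hball⟩ := Metric.isOpen_iff.1 hGo t ht
      have hsub : Ioc (t - δ / 2) (t + δ / 2) ⊆ G := fun x hx => hball <| by
        rw [Metric.mem_ball, Real.dist_eq, abs_lt]
        constructor <;> linarith [hx.1, hx.2]
      have hle : ∀ n, ∫⁻ x in gapSet a b, ENNReal.ofReal (poissonLine (ε n) (t - x)) ≤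
          ENNReal.ofReal Real.pi - ENNReal.ofReal (2 * Real.arctan (δ / 2 / ε n)) := fun n => by
        refine ENNReal.le_sub_of_add_le_right ENNReal.ofReal_ne_top ?_
        rw [← lintegral_poissonLine_Ioc (hε n) t (by linarith : 0 ≤ δ / 2),
          ← lintegral_poissonLine_sub (hε n) t,
          ← lintegral_union measurableSet_Ioc (hGE.symm.mono_right hsub)]
        exact setLIntegral_le_lintegral _ _
      have hlim := ENNReal.Tendsto.sub (tendsto_const_nhds (x := ENNReal.ofReal Real.pi)
        (f := atTop (α := ℕ))) (ENNReal.tendsto_ofReal (tendsto_arctan_div hε hε0 (half_pos hδ)))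
        (Or.inl ENNReal.ofReal_ne_top)
      rw [tsub_self] at hlim
      exact tendsto_of_tendsto_of_tendsto_of_le_of_le tendsto_const_nhds hlim
        (fun _ => zero_le) hle
  have h12 := h1.add h2
  rw [add_zero] at h12
  refine tendsto_of_tendsto_of_tendsto_of_le_of_le tendsto_const_nhds h12 (fun _ => zero_le)
    fun n => ?_
  beta_reduce
  rw [lintegral_lintegral_swap (hmeas n).aemeasurable, ← lintegral_add_right]
  · refine lintegral_mono fun x => ?_
    set z : ℂ := x + ε n * Complex.I with hz
    have hzim : z.im = ε n := by simp [hz]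
    have hzre : z.re = x := by simp [hz]
    have hz0 : 0 < z.im := hzim ▸ hε n
    have key := (abs_im_prodLog_le ha hdisj hlen hc hz0).1
    rw [hzim, hzre] at key
    rw [← ofReal_integral_eq_lintegral_ofReal
      (integrable_poissonLine_sub (hε n) x).integrableOn
      (Eventually.of_forall fun _ => poissonLine_nonneg (hε n).le _), ← ENNReal.ofReal_add]
    · refine ENNReal.ofReal_le_ofReal ?_
      have harg : 0 ≤ z.arg := Complex.arg_nonneg_iff.2 hz0.le
      have hI : 0 ≤ ∫ t in G, poissonLine (ε n) (t - x) :=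
        integral_nonneg fun _ => poissonLine_nonneg (hε n).le _
      have hw0 : (0 : ℝ) < (1 + x ^ 2)⁻¹ := by positivity
      have hw1 : (1 + x ^ 2)⁻¹ ≤ (1 : ℝ) := inv_le_one_of_one_le₀ (by nlinarith [sq_nonneg x])
      calc _ ≤ (z.arg + ∫ t in G, poissonLine (ε n) (t - x)) * (1 + x ^ 2)⁻¹ := by
            gcongr
            linarith
        _ ≤ _ := by
            rw [add_mul]
            gcongr
            exact mul_le_of_le_one_right hI hw1
    · exact mul_nonneg (Complex.arg_nonneg_iff.2 hz0.le) (by positivity)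
    · exact integral_nonneg fun _ => poissonLine_nonneg (hε n).le _
  · exact ((hmeas n).comp measurable_swap).lintegral_prod_right'

end Boundary

/-! ### Kolmogorov's estimate and the boundary values of the square root -/

section Shift

variable {a b c : ℕ → ℝ}

theorem norm_exp_real_mul (r : ℝ) (w : ℂ) : ‖Complex.exp (r * w)‖ = ‖Complex.exp w‖ ^ r := by
  rw [Complex.norm_exp, Complex.norm_exp, ← Real.exp_mul, Complex.re_ofReal_mul, mul_comm]

theorem norm_le_norm_add_mul_I {z : ℂ} (hz : 0 ≤ z.im) {ε : ℝ} (hε : 0 ≤ ε) :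
    ‖z‖ ≤ ‖z + ε * Complex.I‖ := by
  rw [← sq_le_sq₀ (norm_nonneg _) (norm_nonneg _), Complex.sq_norm, Complex.sq_norm,
    Complex.normSq_apply, Complex.normSq_apply]
  simp
  nlinarith

theorem decay_exp_prodLog (hlen : Summable fun j => b j - a j)
    (hc : ∀ j, c j ∈ Icc (a j) (b j)) {r : ℝ} (hr : 0 < r) {ε : ℝ} (hε : 0 < ε) :
    ∃ C : ℝ, ∀ z : ℂ, 0 ≤ z.im →
      ‖Complex.exp (r * prodLog a b c (z + ε * Complex.I))‖ ≤ C * (1 + ‖z‖) ^ (-(r / 2)) := by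
  set L := ∑' j, (b j - a j)
  have hL : 0 ≤ L := tsum_nonneg fun j => by linarith [(hc j).1, (hc j).2]
  set κ := 1 / ε + 1 with hκ
  have hκ0 : 0 < κ := by positivity
  refine ⟨(κ ^ (1 / 2 : ℝ) * Real.exp (L / (2 * ε))) ^ r, fun z hz => ?_⟩
  set ζ := z + ε * Complex.I with hζ
  have him : ζ.im = z.im + ε := by simp [hζ]
  have hζ0 : 0 < ζ.im := by rw [him]; linarith
  have h1 : ε ≤ ‖ζ‖ := by
    refine le_trans ?_ (Complex.abs_im_le_norm _)
    rw [him]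
    exact le_trans (by linarith) (le_abs_self _)
  have h2 : 1 + ‖z‖ ≤ κ * ‖ζ‖ := by
    have h3 := norm_le_norm_add_mul_I hz hε.le
    have h4 : 1 ≤ 1 / ε * ‖ζ‖ := by rw [one_div_mul_eq_div, one_le_div hε]; exact h1
    rw [hκ, add_mul, one_mul]
    exact add_le_add h4 h3
  have h5 : ‖ζ‖ ^ (-(1 / 2) : ℝ) ≤ κ ^ (1 / 2 : ℝ) * (1 + ‖z‖) ^ (-(1 / 2) : ℝ) := by
    have h6 : ‖ζ‖ ^ (-(1 / 2) : ℝ) = κ ^ (1 / 2 : ℝ) * (κ * ‖ζ‖) ^ (-(1 / 2) : ℝ) := by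
      rw [Real.mul_rpow hκ0.le (norm_nonneg _), ← mul_assoc, ← Real.rpow_add hκ0]
      norm_num
    rw [h6]
    gcongr ?_ * ?_
    exact Real.rpow_le_rpow_of_nonpos (by positivity) h2 (by norm_num)
  have h7 : Real.exp (L / (2 * ζ.im)) ≤ Real.exp (L / (2 * ε)) := by
    rw [him]
    gcongr
    linarith
  have h8 := norm_exp_prodLog_le hlen hc hζ0
  rw [norm_exp_real_mul]
  calc _ ≤ ((κ ^ (1 / 2 : ℝ) * Real.exp (L / (2 * ε))) * (1 + ‖z‖) ^ (-(1 / 2) : ℝ)) ^ r := by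
        refine Real.rpow_le_rpow (norm_nonneg _) (h8.trans ?_) hr.le
        calc _ ≤ (κ ^ (1 / 2 : ℝ) * (1 + ‖z‖) ^ (-(1 / 2) : ℝ)) * Real.exp (L / (2 * ε)) :=
              mul_le_mul h5 h7 (Real.exp_pos _).le (by positivity)
          _ = _ := by ring
    _ = _ := by
        rw [Real.mul_rpow (by positivity) (by positivity), ← Real.rpow_mul (by positivity)]
        congr 2
        ring

theorem differentiableAt_exp_prodLog_shift (hlen : Summable fun j => b j - a j)
    (hc : ∀ j, c j ∈ Icc (a j) (b j)) (r : ℝ) {ε : ℝ} (hε : 0 < ε) {z : ℂ} (hz : 0 ≤ z.im) :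
    DifferentiableAt ℂ (fun z => Complex.exp (r * prodLog a b c (z + ε * Complex.I))) z := by
  refine ((DifferentiableAt.comp z (differentiableAt_prodLog hlen hc ?_)
    (differentiableAt_id.add_const _)).const_mul _).cexp
  simp
  linarith

theorem poissonLine_one (x : ℝ) : poissonLine 1 x = (1 + x ^ 2)⁻¹ := by
  rw [poissonLine, one_pow, one_div, add_comm]

/-- Kolmogorov's estimate for the power `3 / 4` of `herglotzProd / i`, whose values lie in the
sector `|arg| ≤ 3 π / 8`, so that their norm is controlled by their real part. -/
theorem exists_integral_rpow_le (ha : ∀ j, 0 ≤ a j)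
    (hdisj : Pairwise fun j k => Disjoint (Ioo (a j) (b j)) (Ioo (a k) (b k)))
    (hlen : Summable fun j => b j - a j) (hc : ∀ j, c j ∈ Icc (a j) (b j)) :
    ∃ C : ℝ, 0 ≤ C ∧ ∀ ε : ℝ, 0 < ε →
      ∫⁻ x : ℝ, ENNReal.ofReal (‖Complex.exp (prodLog a b c (x + ε * Complex.I))‖ ^ (3 / 4 : ℝ) *
        (1 + x ^ 2)⁻¹) ≤ ENNReal.ofReal C := by
  set L := ∑' j, (b j - a j)
  have hL : 0 ≤ L := tsum_nonneg fun j => by linarith [(hc j).1, (hc j).2]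
  set σ := Real.cos (3 / 4 * (Real.pi / 2)) with hσ
  have hσ0 : 0 < σ := Real.cos_pos_of_mem_Ioo ⟨by linarith [Real.pi_pos], by linarith [Real.pi_pos]⟩
  refine ⟨σ⁻¹ * (Real.pi * Real.exp (L / 2) ^ (3 / 4 : ℝ)), by positivity, fun ε hε => ?_⟩
  set F : ℂ → ℂ := fun z => Complex.I *
    Complex.exp ((3 / 4 : ℝ) * prodLog a b c (z + ε * Complex.I)) with hF
  obtain ⟨C, hC⟩ := decay_exp_prodLog (a := a) (b := b) (c := c) hlen hc
    (r := 3 / 4) (by norm_num) hε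
  obtain ⟨hi, hval⟩ := poisson_formula_im (F := F) (C := C) (s := 3 / 4 / 2) (by norm_num)
    (fun z hz => (differentiableAt_exp_prodLog_shift hlen hc _ hε hz).const_mul _)
    (fun z hz => by simpa [hF] using hC z hz) (z := Complex.I) (by simp)
  have hFim : ∀ z : ℂ, (F z).im =
      (Complex.exp ((3 / 4 : ℝ) * prodLog a b c (z + ε * Complex.I))).re := fun z => by
    rw [hF, Complex.I_mul_im]
  have hlow : ∀ x : ℝ, σ * (‖Complex.exp (prodLog a b c (x + ε * Complex.I))‖ ^ (3 / 4 : ℝ) *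
      (1 + x ^ 2)⁻¹) ≤ (F x).im * poissonLine Complex.I.im (x - Complex.I.re) := fun x => by
    rw [hFim, Complex.I_im, Complex.I_re, sub_zero, poissonLine_one, ← mul_assoc,
      ← norm_exp_real_mul]
    gcongr
    set lam := prodLog a b c (x + ε * Complex.I)
    have h1 := (abs_im_prodLog_le ha hdisj hlen hc (z := x + ε * Complex.I) (by simp [hε])).2
    rw [Complex.exp_re, Complex.norm_exp, mul_comm, Complex.im_ofReal_mul]
    gcongr
    rw [← Real.cos_abs (3 / 4 * lam.im), abs_mul, abs_of_pos (by norm_num : (0 : ℝ) < 3 / 4)]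
    refine Real.cos_le_cos_of_nonneg_of_le_pi (by positivity) ?_ (by gcongr)
    linarith [Real.pi_pos]
  have hup : (F Complex.I).im ≤ Real.exp (L / 2) ^ (3 / 4 : ℝ) := by
    rw [hFim]
    refine (Complex.re_le_norm _).trans ?_
    rw [norm_exp_real_mul]
    have h2 : Complex.I + ε * Complex.I = ((1 + ε : ℝ) : ℂ) * Complex.I := by push_cast; ring
    have him : (Complex.I + ε * Complex.I).im = 1 + ε := by simp
    have h1 := norm_exp_prodLog_le (a := a) (b := b) (c := c) hlen hc
      (z := Complex.I + ε * Complex.I) (by rw [him]; linarith)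
    refine Real.rpow_le_rpow (norm_nonneg _) (h1.trans ?_) (by norm_num)
    rw [him]
    have h3 : ‖Complex.I + ε * Complex.I‖ = 1 + ε := by
      rw [h2, norm_mul, Complex.norm_I, mul_one, Complex.norm_real,
        Real.norm_of_nonneg (by linarith)]
    rw [h3]
    calc _ ≤ 1 * Real.exp (L / 2) := by
          refine mul_le_mul (Real.rpow_le_one_of_one_le_of_nonpos (by linarith) (by norm_num)) ?_
            (Real.exp_pos _).le one_pos.le
          refine Real.exp_le_exp.2 (div_le_div_of_nonneg_left hL (by norm_num) (by linarith))
      _ = _ := one_mul _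
  calc _ ≤ ∫⁻ x : ℝ, ENNReal.ofReal (σ⁻¹ *
          ((F x).im * poissonLine Complex.I.im (x - Complex.I.re))) := by
        refine lintegral_mono fun x => ENNReal.ofReal_le_ofReal ?_
        rw [← div_eq_inv_mul, le_div_iff₀' hσ0]
        exact hlow x
    _ = ENNReal.ofReal (∫ x : ℝ, σ⁻¹ *
          ((F x).im * poissonLine Complex.I.im (x - Complex.I.re))) := by
        refine (ofReal_integral_eq_lintegral_ofReal (hi.const_mul _)
          (Eventually.of_forall fun x => ?_)).symm
        refine mul_nonneg (by positivity) (le_trans ?_ (hlow x))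
        positivity
    _ ≤ _ := by
        rw [integral_const_mul, ← hval]
        gcongr

/-- The boundary values of the imaginary part of `(herglotzProd / i) ^ (1 / 2)`. They vanish on
`gapSet`, where `herglotzProd / i` is positive. -/
noncomputable def sqrtBoundary (a b c : ℕ → ℝ) : ℝ → ℝ :=
  (gapSet a b)ᶜ.indicator fun x => (Complex.exp (((1 / 2 : ℝ) : ℂ) * prodLog a b c x)).im

/-- The weight `dx / (1 + x²)`, as a measure. -/
noncomputable def poissonWeight : Measure ℝ :=
  volume.withDensity fun x => ENNReal.ofReal ((1 + x ^ 2)⁻¹)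

instance : IsFiniteMeasure poissonWeight :=
  isFiniteMeasure_withDensity_ofReal integrable_inv_one_add_sq.2

theorem lintegral_poissonWeight (f : ℝ → ENNReal) :
    ∫⁻ x, f x ∂poissonWeight = ∫⁻ x, ENNReal.ofReal ((1 + x ^ 2)⁻¹) * f x := by
  rw [poissonWeight, lintegral_withDensity_eq_lintegral_mul_non_measurable _ (by fun_prop)
    (Eventually.of_forall fun _ => ENNReal.ofReal_lt_top)]
  rfl

theorem setLIntegral_poissonWeight {s : Set ℝ} (hs : MeasurableSet s) (f : ℝ → ENNReal) :
    ∫⁻ x in s, f x ∂poissonWeight = ∫⁻ x in s, ENNReal.ofReal ((1 + x ^ 2)⁻¹) * f x := by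
  rw [← lintegral_indicator hs, ← lintegral_indicator hs, lintegral_poissonWeight]
  refine lintegral_congr fun x => ?_
  by_cases hx : x ∈ s
  · simp [hx]
  · simp [hx]

theorem poissonWeight_restrict_ac (s : Set ℝ) :
    poissonWeight.restrict s ≪ volume.restrict s :=
  (withDensity_absolutelyContinuous _ _).restrict s

theorem abs_im_exp_half_le (w : ℂ) :
    (Complex.exp (((1 / 2 : ℝ) : ℂ) * w)).im ^ 2 ≤ ‖Complex.exp w‖ := by
  have h1 : ‖Complex.exp (((1 / 2 : ℝ) : ℂ) * w)‖ ^ 2 = ‖Complex.exp w‖ := by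
    rw [norm_exp_real_mul, ← Real.rpow_natCast, ← Real.rpow_mul (norm_nonneg _)]
    norm_num
  rw [← h1, ← sq_abs]
  gcongr
  exact Complex.abs_im_le_norm _

theorem aestronglyMeasurable_sqrtBoundary (ha : ∀ j, 0 ≤ a j) (hab : ∀ j, a j < b j)
    (hdisj : Pairwise fun j k => Disjoint (Ioo (a j) (b j)) (Ioo (a k) (b k)))
    (hlen : Summable fun j => b j - a j) (hc : ∀ j, c j ∈ Icc (a j) (b j)) :
    AEStronglyMeasurable (sqrtBoundary a b c) := by
  refine (aestronglyMeasurable_indicator_iff measurableSet_gapSet.compl).2 ?_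
  exact (by fun_prop : Continuous fun w : ℂ =>
    (Complex.exp (((1 / 2 : ℝ) : ℂ) * w)).im).comp_aestronglyMeasurable
      (aestronglyMeasurable_prodLog ha hab hdisj hlen hc)

theorem integrable_sqrtBoundary_sq (ha : ∀ j, 0 ≤ a j) (hab : ∀ j, a j < b j)
    (hdisj : Pairwise fun j k => Disjoint (Ioo (a j) (b j)) (Ioo (a k) (b k)))
    (hlen : Summable fun j => b j - a j) (hc : ∀ j, c j ∈ Icc (a j) (b j))
    (hm : IntegrableOn (fun x : ℝ => ‖herglotzProd a b c x‖ * (1 + x ^ 2)⁻¹) (gapSet a b)ᶜ) :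
    Integrable fun x => sqrtBoundary a b c x ^ 2 * (1 + x ^ 2)⁻¹ := by
  have hmeas := aestronglyMeasurable_sqrtBoundary ha hab hdisj hlen hc
  rw [← integrable_indicator_iff measurableSet_gapSet.compl] at hm
  refine hm.mono' ((hmeas.pow 2).mul (Continuous.aestronglyMeasurable
    ((by fun_prop : Continuous fun x : ℝ => 1 + x ^ 2).inv₀ fun x => by positivity))) ?_
  filter_upwards [ae_tendsto_prodLog ha hab hdisj hlen hc] with x hx
  rw [Real.norm_of_nonneg (by positivity)]
  by_cases hxE : x ∈ (gapSet a b)ᶜ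
  · rw [sqrtBoundary, indicator_of_mem hxE, indicator_of_mem hxE, (hx hxE).2.1, norm_mul,
      Complex.norm_I, one_mul]
    gcongr
    exact abs_im_exp_half_le _
  · rw [sqrtBoundary, indicator_of_notMem hxE, indicator_of_notMem hxE]
    simp

theorem integrable_sqrtBoundary (ha : ∀ j, 0 ≤ a j) (hab : ∀ j, a j < b j)
    (hdisj : Pairwise fun j k => Disjoint (Ioo (a j) (b j)) (Ioo (a k) (b k)))
    (hlen : Summable fun j => b j - a j) (hc : ∀ j, c j ∈ Icc (a j) (b j))
    (hm : IntegrableOn (fun x : ℝ => ‖herglotzProd a b c x‖ * (1 + x ^ 2)⁻¹) (gapSet a b)ᶜ) :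
    Integrable fun x => sqrtBoundary a b c x * (1 + x ^ 2)⁻¹ := by
  have hmeas := aestronglyMeasurable_sqrtBoundary ha hab hdisj hlen hc
  refine ((integrable_sqrtBoundary_sq ha hab hdisj hlen hc hm).add
    integrable_inv_one_add_sq).mono' (hmeas.mul (Continuous.aestronglyMeasurable
    ((by fun_prop : Continuous fun x : ℝ => 1 + x ^ 2).inv₀ fun x => by positivity)))
    (Eventually.of_forall fun x => ?_)
  have hw : (0 : ℝ) < (1 + x ^ 2)⁻¹ := by positivity
  rw [norm_mul, Real.norm_eq_abs, Real.norm_of_nonneg hw.le, Pi.add_apply, ← add_one_mul]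
  gcongr
  rw [← sq_abs]
  nlinarith [sq_nonneg (|sqrtBoundary a b c x| - 1 / 2)]

end Shift

/-! ### The Nevanlinna representation of the square root -/

section SquareRoot

variable {a b c : ℕ → ℝ}

theorem norm_exp_rpow_three_quarters (w : ℂ) :
    ‖Complex.exp w‖ ^ (3 / 4 : ℝ) = (‖Complex.exp w‖ ^ (1 / 4 : ℝ)) ^ 3 := by
  rw [← Real.rpow_natCast, ← Real.rpow_mul (norm_nonneg _)]
  norm_num

theorem norm_exp_half (w : ℂ) :
    ‖Complex.exp (((1 / 2 : ℝ) : ℂ) * w)‖ = (‖Complex.exp w‖ ^ (1 / 4 : ℝ)) ^ 2 := by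
  rw [norm_exp_real_mul, ← Real.rpow_natCast, ← Real.rpow_mul (norm_nonneg _)]
  norm_num

/-- The imaginary part of `exp (w / 2)` is small if `w` has small imaginary part, unless `exp w`
is large. -/
theorem abs_im_exp_half_le_add (w : ℂ) {δ : ℝ} (hδ : 0 < δ) :
    |(Complex.exp (((1 / 2 : ℝ) : ℂ) * w)).im| ≤
      δ * ‖Complex.exp w‖ ^ (3 / 4 : ℝ) + (δ ^ 2)⁻¹ * |w.im| := by
  have h1 : |(Complex.exp (((1 / 2 : ℝ) : ℂ) * w)).im| =
      (‖Complex.exp w‖ ^ (1 / 4 : ℝ)) ^ 2 * |Real.sin (w.im / 2)| := by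
    rw [← norm_exp_half, Complex.exp_im, Complex.norm_exp, abs_mul, Real.abs_exp,
      Complex.im_ofReal_mul, one_div_mul_eq_div]
  rw [h1, norm_exp_rpow_three_quarters]
  set X := ‖Complex.exp w‖ ^ (1 / 4 : ℝ)
  have hX : 0 ≤ X := by positivity
  set Y := |Real.sin (w.im / 2)|
  have hY : 0 ≤ Y := abs_nonneg _
  have hY1 : Y ≤ 1 := Real.abs_sin_le_one _
  have hYw : Y ≤ |w.im| := by
    refine (Real.abs_sin_le_abs).trans ?_
    rw [abs_div, abs_two]
    linarith [abs_nonneg w.im]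
  rcases le_total Y (δ * X) with h | h
  · have : X ^ 2 * Y ≤ δ * X ^ 3 := by
      calc _ ≤ X ^ 2 * (δ * X) := by gcongr
        _ = _ := by ring
    have h2 : 0 ≤ (δ ^ 2)⁻¹ * |w.im| := by positivity
    linarith
  · have h2 : X ^ 2 * Y ≤ (δ ^ 2)⁻¹ * |w.im| := by
      rw [← div_eq_inv_mul, le_div_iff₀ (by positivity)]
      calc _ = (δ * X) ^ 2 * Y := by ring
        _ ≤ Y ^ 2 * Y := by gcongr
        _ ≤ 1 ^ 2 * |w.im| := by gcongr
        _ = _ := by ring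
    have h3 : 0 ≤ δ * X ^ 3 := by positivity
    linarith

theorem abs_im_exp_half_le_of_le (w : ℂ) {δ : ℝ} (hδ : 0 < δ)
    (h : (δ ^ 2)⁻¹ ≤ |(Complex.exp (((1 / 2 : ℝ) : ℂ) * w)).im|) :
    |(Complex.exp (((1 / 2 : ℝ) : ℂ) * w)).im| ≤ δ * ‖Complex.exp w‖ ^ (3 / 4 : ℝ) := by
  have h1 := Complex.abs_im_le_norm (Complex.exp (((1 / 2 : ℝ) : ℂ) * w))
  rw [norm_exp_half] at h1
  rw [norm_exp_rpow_three_quarters]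
  set X := ‖Complex.exp w‖ ^ (1 / 4 : ℝ)
  have hX : 0 ≤ X := by positivity
  have h2 : 1 ≤ δ * X := by
    have h3 := h.trans h1
    rw [inv_le_iff_one_le_mul₀ (by positivity)] at h3
    have : (1 : ℝ) ^ 2 ≤ (δ * X) ^ 2 := by rw [mul_pow]; linarith
    exact (sq_le_sq₀ zero_le_one (by positivity)).1 this
  calc _ ≤ X ^ 2 := h1
    _ ≤ X ^ 2 * (δ * X) := le_mul_of_one_le_right (by positivity) h2
    _ = _ := by ring

/-- On `gapSet` the imaginary part of `(herglotzProd / i) ^ (1 / 2)` tends to zero in the mean, as the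
argument does. -/
theorem tendsto_setLIntegral_im_exp_half (ha : ∀ j, 0 ≤ a j)
    (hdisj : Pairwise fun j k => Disjoint (Ioo (a j) (b j)) (Ioo (a k) (b k)))
    (hlen : Summable fun j => b j - a j) (hc : ∀ j, c j ∈ Icc (a j) (b j))
    {ε : ℕ → ℝ} (hε : ∀ n, 0 < ε n) (hε0 : Tendsto ε atTop (𝓝 0)) :
    Tendsto (fun n => ∫⁻ x in gapSet a b, ENNReal.ofReal
      (|(Complex.exp (((1 / 2 : ℝ) : ℂ) * prodLog a b c (x + ε n * Complex.I))).im| *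
        (1 + x ^ 2)⁻¹)) atTop (𝓝 0) := by
  obtain ⟨C, hC0, hC⟩ := exists_integral_rpow_le ha hdisj hlen hc
  refine ENNReal.tendsto_nhds_zero.2 fun η hη => ?_
  obtain ⟨r, hr0, hrη⟩ := ENNReal.lt_iff_exists_nnreal_btwn.1 hη
  have hr : (0 : ℝ) < r := by exact_mod_cast hr0
  set δ : ℝ := r / (2 * (C + 1)) with hδ
  have hδ0 : 0 < δ := by positivity
  have hδC : δ * C ≤ r / 2 := by
    rw [hδ, div_mul_eq_mul_div, div_le_iff₀ (by positivity)]
    nlinarith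
  have hlim := ENNReal.Tendsto.const_mul (a := ENNReal.ofReal (δ ^ 2)⁻¹)
    (tendsto_lintegral_im_prodLog ha hdisj hlen hc hε hε0) (Or.inr ENNReal.ofReal_ne_top)
  rw [mul_zero] at hlim
  filter_upwards [ENNReal.tendsto_nhds_zero.1 hlim (ENNReal.ofReal (r / 2))
    (ENNReal.ofReal_pos.2 (by positivity))] with n hn
  calc _ ≤ ∫⁻ x in gapSet a b, (ENNReal.ofReal δ * ENNReal.ofReal
          (‖Complex.exp (prodLog a b c (x + ε n * Complex.I))‖ ^ (3 / 4 : ℝ) * (1 + x ^ 2)⁻¹) +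
          ENNReal.ofReal (δ ^ 2)⁻¹ * ENNReal.ofReal
            (|(prodLog a b c (x + ε n * Complex.I)).im| * (1 + x ^ 2)⁻¹)) := by
        refine lintegral_mono fun x => ?_
        rw [← ENNReal.ofReal_mul hδ0.le, ← ENNReal.ofReal_mul (by positivity),
          ← ENNReal.ofReal_add (by positivity) (by positivity), ← mul_assoc, ← mul_assoc,
          ← add_mul]
        exact ENNReal.ofReal_le_ofReal
          (mul_le_mul_of_nonneg_right (abs_im_exp_half_le_add _ hδ0) (by positivity))
    _ = ENNReal.ofReal δ * (∫⁻ x in gapSet a b, ENNReal.ofReal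
          (‖Complex.exp (prodLog a b c (x + ε n * Complex.I))‖ ^ (3 / 4 : ℝ) * (1 + x ^ 2)⁻¹)) +
          ENNReal.ofReal (δ ^ 2)⁻¹ * ∫⁻ x in gapSet a b, ENNReal.ofReal
            (|(prodLog a b c (x + ε n * Complex.I)).im| * (1 + x ^ 2)⁻¹) := by
        have hcont := continuous_prodLog_horizontal hlen hc (hε n)
        have hw : Continuous fun x : ℝ => (1 + x ^ 2)⁻¹ :=
          (by fun_prop : Continuous fun x : ℝ => 1 + x ^ 2).inv₀ fun x => by positivity
        rw [lintegral_add_right, lintegral_const_mul' _ _ ENNReal.ofReal_ne_top,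
          lintegral_const_mul' _ _ ENNReal.ofReal_ne_top]
        exact (((Complex.continuous_im.comp hcont).abs.mul hw).measurable.ennreal_ofReal).const_mul _
    _ ≤ ENNReal.ofReal δ * ENNReal.ofReal C + ENNReal.ofReal (r / 2) := by
        gcongr
        exact (setLIntegral_le_lintegral _ _).trans (hC _ (hε n))
    _ = ENNReal.ofReal (δ * C + r / 2) := by
        rw [← ENNReal.ofReal_mul hδ0.le, ← ENNReal.ofReal_add (by positivity) (by positivity)]
    _ ≤ ENNReal.ofReal r := ENNReal.ofReal_le_ofReal (by linarith)
    _ ≤ η := by rw [ENNReal.ofReal_coe_nnreal]; exact hrη.le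

theorem continuous_im_exp_half (hlen : Summable fun j => b j - a j)
    (hc : ∀ j, c j ∈ Icc (a j) (b j)) {ε : ℝ} (hε : 0 < ε) :
    Continuous fun x : ℝ =>
      (Complex.exp (((1 / 2 : ℝ) : ℂ) * prodLog a b c (x + ε * Complex.I))).im := by
  have := continuous_prodLog_horizontal (a := a) (b := b) (c := c) hlen hc hε
  fun_prop

/-- On the gaps, where the boundary values of `(herglotzProd / i) ^ (1 / 2)` exist almost
everywhere, Kolmogorov's estimate gives uniform integrability, and Vitali's theorem applies. -/
theorem tendsto_eLpNorm_compl_gapSet (ha : ∀ j, 0 ≤ a j) (hab : ∀ j, a j < b j)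
    (hdisj : Pairwise fun j k => Disjoint (Ioo (a j) (b j)) (Ioo (a k) (b k)))
    (hlen : Summable fun j => b j - a j) (hc : ∀ j, c j ∈ Icc (a j) (b j))
    (hm : IntegrableOn (fun x : ℝ => ‖herglotzProd a b c x‖ * (1 + x ^ 2)⁻¹) (gapSet a b)ᶜ)
    {ε : ℕ → ℝ} (hε : ∀ n, 0 < ε n) (hε0 : Tendsto ε atTop (𝓝 0)) :
    Tendsto (fun n => eLpNorm ((fun x : ℝ =>
      (Complex.exp (((1 / 2 : ℝ) : ℂ) * prodLog a b c (x + ε n * Complex.I))).im) -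
        sqrtBoundary a b c) 1 (poissonWeight.restrict (gapSet a b)ᶜ)) atTop (𝓝 0) := by
  have hEm : MeasurableSet (gapSet a b)ᶜ := measurableSet_gapSet.compl
  have hmeas : ∀ n, AEStronglyMeasurable (fun x : ℝ =>
      (Complex.exp (((1 / 2 : ℝ) : ℂ) * prodLog a b c (x + ε n * Complex.I))).im)
      (poissonWeight.restrict (gapSet a b)ᶜ) := fun n =>
    (continuous_im_exp_half hlen hc (hε n)).aestronglyMeasurable
  refine tendsto_Lp_finite_of_tendsto_ae le_rfl ENNReal.one_ne_top hmeas ?_ ?_ ?_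
  · refine ⟨((aestronglyMeasurable_sqrtBoundary ha hab hdisj hlen hc).mono_ac
      (withDensity_absolutelyContinuous _ _)).restrict, ?_⟩
    rw [eLpNorm_one_eq_lintegral_enorm]
    refine (setLIntegral_le_lintegral _ _).trans_lt ?_
    rw [lintegral_poissonWeight]
    refine lt_of_le_of_lt (le_of_eq (lintegral_congr fun x => ?_))
      (integrable_sqrtBoundary ha hab hdisj hlen hc hm).2
    rw [enorm_mul, mul_comm, Real.enorm_of_nonneg (by positivity : (0 : ℝ) ≤ (1 + x ^ 2)⁻¹)]
  · -- the exponent `3 / 4` exceeds `1 / 2`, which bounds the part where the function is large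
    obtain ⟨C, hC0, hC⟩ := exists_integral_rpow_le ha hdisj hlen hc
    refine unifIntegrable_of le_rfl ENNReal.one_ne_top hmeas fun η hη => ?_
    set δ : ℝ := η / (C + 1) with hδ
    have hδ0 : 0 < δ := by positivity
    have hδC : δ * C ≤ η := by
      rw [hδ, div_mul_eq_mul_div, div_le_iff₀ (by positivity)]
      nlinarith
    refine ⟨⟨(δ ^ 2)⁻¹, by positivity⟩, fun n => ?_⟩
    rw [eLpNorm_one_eq_lintegral_enorm]
    calc _ ≤ ∫⁻ x, ENNReal.ofReal (δ * ‖Complex.exp (prodLog a b c (x + ε n * Complex.I))‖ ^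
          (3 / 4 : ℝ)) ∂poissonWeight := by
          refine (setLIntegral_le_lintegral _ _).trans (lintegral_mono fun x => ?_)
          rw [← ofReal_norm]
          refine ENNReal.ofReal_le_ofReal ?_
          rw [norm_indicator_eq_indicator_norm]
          refine indicator_apply_le' (fun hx => ?_) fun _ => by positivity
          exact abs_im_exp_half_le_of_le _ hδ0 (NNReal.coe_le_coe.2 hx)
      _ = ENNReal.ofReal δ * ∫⁻ x : ℝ, ENNReal.ofReal
          (‖Complex.exp (prodLog a b c (x + ε n * Complex.I))‖ ^ (3 / 4 : ℝ) *
            (1 + x ^ 2)⁻¹) := by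
          rw [lintegral_poissonWeight, ← lintegral_const_mul' _ _ ENNReal.ofReal_ne_top]
          refine lintegral_congr fun x => ?_
          rw [← ENNReal.ofReal_mul (by positivity), ← ENNReal.ofReal_mul hδ0.le]
          congr 1
          ring
      _ ≤ ENNReal.ofReal δ * ENNReal.ofReal C := by gcongr; exact hC _ (hε n)
      _ ≤ ENNReal.ofReal η := by
          rw [← ENNReal.ofReal_mul hδ0.le]
          exact ENNReal.ofReal_le_ofReal hδC
  · have hlim : Tendsto ε atTop (𝓝[>] 0) :=
      tendsto_nhdsWithin_iff.2 ⟨hε0, Eventually.of_forall hε⟩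
    refine (poissonWeight_restrict_ac _).ae_le ((ae_restrict_iff' hEm).2 ?_)
    filter_upwards [ae_tendsto_prodLog ha hab hdisj hlen hc] with x hx hxE
    rw [sqrtBoundary, indicator_of_mem hxE]
    exact (Complex.continuous_im.tendsto _).comp ((Complex.continuous_exp.tendsto _).comp
      (((hx hxE).1.comp hlim).const_mul _))

theorem tendsto_lintegral_im_exp_half_sub (ha : ∀ j, 0 ≤ a j) (hab : ∀ j, a j < b j)
    (hdisj : Pairwise fun j k => Disjoint (Ioo (a j) (b j)) (Ioo (a k) (b k)))
    (hlen : Summable fun j => b j - a j) (hc : ∀ j, c j ∈ Icc (a j) (b j))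
    (hm : IntegrableOn (fun x : ℝ => ‖herglotzProd a b c x‖ * (1 + x ^ 2)⁻¹) (gapSet a b)ᶜ)
    {ε : ℕ → ℝ} (hε : ∀ n, 0 < ε n) (hε0 : Tendsto ε atTop (𝓝 0)) :
    Tendsto (fun n => ∫⁻ x, ‖(Complex.exp (((1 / 2 : ℝ) : ℂ) *
      prodLog a b c (x + ε n * Complex.I))).im - sqrtBoundary a b c x‖ₑ ∂poissonWeight)
        atTop (𝓝 0) := by
  have h1 := tendsto_setLIntegral_im_exp_half ha hdisj hlen hc hε hε0
  have h2 := tendsto_eLpNorm_compl_gapSet ha hab hdisj hlen hc hm hε hε0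
  have h3 := h1.add h2
  rw [add_zero] at h3
  refine h3.congr fun n => ?_
  rw [← lintegral_add_compl (μ := poissonWeight) _ (measurableSet_gapSet (a := a) (b := b)),
    eLpNorm_one_eq_lintegral_enorm]
  congr 1
  rw [setLIntegral_poissonWeight measurableSet_gapSet]
  refine setLIntegral_congr_fun measurableSet_gapSet fun x hx => ?_
  simp only [sqrtBoundary]
  rw [indicator_of_notMem (by simpa using hx), sub_zero, ← ofReal_norm, Real.norm_eq_abs,
    ← ENNReal.ofReal_mul (by positivity), mul_comm]

/-- The Nevanlinna representation of `(herglotzProd / i) ^ (1 / 2)` by its boundary values. -/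
theorem exp_half_prodLog_eq_integral (ha : ∀ j, 0 ≤ a j) (hab : ∀ j, a j < b j)
    (hdisj : Pairwise fun j k => Disjoint (Ioo (a j) (b j)) (Ioo (a k) (b k)))
    (hlen : Summable fun j => b j - a j) (hc : ∀ j, c j ∈ Icc (a j) (b j))
    (hm : IntegrableOn (fun x : ℝ => ‖herglotzProd a b c x‖ * (1 + x ^ 2)⁻¹) (gapSet a b)ᶜ)
    {z : ℂ} (hz : 0 < z.im) :
    Real.pi * Complex.exp (((1 / 2 : ℝ) : ℂ) * prodLog a b c z) =
      Real.pi * (Complex.exp (((1 / 2 : ℝ) : ℂ) * prodLog a b c Complex.I)).re +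
        ∫ x : ℝ, (sqrtBoundary a b c x : ℂ) * nevanlinnaKernel z x := by
  set ε : ℕ → ℝ := fun n => 1 / ((n : ℝ) + 1) with hεdef
  have hε : ∀ n, 0 < ε n := fun n => Nat.one_div_pos_of_nat
  have hε0 : Tendsto ε atTop (𝓝 0) := tendsto_one_div_add_atTop_nhds_zero_nat
  set p : ℂ → ℂ := fun z => Complex.exp (((1 / 2 : ℝ) : ℂ) * prodLog a b c z) with hp
  have hpc : ∀ w : ℂ, 0 < w.im →
      Tendsto (fun n => p (w + ε n * Complex.I)) atTop (𝓝 (p w)) := fun w hw => by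
    have h1 : ContinuousAt p w :=
      (((differentiableAt_prodLog hlen hc hw).const_mul _).cexp).continuousAt
    refine h1.tendsto.comp ?_
    have h2 : Tendsto (fun n => w + ((ε n : ℝ) : ℂ) * Complex.I) atTop
        (𝓝 (w + ((0 : ℝ) : ℂ) * Complex.I)) :=
      ((((Complex.continuous_ofReal.tendsto 0).comp hε0).mul_const _).const_add w)
    simpa using h2
  set M := (1 + ‖z‖) * ((1 + ‖z‖) / z.im + 1) with hM
  have hM0 : 0 ≤ M := by positivity
  have hK : ∀ x, ‖nevanlinnaKernel z x‖ ≤ M * (1 + x ^ 2)⁻¹ := norm_nevanlinnaKernel_le hz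
  have hKc := continuous_nevanlinnaKernel hz
  have hrep : ∀ n, Real.pi * p (z + ε n * Complex.I) = Real.pi * (p (Complex.I + ε n * Complex.I)).re
      + ∫ x : ℝ, ((p (x + ε n * Complex.I)).im : ℂ) * nevanlinnaKernel z x := fun n => by
    obtain ⟨C, hC⟩ := decay_exp_prodLog (a := a) (b := b) (c := c) hlen hc
      (r := 1 / 2) (by norm_num) (hε n)
    exact schwarz_formula_sub (F := fun z => p (z + ε n * Complex.I)) (C := C) (s := 1 / 2 / 2)
      (by norm_num) (fun w hw => differentiableAt_exp_prodLog_shift hlen hc _ (hε n) hw) hC hz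
  have hint : ∀ n, Integrable fun x : ℝ =>
      ((p (x + ε n * Complex.I)).im : ℂ) * nevanlinnaKernel z x := fun n => by
    obtain ⟨C, hC⟩ := decay_exp_prodLog (a := a) (b := b) (c := c) hlen hc
      (r := 1 / 2) (by norm_num) (hε n)
    have hC0 : 0 ≤ C := by
      have := (norm_nonneg _).trans (hC 0 (by simp))
      simpa using this
    refine (integrable_inv_one_add_sq.const_mul (C * M)).mono'
      ((Complex.continuous_ofReal.comp (continuous_im_exp_half hlen hc (hε n))).mul
        hKc).aestronglyMeasurable (Eventually.of_forall fun x => ?_)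
    rw [norm_mul, Complex.norm_real, mul_assoc]
    refine mul_le_mul ?_ (hK x) (norm_nonneg _) hC0
    refine (Complex.abs_im_le_norm _).trans ((hC x (by simp)).trans ?_)
    refine mul_le_of_le_one_right hC0 (Real.rpow_le_one_of_one_le_of_nonpos ?_ (by norm_num))
    linarith [norm_nonneg (x : ℂ)]
  have hintg : Integrable fun x : ℝ => (sqrtBoundary a b c x : ℂ) * nevanlinnaKernel z x := by
    refine ((integrable_sqrtBoundary ha hab hdisj hlen hc hm).norm.const_mul M).mono'
      ((Complex.continuous_ofReal.comp_aestronglyMeasurable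
        (aestronglyMeasurable_sqrtBoundary ha hab hdisj hlen hc)).mul hKc.aestronglyMeasurable)
      (Eventually.of_forall fun x => ?_)
    rw [norm_mul, Complex.norm_real, norm_mul, Real.norm_of_nonneg
      (by positivity : (0 : ℝ) ≤ (1 + x ^ 2)⁻¹), mul_left_comm]
    gcongr
    exact hK x
  have hL1 := tendsto_integral_of_L1 _ hintg.aestronglyMeasurable (Eventually.of_forall hint) (l := atTop) (by
    have h1 := ENNReal.Tendsto.const_mul (a := ENNReal.ofReal M)
      (tendsto_lintegral_im_exp_half_sub ha hab hdisj hlen hc hm hε hε0)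
      (Or.inr ENNReal.ofReal_ne_top)
    rw [mul_zero] at h1
    refine tendsto_of_tendsto_of_tendsto_of_le_of_le tendsto_const_nhds h1
      (fun _ => zero_le) fun n => ?_
    beta_reduce
    rw [lintegral_poissonWeight, ← lintegral_const_mul' _ _ ENNReal.ofReal_ne_top]
    refine lintegral_mono fun x => ?_
    rw [← sub_mul, ← Complex.ofReal_sub, enorm_mul, ← mul_assoc, mul_comm,
      ← ENNReal.ofReal_mul hM0, ← ofReal_norm (nevanlinnaKernel z x)]
    gcongr
    · exact hK x
    · rw [← ofReal_norm, ← ofReal_norm, Complex.norm_real])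
  have hlim1 := (hpc z hz).const_mul (Real.pi : ℂ)
  have hlim2 := (((Complex.continuous_ofReal.comp Complex.continuous_re).tendsto _).comp
    (hpc Complex.I (by simp))).const_mul (Real.pi : ℂ)
  refine tendsto_nhds_unique hlim1 ((hlim2.add hL1).congr fun n => ?_)
  exact (hrep n).symm

end SquareRoot

/-! ### Representing measures -/

section Herglotz

variable {m : ℂ → ℂ} {E : Set ℝ} {ρ : Measure ℝ}

namespace IsHerglotzMeasure

theorem isLocallyFiniteMeasure (h : IsHerglotzMeasure m E ρ) : IsLocallyFiniteMeasure ρ := by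
  refine ⟨fun x => ⟨Metric.ball x 1, Metric.ball_mem_nhds x one_pos, ?_⟩⟩
  refine (measure_mono fun t ht => ?_).trans_lt
    (h.integrable.measure_norm_ge_lt_top (ε := 1 / (2 + |x|)) (by positivity))
  rw [Metric.mem_ball, Real.dist_eq] at ht
  have h1 : |t| - |x| ≤ |t - x| := abs_sub_abs_le_abs_sub t x
  rw [mem_ofPred_eq, Real.norm_of_nonneg (by positivity)]
  exact one_div_le_one_div_of_le (by positivity) (by linarith)

theorem integrable_inv_sub (h : IsHerglotzMeasure m E ρ) {z : ℂ} (hz : 0 < z.im) :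
    Integrable (fun t : ℝ => ((t : ℂ) - z)⁻¹) ρ := by
  refine (h.integrable.const_mul ((1 + ‖z‖) / z.im + 1)).mono'
    (continuous_inv_ofReal_sub hz).aestronglyMeasurable (Eventually.of_forall fun t => ?_)
  have h1 := one_add_abs_le_norm_sub hz t
  have h2 := norm_pos_iff.2 (ofReal_sub_ne_zero hz t)
  rw [norm_inv, mul_one_div, le_div_iff₀ (by positivity), inv_mul_le_iff₀ h2, mul_comm]
  exact h1

theorem integrable_poissonLine_sub (h : IsHerglotzMeasure m E ρ) (x : ℝ) {y : ℝ} (hy : 0 < y) :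
    Integrable (fun t => poissonLine y (t - x)) ρ := by
  have h1 := (h.integrable_inv_sub (z := x + y * Complex.I) (by simpa using hy)).im
  refine h1.congr (Eventually.of_forall fun t => ?_)
  simp only [RCLike.im_eq_complex_im, im_inv_ofReal_sub]
  simp

theorem im_eq (h : IsHerglotzMeasure m E ρ) (x : ℝ) {y : ℝ} (hy : 0 < y) :
    (m (x + y * Complex.I)).im = ∫ t, poissonLine y (t - x) ∂ρ := by
  have hz : 0 < ((x : ℂ) + y * Complex.I).im := by simpa using hy
  simp_rw [h.eq_integral _ hz, one_div]
  rw [im_integral_eq (h.integrable_inv_sub hz)]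
  refine integral_congr_ae (Eventually.of_forall fun t => ?_)
  simp only [im_inv_ofReal_sub]
  simp

end IsHerglotzMeasure

/-- The criterion of absolute continuity applies with `p = (herglotzProd / i) ^ (1 / 2)`, since
`Im herglotzProd ≤ |p|²`. -/
theorem IsHerglotzMeasure.absolutelyContinuous {a b c : ℕ → ℝ}
    (ha : ∀ j, 0 ≤ a j) (hab : ∀ j, a j < b j)
    (hdisj : Pairwise fun j k => Disjoint (Ioo (a j) (b j)) (Ioo (a k) (b k)))
    (hlen : Summable fun j => b j - a j) (hc : ∀ j, c j ∈ Icc (a j) (b j))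
    (hm : IntegrableOn (fun x : ℝ => ‖herglotzProd a b c x‖ * (1 + x ^ 2)⁻¹) (gapSet a b)ᶜ)
    (h : IsHerglotzMeasure (herglotzProd a b c) E ρ) : ρ ≪ volume := by
  have := h.isLocallyFiniteMeasure
  refine absolutelyContinuous_of_nevanlinna
    (p := fun z => Complex.exp (((1 / 2 : ℝ) : ℂ) * prodLog a b c z))
    (fun x y hy => h.integrable_poissonLine_sub x hy) (fun x y hy => ?_)
    (integrable_sqrtBoundary ha hab hdisj hlen hc hm)
    (integrable_sqrtBoundary_sq ha hab hdisj hlen hc hm)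
    fun z hz => exp_half_prodLog_eq_integral ha hab hdisj hlen hc hm hz
  rw [← h.im_eq x hy]
  refine (Complex.im_le_norm _).trans (le_of_eq ?_)
  rw [herglotzProd_eq hlen hc (by simpa using hy), norm_mul, Complex.norm_I, one_mul,
    norm_exp_real_mul, ← Real.rpow_natCast, ← Real.rpow_mul (norm_nonneg _)]
  norm_num

end Herglotz

/-! ### Existence of the representing measure -/

section Existence

open ENNReal

theorem ofReal_inv_one_add_abs_le_tsum {x : ℝ} {k : ℕ} (hx : 2 ^ k ≤ |x|) :
    ENNReal.ofReal (1 / (1 + |x|)) ≤ ∑' j : ℕ, 5 * ENNReal.ofReal (poissonLine (2 ^ (k + j)) x) := by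
  have h1 : 1 ≤ |x| := (one_le_pow₀ one_le_two).trans hx
  -- the term with `Y ≤ |x| < 2 Y` suffices
  obtain ⟨n, hn, hn'⟩ := exists_nat_pow_near h1 one_lt_two
  have hkn : k < n + 1 := (pow_lt_pow_iff_right₀ (one_lt_two (α := ℝ))).1 (hx.trans_lt hn')
  refine le_trans ?_ (ENNReal.le_tsum (n - k))
  rw [Nat.add_sub_cancel' (Nat.lt_succ_iff.1 hkn), ← ENNReal.ofReal_ofNat 5,
    ← ENNReal.ofReal_mul (by norm_num)]
  refine ENNReal.ofReal_le_ofReal ?_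
  have hY : (0 : ℝ) < 2 ^ n := by positivity
  rw [pow_succ] at hn'
  rw [poissonLine, mul_div_assoc', div_le_div_iff₀ (by positivity) (by positivity), ← sq_abs x]
  nlinarith

/-- If the Poisson integrals of `f` at `i Y` decay geometrically along `Y = 2 ^ k`, then `f` has
small tails for the weight `1 / (1 + |x|)`. -/
theorem setLIntegral_inv_one_add_abs_le {f : ℝ → ℝ≥0∞} (hf : Measurable f) {A q : ℝ≥0∞}
    (h : ∀ k : ℕ, ∫⁻ x, f x * ENNReal.ofReal (poissonLine (2 ^ k) x) ≤ A * q ^ k) (k : ℕ) :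
    ∫⁻ x in {x : ℝ | 2 ^ k ≤ |x|}, f x * ENNReal.ofReal (1 / (1 + |x|)) ≤
      5 * A * (1 - q)⁻¹ * q ^ k := by
  have hm : MeasurableSet {x : ℝ | 2 ^ k ≤ |x|} := measurableSet_le measurable_const (by fun_prop)
  have hmP : ∀ Y : ℝ, Measurable fun x => ENNReal.ofReal (poissonLine Y x) := fun Y =>
    (measurable_poissonLine.comp (measurable_const.prodMk measurable_id)).ennreal_ofReal
  calc _ ≤ ∫⁻ x in {x : ℝ | 2 ^ k ≤ |x|},
          ∑' j : ℕ, 5 * (f x * ENNReal.ofReal (poissonLine (2 ^ (k + j)) x)) := by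
        refine setLIntegral_mono' hm fun x hx => ?_
        refine (mul_le_mul_right (ofReal_inv_one_add_abs_le_tsum hx) (f x)).trans (le_of_eq ?_)
        rw [← ENNReal.tsum_mul_left]
        refine tsum_congr fun j => ?_
        ring
    _ = ∑' j : ℕ, ∫⁻ x in {x : ℝ | 2 ^ k ≤ |x|},
          5 * (f x * ENNReal.ofReal (poissonLine (2 ^ (k + j)) x)) :=
        lintegral_tsum fun j => ((hf.mul (hmP _)).const_mul _).aemeasurable
    _ ≤ ∑' j : ℕ, 5 * A * q ^ k * q ^ j := by
        refine ENNReal.tsum_le_tsum fun j => (setLIntegral_le_lintegral _ _).trans ?_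
        rw [lintegral_const_mul' _ _ ENNReal.ofNat_ne_top, mul_assoc, mul_assoc, ← pow_add]
        gcongr
        exact h _
    _ = _ := by rw [ENNReal.tsum_mul_left, ENNReal.tsum_geometric]; ring

theorem lintegral_inv_one_add_abs_le {f : ℝ → ℝ≥0∞} (hf : Measurable f) {A q : ℝ≥0∞}
    (h : ∀ k : ℕ, ∫⁻ x, f x * ENNReal.ofReal (poissonLine (2 ^ k) x) ≤ A * q ^ k) :
    ∫⁻ x, f x * ENNReal.ofReal (1 / (1 + |x|)) ≤ 5 * A * (1 - q)⁻¹ + 2 * A := by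
  have hm : MeasurableSet {x : ℝ | 2 ^ 0 ≤ |x|} := measurableSet_le measurable_const (by fun_prop)
  have hmP : Measurable fun x => ENNReal.ofReal (poissonLine (2 ^ 0) x) :=
    (measurable_poissonLine.comp (measurable_const.prodMk measurable_id)).ennreal_ofReal
  rw [← lintegral_add_compl _ hm]
  refine add_le_add ((setLIntegral_inv_one_add_abs_le hf h 0).trans (by simp)) ?_
  calc _ ≤ ∫⁻ x in {x : ℝ | 2 ^ 0 ≤ |x|}ᶜ,
          2 * (f x * ENNReal.ofReal (poissonLine (2 ^ 0) x)) := by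
        refine setLIntegral_mono' hm.compl fun x hx => ?_
        rw [mem_compl_iff, mem_ofPred_eq, pow_zero, not_le] at hx
        rw [mul_left_comm, ← ENNReal.ofReal_ofNat 2, ← ENNReal.ofReal_mul (by norm_num)]
        gcongr
        rw [pow_zero, poissonLine_one, ← div_eq_mul_inv,
          div_le_div_iff₀ (by positivity) (by positivity), ← sq_abs x]
        nlinarith [abs_nonneg x]
    _ ≤ _ := by
        refine (setLIntegral_le_lintegral _ _).trans ?_
        rw [lintegral_const_mul' _ _ ENNReal.ofNat_ne_top]
        gcongr
        simpa using h 0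

theorem continuous_one_add_abs_mul_inv_sub {z : ℂ} (hz : 0 < z.im) :
    Continuous fun x : ℝ => ((1 + |x| : ℝ) : ℂ) * ((x : ℂ) - z)⁻¹ :=
  (by fun_prop : Continuous fun x : ℝ => ((1 + |x| : ℝ) : ℂ)).mul (continuous_inv_ofReal_sub hz)

theorem norm_one_add_abs_mul_inv_sub_le {z : ℂ} (hz : 0 < z.im) (x : ℝ) :
    ‖((1 + |x| : ℝ) : ℂ) * ((x : ℂ) - z)⁻¹‖ ≤ (1 + ‖z‖) / z.im + 1 := by
  have h2 := norm_pos_iff.2 (ofReal_sub_ne_zero hz x)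
  rw [norm_mul, norm_inv, Complex.norm_real, Real.norm_of_nonneg (by positivity),
    ← div_eq_mul_inv, div_le_iff₀ h2]
  exact one_add_abs_le_norm_sub hz x

/-- A form of Herglotz's theorem: a holomorphic function with nonnegative imaginary part that
decays like `|z| ^ (-1 / 2)` is the Stieltjes transform of a measure. The measure is a weak limit
of the boundary measures of shifts, weighted by `1 / (1 + |x|)`. -/
theorem exists_measure_of_im_nonneg {F : ℂ → ℂ} {C : ℝ}
    (hd : ∀ z : ℂ, 0 < z.im → DifferentiableAt ℂ F z) (him : ∀ z : ℂ, 0 < z.im → 0 ≤ (F z).im)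
    (hdecay : ∀ ε : ℝ, 0 < ε → ∃ C : ℝ, ∀ z : ℂ, 0 ≤ z.im →
      ‖F (z + ε * Complex.I)‖ ≤ C * (1 + ‖z‖) ^ (-(1 / 2) : ℝ))
    (hY : ∀ Y : ℝ, 1 ≤ Y → ‖F (Y * Complex.I)‖ ≤ C * Y ^ (-(1 / 2) : ℝ)) :
    ∃ ρ : Measure ℝ, Integrable (fun t : ℝ => 1 / (1 + |t|)) ρ ∧
      ∀ z : ℂ, 0 < z.im → F z = ∫ t : ℝ, 1 / ((t : ℂ) - z) ∂ρ := by
  have hC0 : 0 ≤ C := by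
    have := (norm_nonneg _).trans (hY 1 le_rfl)
    simpa using this
  have hpi := Real.pi_pos
  set ε : ℕ → ℝ := fun n => 1 / ((n : ℝ) + 1) with hεdef
  have hε : ∀ n, 0 < ε n := fun n => Nat.one_div_pos_of_nat
  have hε0 : Tendsto ε atTop (𝓝 0) := tendsto_one_div_add_atTop_nhds_zero_nat
  have hshift : ∀ n, ∀ z : ℂ, 0 ≤ z.im → 0 < (z + ε n * Complex.I).im := fun n z hz => by
    simpa using add_pos_of_nonneg_of_pos hz (hε n)
  have hdn : ∀ n, ∀ z : ℂ, 0 ≤ z.im → DifferentiableAt ℂ (fun z => F (z + ε n * Complex.I)) z :=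
    fun n z hz => DifferentiableAt.comp z (hd _ (hshift n z hz)) (differentiableAt_id.add_const _)
  set g : ℕ → ℝ → ℝ := fun n x => (F (x + ε n * Complex.I)).im with hg
  have hg0 : ∀ n x, 0 ≤ g n x := fun n x => him _ (hshift n x (by simp))
  have hgc : ∀ n, Continuous (g n) := fun n =>
    Complex.continuous_im.comp (continuous_comp_horizontal
      (fun z hz => (hd z hz).continuousAt) (hε n))
  set f : ℕ → ℝ → ℝ≥0∞ := fun n x => ENNReal.ofReal (g n x / Real.pi) with hf
  have hfm : ∀ n, Measurable (f n) := fun n => ((hgc n).measurable.div_const _).ennreal_ofReal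
  have hq0 : (0 : ℝ) ≤ 2 ^ (-(1 / 2) : ℝ) := by positivity
  set q : NNReal := ⟨2 ^ (-(1 / 2) : ℝ), hq0⟩ with hq
  have hq1 : q < 1 := by
    rw [← NNReal.coe_lt_coe]
    exact Real.rpow_lt_one_of_one_lt_of_neg one_lt_two (by norm_num)
  -- Poisson's formula at `i Y`, for `Y = 2 ^ k`
  have hP : ∀ n k, ∫⁻ x, f n x * ENNReal.ofReal (poissonLine (2 ^ k) x) ≤
      ENNReal.ofReal C * (q : ℝ≥0∞) ^ k := fun n k => by
    obtain ⟨C', hC'⟩ := hdecay _ (hε n)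
    have him0 : (((2 ^ k : ℝ) : ℂ) * Complex.I).im = 2 ^ k := by
      rw [Complex.im_ofReal_mul, Complex.I_im, mul_one]
    have hre0 : (((2 ^ k : ℝ) : ℂ) * Complex.I).re = 0 := by
      rw [Complex.re_ofReal_mul, Complex.I_re, mul_zero]
    obtain ⟨hi, hval⟩ := poisson_formula_im (s := 1 / 2) (by norm_num) (hdn n) hC'
      (z := ((2 ^ k : ℝ) : ℂ) * Complex.I) (by rw [him0]; positivity)
    rw [him0, hre0] at hi hval
    simp_rw [sub_zero] at hi hval
    have h1 : ∫⁻ x, f n x * ENNReal.ofReal (poissonLine (2 ^ k) x) =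
        ENNReal.ofReal (F (((2 ^ k : ℝ) : ℂ) * Complex.I + ε n * Complex.I)).im := by
      have h2 : ∀ x, f n x * ENNReal.ofReal (poissonLine (2 ^ k) x) =
          ENNReal.ofReal (Real.pi⁻¹ * (g n x * poissonLine (2 ^ k) x)) := fun x => by
        rw [hf, ← ENNReal.ofReal_mul (div_nonneg (hg0 n x) hpi.le)]
        congr 1
        ring
      simp_rw [h2]
      rw [← ofReal_integral_eq_lintegral_ofReal (hi.const_mul _) (Eventually.of_forall fun x =>
        mul_nonneg (by positivity) (mul_nonneg (hg0 n x) (poissonLine_nonneg (by positivity) _))),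
        integral_const_mul, ← hval, inv_mul_cancel_left₀ hpi.ne']
    rw [h1, ← add_mul, ← Complex.ofReal_add]
    have h1k : (1 : ℝ) ≤ 2 ^ k := one_le_pow₀ one_le_two
    have h3 := (Complex.im_le_norm _).trans (hY (2 ^ k + ε n) (by linarith [hε n]))
    have h4 : (2 ^ k + ε n) ^ (-(1 / 2) : ℝ) ≤ ((2 : ℝ) ^ (-(1 / 2) : ℝ)) ^ k := by
      rw [Real.rpow_pow_comm zero_le_two]
      exact Real.rpow_le_rpow_of_nonpos (by positivity) (by linarith [hε n]) (by norm_num)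
    refine (ENNReal.ofReal_le_ofReal (h3.trans (mul_le_mul_of_nonneg_left h4 hC0))).trans
      (le_of_eq ?_)
    rw [ENNReal.ofReal_mul hC0, ENNReal.ofReal_pow hq0]
    congr 2
    rw [← ENNReal.ofReal_coe_nnreal]
    rfl
  have hqt : (1 - (q : ℝ≥0∞))⁻¹ ≠ ∞ := by
    rw [ENNReal.inv_ne_top]
    exact (tsub_pos_of_lt (by exact_mod_cast hq1)).ne'
  set B : ℝ≥0∞ := 5 * ENNReal.ofReal C * (1 - (q : ℝ≥0∞))⁻¹ with hB
  have hBt : B ≠ ∞ := by finiteness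
  set M : ℝ≥0∞ := B + 2 * ENNReal.ofReal C with hM
  have hMt : M ≠ ∞ := by finiteness
  have hmass : ∀ n, ∫⁻ x, f n x * ENNReal.ofReal (1 / (1 + |x|)) ≤ M := fun n =>
    lintegral_inv_one_add_abs_le (hfm n) (hP n)
  -- Prokhorov's theorem is applied to the measures `Im F(x + i ε) dx / (π (1 + |x|))`, whose limit
  -- is taken along an ultrafilter
  set ν : ℕ → FiniteMeasure ℝ := fun n =>
    ⟨volume.withDensity fun x => f n x * ENNReal.ofReal (1 / (1 + |x|)),
      isFiniteMeasure_withDensity (ne_top_of_le_ne_top hMt (hmass n))⟩ with hν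
  have hνs : ∀ n {s : Set ℝ}, MeasurableSet s → (ν n : Measure ℝ) s =
      ∫⁻ x in s, f n x * ENNReal.ofReal (1 / (1 + |x|)) := fun n s hs => withDensity_apply _ hs
  have hcompact := isCompact_setOfPred_finiteMeasure_mass_le_compl_isCompact_le
    (E := ℝ) (u := fun n => B.toNNReal * q ^ n) (K := fun n => Metric.closedBall 0 (2 ^ n))
    M.toNNReal (by simpa using
      (NNReal.tendsto_pow_atTop_nhds_zero_of_lt_one hq1).const_mul B.toNNReal)
    (fun n => isCompact_closedBall _ _) (Or.inl inferInstance)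
  obtain ⟨ν₀, -, hlim⟩ := hcompact.ultrafilter_le_nhds' ((hyperfilter ℕ).map ν) (by
    refine Filter.eventually_map.2 <| Eventually.of_forall fun n => ⟨?_, fun k => ?_⟩
    · rw [← ENNReal.coe_le_coe, ENNReal.coe_toNNReal hMt, FiniteMeasure.ennreal_mass,
        hνs n MeasurableSet.univ, Measure.restrict_univ]
      exact hmass n
    · rw [← ENNReal.coe_le_coe, FiniteMeasure.ennreal_coeFn_eq_coeFn_toMeasure,
        hνs n Metric.isClosed_closedBall.measurableSet.compl, ENNReal.coe_mul, ENNReal.coe_pow,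
        ENNReal.coe_toNNReal hBt]
      refine le_trans (lintegral_mono_set fun x hx => ?_)
        (setLIntegral_inv_one_add_abs_le (hfm n) (hP n) k)
      rw [mem_compl_iff, Metric.mem_closedBall, dist_zero_right, Real.norm_eq_abs, not_le] at hx
      exact hx.le)
  have hlim' : Tendsto ν (hyperfilter ℕ) (𝓝 ν₀) := hlim
  have hwm : Measurable fun x : ℝ => ENNReal.ofReal (1 + |x|) := by fun_prop
  have hwt : ∀ᵐ x : ℝ ∂(ν₀ : Measure ℝ), ENNReal.ofReal (1 + |x|) < ∞ :=
    Eventually.of_forall fun _ => ENNReal.ofReal_lt_top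
  have hw : ∀ x : ℝ, (ENNReal.ofReal (1 + |x|)).toReal = 1 + |x| := fun x =>
    ENNReal.toReal_ofReal (by positivity)
  refine ⟨(ν₀ : Measure ℝ).withDensity fun x => ENNReal.ofReal (1 + |x|), ?_, fun z hz => ?_⟩
  · rw [integrable_withDensity_iff hwm hwt]
    refine (integrable_const (1 : ℝ)).congr (Eventually.of_forall fun x => ?_)
    beta_reduce
    rw [hw, one_div_mul_cancel (by positivity)]
  set G : BoundedContinuousFunction ℝ ℂ := BoundedContinuousFunction.ofNormedAddCommGroup
    (fun x : ℝ => ((1 + |x| : ℝ) : ℂ) * ((x : ℂ) - z)⁻¹) (continuous_one_add_abs_mul_inv_sub hz)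
    _ (norm_one_add_abs_mul_inv_sub_le hz) with hG
  have hGx : ∀ x, G x = ((1 + |x| : ℝ) : ℂ) * ((x : ℂ) - z)⁻¹ := fun x => rfl
  have h1 := (FiniteMeasure.tendsto_iff_forall_integral_rclike_tendsto ℂ).1 hlim' G
  have h2 : ∀ n, ∫ x, G x ∂(ν n : Measure ℝ) = F (z + ε n * Complex.I) := fun n => by
    obtain ⟨C', hC'⟩ := hdecay _ (hε n)
    obtain ⟨hi, hval⟩ := schwarz_formula (s := 1 / 2) (by norm_num) (hdn n) hC' hz
    have h3 : ∫ x, G x ∂(ν n : Measure ℝ) =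
        ∫ x, (f n x * ENNReal.ofReal (1 / (1 + |x|))).toReal • G x :=
      integral_withDensity_eq_integral_toReal_smul ((hfm n).mul (by fun_prop))
        (Eventually.of_forall fun x => ENNReal.mul_lt_top ENNReal.ofReal_lt_top
          ENNReal.ofReal_lt_top) _
    have h4 : ∀ x, (f n x * ENNReal.ofReal (1 / (1 + |x|))).toReal • G x =
        (Real.pi : ℂ)⁻¹ * (((F (x + ε n * Complex.I)).im : ℂ) * ((x : ℂ) - z)⁻¹) := fun x => by
      have h5 : ((1 + |x| : ℝ) : ℂ) ≠ 0 := by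
        exact_mod_cast (by positivity : (1 + |x| : ℝ) ≠ 0)
      rw [ENNReal.toReal_mul, ENNReal.toReal_ofReal (div_nonneg (hg0 n x) hpi.le),
        ENNReal.toReal_ofReal (by positivity), hGx, Complex.real_smul, Complex.ofReal_mul,
        Complex.ofReal_div, Complex.ofReal_div, Complex.ofReal_one]
      field_simp
      rfl
    rw [h3]
    simp_rw [h4]
    rw [integral_const_mul, ← hval,
      inv_mul_cancel_left₀ (by exact_mod_cast hpi.ne')]
  have h3 : Tendsto (fun n => F (z + ε n * Complex.I)) (hyperfilter ℕ) (𝓝 (F z)) := by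
    refine ((hd z hz).continuousAt.tendsto.comp ?_).mono_left Nat.hyperfilter_le_atTop
    have h4 : Tendsto (fun n => z + ((ε n : ℝ) : ℂ) * Complex.I) atTop
        (𝓝 (z + ((0 : ℝ) : ℂ) * Complex.I)) :=
      ((((Complex.continuous_ofReal.tendsto 0).comp hε0).mul_const _).const_add z)
    simpa using h4
  simp_rw [h2] at h1
  rw [tendsto_nhds_unique h3 h1, integral_withDensity_eq_integral_toReal_smul hwm hwt]
  refine integral_congr_ae (Eventually.of_forall fun x => ?_)
  beta_reduce
  rw [hw, hGx, one_div, Complex.real_smul]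

end Existence

/-! ### The support of the representing measure -/

section Support

variable {a b c : ℕ → ℝ}

theorem isOpen_compl_gapSet : IsOpen (gapSet a b)ᶜ := by
  have h : (gapSet a b)ᶜ = Iio 0 ∪ ⋃ k, Ioo (a k) (b k) := by
    ext x
    rw [mem_compl_gapSet, mem_union, mem_iUnion, mem_Iio]
  rw [h]
  exact isOpen_Iio.union (isOpen_iUnion fun _ => isOpen_Ioo)

theorem re_gapLog (a b c : ℝ) (z : ℂ) : (gapLog a b c z).re =
    Real.log ‖z - c‖ - Real.log ‖z - a‖ / 2 - Real.log ‖z - b‖ / 2 := by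
  have h2 : ∀ w : ℂ, (w / 2).re = w.re / 2 := fun w => by simp
  rw [gapLog, Complex.sub_re, Complex.sub_re, h2, h2, Complex.log_re, Complex.log_re,
    Complex.log_re]

namespace GapSep

variable {x : ℝ} {k : ℕ} {d : ℝ}

theorem half (h : GapSep a b x k d) {x' : ℝ} (hx : |x' - x| ≤ d / 2) :
    GapSep a b x' k (d / 2) := by
  have key : ∀ t, d ≤ |t - x| → d / 2 ≤ |t - x'| := fun t ht => by
    have := abs_sub_le t x' x
    linarith
  refine ⟨half_pos h.pos, ?_, fun j hj t ht => key t (h.gap j hj t ht), key _ h.left,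
    key _ h.right⟩
  have := key 0 (by simpa using h.zero)
  simpa using this

/-- Away from the origin and from the endpoints of the gaps, `herglotzProd` stays bounded up to
the real line. -/
theorem exists_norm_exp_prodLog_le (h : GapSep a b x k d)
    (hlen : Summable fun j => b j - a j) (hc : ∀ j, c j ∈ Icc (a j) (b j)) :
    ∃ C : ℝ, ∀ x' : ℝ, |x' - x| ≤ d / 2 → ∀ ε : ℝ, 0 < ε → ε ≤ 1 →
      ‖Complex.exp (prodLog a b c (x' + ε * Complex.I))‖ ≤ C := by
  set L := ∑' j, (b j - a j)
  set K := |x| + d / 2 + |c k| + 1 with hK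
  have hd := h.pos
  refine ⟨1 / 2 * (d / 2) ^ (-(1 / 2) : ℝ) *
    (Real.exp (Real.log K - Real.log (d / 2)) * Real.exp (L / (2 * (d / 2)))),
    fun x' hx ε hε hε1 => ?_⟩
  have h' := h.half hx
  set z : ℂ := x' + ε * Complex.I with hz
  have hzim : 0 < z.im := by simpa [hz] using hε
  have hdist : ∀ t : ℝ, d / 2 ≤ |t - x'| → d / 2 ≤ ‖z - t‖ := fun t ht => by
    rw [norm_sub_rev]
    exact ht.trans (abs_sub_le_norm_vertical x' ε t)
  rw [norm_exp_prodLog (by simpa using ne_ofReal_of_im_pos hzim 0),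
    (summable_gapLog hlen hc hzim).tsum_eq_add_tsum_ite k, Complex.exp_add, norm_mul]
  have h1 : ‖z‖ ^ (-(1 / 2) : ℝ) ≤ (d / 2) ^ (-(1 / 2) : ℝ) :=
    Real.rpow_le_rpow_of_nonpos h'.pos (by simpa using hdist 0 (by simpa using h'.zero))
      (by norm_num)
  have h2 : ‖Complex.exp (gapLog (a k) (b k) (c k) z)‖ ≤
      Real.exp (Real.log K - Real.log (d / 2)) := by
    rw [Complex.norm_exp, re_gapLog]
    refine Real.exp_le_exp.2 ?_
    have hzc : ‖z - c k‖ ≤ K := by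
      have e : z - c k = ((x' - c k : ℝ) : ℂ) + ε * Complex.I := by rw [hz]; push_cast; ring
      rw [e]
      refine (norm_add_le _ _).trans ?_
      rw [Complex.norm_real, norm_mul, Complex.norm_I, mul_one, Complex.norm_real,
        Real.norm_eq_abs, Real.norm_eq_abs, abs_of_pos hε]
      have h3 : |x' - c k| ≤ |x'| + |c k| := abs_sub _ _
      have h4 := abs_sub_abs_le_abs_sub x' x
      linarith
    have h5 := Real.log_le_log (norm_pos_iff.2 (sub_ne_zero.2 (ne_ofReal_of_im_pos hzim _))) hzc
    have h6 := Real.log_le_log h'.pos (hdist _ h'.left)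
    have h7 := Real.log_le_log h'.pos (hdist _ h'.right)
    linarith
  have h3 : ‖Complex.exp (∑' j, if j = k then 0 else gapLog (a j) (b j) (c j) z)‖ ≤
      Real.exp (L / (2 * (d / 2))) := by
    rw [Complex.norm_exp]
    refine Real.exp_le_exp.2 ((Complex.re_le_norm _).trans ?_)
    refine tsum_of_norm_bounded (hlen.hasSum.div_const _) fun j => ?_
    split_ifs with hj
    · rw [norm_zero]
      exact div_nonneg (by linarith [(hc j).1, (hc j).2]) (by linarith)
    · exact norm_gapLog_vertical_le (hc j) h'.pos (h'.gap j hj) hε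
  gcongr

end GapSep

theorem im_I_mul_exp_prodLog_nonneg (ha : ∀ j, 0 ≤ a j)
    (hdisj : Pairwise fun j k => Disjoint (Ioo (a j) (b j)) (Ioo (a k) (b k)))
    (hlen : Summable fun j => b j - a j) (hc : ∀ j, c j ∈ Icc (a j) (b j)) {z : ℂ}
    (hz : 0 < z.im) : 0 ≤ (Complex.I * Complex.exp (prodLog a b c z)).im := by
  rw [Complex.I_mul_im, Complex.exp_re]
  exact mul_nonneg (Real.exp_pos _).le
    (Real.cos_nonneg_of_mem_Icc (abs_le.1 (abs_im_prodLog_le ha hdisj hlen hc hz).2))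

/-- A representing measure does not charge the gaps, because `herglotzProd` has real boundary
values there. -/
theorem IsHerglotzMeasure.measure_compl_gapSet {E : Set ℝ} {ρ : Measure ℝ}
    (h : IsHerglotzMeasure (herglotzProd a b c) E ρ)
    (ha : ∀ j, 0 ≤ a j) (hab : ∀ j, a j < b j)
    (hdisj : Pairwise fun j k => Disjoint (Ioo (a j) (b j)) (Ioo (a k) (b k)))
    (hlen : Summable fun j => b j - a j) (hc : ∀ j, c j ∈ Icc (a j) (b j)) :
    ρ (gapSet a b)ᶜ = 0 := by
  have := h.isLocallyFiniteMeasure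
  refine measure_null_of_locally_null _ fun x hx => ?_
  obtain ⟨k, d, hs⟩ := exists_gapSep ha hab hdisj hx
  obtain ⟨C, hC⟩ := hs.exists_norm_exp_prodLog_le hlen hc
  have hd := hs.pos
  set V := Metric.ball x (d / 2) ∩ (gapSet a b)ᶜ with hV
  have hVo : IsOpen V := Metric.isOpen_ball.inter isOpen_compl_gapSet
  refine ⟨V, mem_nhdsWithin_of_mem_nhds (hVo.mem_nhds ⟨Metric.mem_ball_self (by linarith), hx⟩), ?_⟩
  set ε : ℕ → ℝ := fun n => 1 / ((n : ℝ) + 1) with hεdef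
  have hε : ∀ n, 0 < ε n := fun n => Nat.one_div_pos_of_nat
  have hε1 : ∀ n, ε n ≤ 1 := fun n => by
    rw [hεdef, div_le_one (by positivity)]
    linarith [n.cast_nonneg (α := ℝ)]
  have hε0 : Tendsto ε atTop (𝓝 0) := tendsto_one_div_add_atTop_nhds_zero_nat
  have hεw : Tendsto ε atTop (𝓝[>] 0) :=
    tendsto_nhdsWithin_iff.2 ⟨hε0, Eventually.of_forall hε⟩
  have hm : ∀ (n : ℕ) (x : ℝ), herglotzProd a b c (x + ε n * Complex.I) =
      Complex.I * Complex.exp (prodLog a b c (x + ε n * Complex.I)) := fun n x =>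
    herglotzProd_eq hlen hc (by simpa using hε n)
  have hlim : Tendsto (fun n => ∫⁻ x in V,
      ENNReal.ofReal (herglotzProd a b c (x + ε n * Complex.I)).im) atTop (𝓝 0) := by
    have h0 : ∫⁻ x in V, (0 : ENNReal) = 0 := lintegral_zero
    rw [← h0]
    refine tendsto_lintegral_of_dominated_convergence' (fun _ => ENNReal.ofReal C) (fun n => ?_)
      (fun n => ?_) ?_ ?_
    · have := continuous_prodLog_horizontal (a := a) (b := b) (c := c) hlen hc (hε n)
      simp_rw [hm]
      exact (by fun_prop : Continuous fun x : ℝ => (Complex.I *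
        Complex.exp (prodLog a b c (x + ε n * Complex.I))).im).measurable.ennreal_ofReal.aemeasurable
    · refine (ae_restrict_iff' hVo.measurableSet).2 (Eventually.of_forall fun y hy => ?_)
      refine ENNReal.ofReal_le_ofReal ((Complex.im_le_norm _).trans ?_)
      rw [hm, norm_mul, Complex.norm_I, one_mul]
      have hy1 := hy.1
      rw [Metric.mem_ball, Real.dist_eq] at hy1
      exact hC y hy1.le _ (hε n) (hε1 n)
    · rw [setLIntegral_const]
      exact ENNReal.mul_ne_top ENNReal.ofReal_ne_top
        ((measure_mono inter_subset_left).trans_lt measure_ball_lt_top).ne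
    · refine (ae_restrict_iff' hVo.measurableSet).2 ?_
      filter_upwards [ae_tendsto_prodLog ha hab hdisj hlen hc] with y hy hyV
      obtain ⟨h1, h2, h3⟩ := hy hyV.2
      rw [← ENNReal.ofReal_zero, ← h3, h2]
      simp_rw [hm]
      exact (ENNReal.continuous_ofReal.tendsto _).comp ((Complex.continuous_im.tendsto _).comp
        (((Complex.continuous_exp.tendsto _).comp (h1.comp hεw)).const_mul _))
  have hle := pi_mul_measure_le_liminf (ρ := ρ)
    (u := fun x y => (herglotzProd a b c (x + y * Complex.I)).im)
    (fun x y hy => h.integrable_poissonLine_sub x hy) (fun x y hy => h.im_eq x hy) hε hε0 hVo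
  rw [hlim.liminf_eq] at hle
  have h1 := mul_eq_zero.1 (nonpos_iff_eq_zero.1 hle)
  exact h1.resolve_left (ENNReal.ofReal_pos.2 Real.pi_pos).ne'

theorem exists_isHerglotzMeasure (ha : ∀ j, 0 ≤ a j) (hab : ∀ j, a j < b j)
    (hdisj : Pairwise fun j k => Disjoint (Ioo (a j) (b j)) (Ioo (a k) (b k)))
    (hlen : Summable fun j => b j - a j) (hc : ∀ j, c j ∈ Icc (a j) (b j)) :
    ∃ ρ : Measure ℝ, IsHerglotzMeasure (herglotzProd a b c) (gapSet a b) ρ := by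
  set L := ∑' j, (b j - a j)
  have hL : 0 ≤ L := tsum_nonneg fun j => by linarith [(hc j).1, (hc j).2]
  obtain ⟨ρ, hρ, hrep⟩ := exists_measure_of_im_nonneg
    (F := fun z => Complex.I * Complex.exp (prodLog a b c z)) (C := Real.exp (L / 2))
    (fun z hz => (differentiableAt_prodLog hlen hc hz).cexp.const_mul _)
    (fun z hz => im_I_mul_exp_prodLog_nonneg ha hdisj hlen hc hz)
    (fun ε hε => by
      obtain ⟨C, hC⟩ := decay_exp_prodLog (a := a) (b := b) (c := c) hlen hc one_pos hε
      refine ⟨C, fun z hz => ?_⟩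
      simpa using hC z hz)
    (fun Y hY => by
      have him : ((Y : ℂ) * Complex.I).im = Y := by simp
      have h := norm_exp_prodLog_le (a := a) (b := b) (c := c) hlen hc
        (z := Y * Complex.I) (by rw [him]; linarith)
      rw [him, norm_mul, Complex.norm_I, mul_one, Complex.norm_real,
        Real.norm_of_nonneg (by linarith)] at h
      rw [norm_mul, Complex.norm_I, one_mul, mul_comm (Real.exp (L / 2))]
      refine h.trans (mul_le_mul_of_nonneg_left (Real.exp_le_exp.2 ?_) (by positivity))
      exact div_le_div_of_nonneg_left hL two_pos (by linarith))
  -- the support condition is void for `univ`, and is then deduced for `gapSet`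
  have h0 : IsHerglotzMeasure (herglotzProd a b c) univ ρ :=
    ⟨by simp, hρ, fun z hz => (herglotzProd_eq hlen hc hz).trans (hrep z hz)⟩
  exact ⟨ρ, h0.measure_compl_gapSet ha hab hdisj hlen hc, hρ, h0.eq_integral⟩

end Support

theorem theorem5p3 (a b c : ℕ → ℝ)
    (ha : ∀ j, 0 ≤ a j) (hab : ∀ j, a j < b j)
    (hdisj : Pairwise fun j k => Disjoint (Ioo (a j) (b j)) (Ioo (a k) (b k)))
    (hlen : Summable fun j => b j - a j)
    (hc : ∀ j, c j ∈ Icc (a j) (b j))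
    -- the balanced integrals over the two parts of each gap, both finite
    (hint : ∀ j, IntegrableOn (fun x : ℝ => herglotzProd a b c x) (Ioo (a j) (b j)))
    (hbal : ∀ j, -∫ x in (a j)..(c j), herglotzProd a b c x
      = ∫ x in (c j)..(b j), herglotzProd a b c x)
    -- integrability up to the origin from the left
    (hzero : IntegrableOn (fun x : ℝ => herglotzProd a b c x) (Ioo (-1) 0))
    -- the condition of Parreau-Widom type
    (hPW : Summable fun j => ∫ x in (c j)..(b j), herglotzProd a b c x) :
    (∃ ρ : Measure ℝ, IsHerglotzMeasure (herglotzProd a b c) (gapSet a b) ρ) ∧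
    ∀ ρ : Measure ℝ, IsHerglotzMeasure (herglotzProd a b c) (gapSet a b) ρ → ρ ≪ volume :=
  ⟨exists_isHerglotzMeasure ha hab hdisj hlen hc, fun _ hρ =>
    hρ.absolutelyContinuous ha hab hdisj hlen hc
      (integrableOn_norm_herglotzProd ha hab hdisj hlen hc hint hbal hzero hPW)⟩
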